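/- \textbf{Setting.} Let $f=\frac1n\sum_{i=1}^n f_i:\mathbb R^d\to\mathbb R$ ($d,n\ge 1$), where every $f_i$ is twice differentiable with $\|\nabla f_i(x)-\nabla f_i(y)\|\le \ell\|x-y\|$ and $\|\nabla^2 f_i(x)-\nabla^2 f_i(y)\|\le\rho\|x-y\|$ (operator norm) for all $x,y$, with $\rho>0$. Let $f$ be bounded below, $x_0\in\mathbb R^d$, $\Delta_f=f(x_0)-\inf f$, and let $\epsilon>0$, $0<\delta\le\ell$, $0<p<1$. A point $x$ is an $(\epsilon,\delta)$-approximate second-order stationary point if $\|\nabla f(x)\|\le\epsilon$ and $\nabla^2 f(x)\succeq-\delta I$. A query is one evaluation of $f$. \textbf{Estimators.} For $\mu>0$ and $u$ on the unit sphere, $$\hat\nabla_{coord}f(x)=\sum_{i=1}^d\frac{f(x+\mu e_i)-f(x-\mu e_i)}{2\mu}e_i,\qquad \hat\nabla_{rand}f(x)=d\,\frac{f(x+\mu u)-f(x-\mu u)}{2\mu}u,$$ $$\mathcal H_f(x)v=\sum_{i=1}^d\frac{f(x+v+\mu e_i)-f(x+v-\mu e_i)+f(x-\mu e_i)-f(x+\mu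 e_i)}{2\mu}e_i .$$ \textbf{ZO-NCF-Deterministic}$(f,z,\delta,q)$ with constant $C_1$. Put $T=\lceil C_1^2\log(d/q)\sqrt{\ell/\delta}\,\rceil$, $\sigma=(d/q)^{-2C_1}\delta/(T^4\rho)$, $r=(d/q)^{C_1}\sigma$. Draw $\xi'\sim\mathcal N(0,I)$ and set $y_0=0$, $y_1=\sigma\xi'/\|\xi'\|$. For $t=1,\dots,T$ let $\mathcal M(y_t)=-\frac1\ell\mathcal H_f(z)y_t+(1-\frac{3\delta}{4\ell})y_t$ (with $\mu=\|y_t\|$), $y_{t+1}=2\mathcal M(y_t)-y_{t-1}$, $w_{t+1}=y_{t+1}-\mathcal M(y_t)$; if $\|w_{t+1}\|\ge r$, return $v=w_{t+1}/\|w_{t+1}\|$. If the loop ends, return $\bot$. \textbf{ZO-GD-NCF.} For $t=0,\dots,K-1$: if $\|\hat\nabla_{coord}f(x_t)\|\ge\frac{3\epsilon}4$ (with $\mu=\mu_1$), set $x_{t+1}=x_t-\eta\hat\nabla_{coord}f(x_t)$ (Option I) or $x_{t+1}=x_t-\eta\hat\nabla_{rand}f(x_t)$ with $u$ uniform on the unit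 sphere (Option II), in both cases with $\mu=\mu_2$. Otherwise let $v$ be the result of ZO-NCF-Deterministic$(f,x_t,\delta,p/K)$; if $v=\bot$, output $x_t$ and stop, else set $x_{t+1}=x_t\pm\frac\delta\rho v$ with a uniformly random sign. All random choices are independent. If the loop ends, there is no output. \textbf{Parameters.} Put $\Lambda=\min\bigl\{\frac1p,\ (1+\frac{\rho^2\epsilon^2}{\delta^4})\log^2\frac2p\bigr\}$, $\mu_1=\sqrt{\frac{3\epsilon}{2\rho\sqrt d}}$, $C_1=c_1(1+\log\frac\ell\delta)$, $K=\bigl\lceil c_K\bigl(\frac{\rho^2\Delta_f}{\delta^3}+\kappa\frac{\ell\Delta_f}{\epsilon^2}+1\bigr)\Lambda\bigr\rceil$, and Option I: $\kappa=1$, $\eta=\frac1{4\ell}$, $\mu_2=\sqrt{\frac{3\epsilon}{4\rho\sqrt d}}$; Option II: $\kappa=d$, $\eta=\frac1{8d\ell}$, $\mu_2=\min\bigl\{\sqrt{\frac{3\epsilon}{4\rho d}},\frac{\epsilon}{16\sqrt d\,\ell}\bigr\}$. \textbf{Theorem.} There are absolute constants $c_1,c_K,c_Q>0$ and $m\in\mathbb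 N$ such that in the above setting, for either option, with probability at least $1-p$, ZO-GD-NCF outputs an $(\epsilon,\delta)$-approximate second-order stationary point of $f$ and makes at most $$c_Q\left(\kappa\,\frac{d\,\ell\Delta_f}{\epsilon^2}+d\,\frac{\sqrt\ell}{\sqrt\delta}\Bigl(\frac{\rho^2\Delta_f}{\delta^3}+1\Bigr)\right)\Lambda\ \log^m\!\left(\frac{3d\,\ell}{p\,\delta}\Bigl(1+\frac{\rho^2\Delta_f}{\delta^3}+\frac{\ell\Delta_f}{\epsilon^2}\Bigr)\right)$$ function queries. In particular, for fixed $p$, and also for all $p$ whenever $\delta\ge\sqrt{\rho\epsilon}$, the query complexity is $\tilde{\mathcal O}\bigl(\frac{d\ell\Delta_f}{\epsilon^2}+d\frac{\sqrt\ell}{\sqrt\delta}(\frac{\rho^2\Delta_f}{\delta^3}+1)\bigr)$ for Option I, with $d^2$ in place of $d$ in the first term for Option II. -/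

import Mathlib

open MeasureTheory ProbabilityTheory

noncomputable section

namespace ZO

/-- Euclidean space `ℝ^d`. -/
abbrev Vec (d : ℕ) : Type := EuclideanSpace ℝ (Fin d)

/-- The `i`-th standard basis vector of `ℝ^d`. -/
def basisVec {d : ℕ} (i : Fin d) : Vec d := EuclideanSpace.single i 1

/-! ### The problem class -/

/-- The Hessian of `f` at `x`, as the Fréchet derivative of the gradient. -/
def hessian {d : ℕ} (f : Vec d → ℝ) (x : Vec d) : Vec d →L[ℝ] Vec d :=
  fderiv ℝ (gradient f) x

/-- `f` is twice differentiable on `ℝ^d`. -/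
def TwiceDifferentiable {d : ℕ} (f : Vec d → ℝ) : Prop :=
  Differentiable ℝ f ∧ Differentiable ℝ (gradient f)

/-- `f` is `ℓ`-Lipschitz smooth. -/
def LipschitzSmooth {d : ℕ} (l : ℝ) (f : Vec d → ℝ) : Prop :=
  ∀ x y : Vec d, ‖gradient f x - gradient f y‖ ≤ l * ‖x - y‖

/-- `f` is `ρ`-Hessian Lipschitz (in the operator norm). -/
def HessianLipschitz {d : ℕ} (ρ : ℝ) (f : Vec d → ℝ) : Prop :=
  ∀ x y : Vec d, ‖hessian f x - hessian f y‖ ≤ ρ * ‖x - y‖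

/-- `x` is an `(ε, δ)`-approximate second-order stationary point of `f`:
`‖∇f(x)‖ ≤ ε` and `∇²f(x) ⪰ -δ I`. -/
def IsSOSP {d : ℕ} (ε δ : ℝ) (f : Vec d → ℝ) (x : Vec d) : Prop :=
  ‖gradient f x‖ ≤ ε ∧ ∀ v : Vec d, -δ * ‖v‖ ^ 2 ≤ inner ℝ v (hessian f x v)

/-- The finite-sum objective `f = (1/n) ∑ fᵢ`. -/
def finiteSum {d n : ℕ} (fs : Fin n → Vec d → ℝ) (x : Vec d) : ℝ :=
  (1 / (n : ℝ)) * ∑ i, fs i x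

/-! ### Programs that access a function only through its values -/

/-- A program with access to an unknown function `X → ℝ` through value queries:
it either returns a result, or queries the function at a point and continues with the answer. -/
inductive Prog (X : Type) (α : Type) : Type
  | ret (a : α) : Prog X α
  | query (x : X) (next : ℝ → Prog X α) : Prog X α

namespace Prog

variable {X α β : Type}

/-- Sequential composition. -/
def bind : Prog X α → (α → Prog X β) → Prog X β
  | ret a, g => g a
  | query x next, g => query x (fun y => (next y).bind g)

instance : Monad (Prog X) where
  pure := ret
  bind := bind

/-- The result of the program when the queried function is `f`. -/
def eval (f : X → ℝ) : Prog X α → α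
  | ret a => a
  | query x next => (next (f x)).eval f

/-- The number of function queries made by the program when the queried function is `f`. -/
def cost (f : X → ℝ) : Prog X α → ℕ
  | ret _ => 0
  | query x next => (next (f x)).cost f + 1

/-- A single function query, returning the value at `x`. -/
def ask (x : X) : Prog X ℝ := query x ret

/-- Run finitely many programs one after the other and collect their results. -/
def collect : {n : ℕ} → (Fin n → Prog X α) → Prog X (Fin n → α)
  | 0, _ => pure (fun i => i.elim0)
  | _ + 1, g => do
      let a ← g 0
      let s ← collect (fun i => g i.succ)
      pure (Fin.cons a s)

end Prog

/-! ### Zeroth-order estimators -/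

/-- The coordinate-wise gradient estimator
`∑ᵢ (f(x + μ eᵢ) - f(x - μ eᵢ)) / (2μ) eᵢ`. -/
def coordGradEst {d : ℕ} (μ : ℝ) (x : Vec d) : Prog (Vec d) (Vec d) := do
  let c ← Prog.collect (fun i : Fin d => do
    let a ← Prog.ask (x + μ • basisVec i)
    let b ← Prog.ask (x - μ • basisVec i)
    pure ((a - b) / (2 * μ)))
  pure (∑ i, c i • basisVec i)

/-- The random gradient estimator `d (f(x + μ u) - f(x - μ u)) / (2μ) u` with direction `u`. -/
def randGradEst {d : ℕ} (μ : ℝ) (u x : Vec d) : Prog (Vec d) (Vec d) := do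
  let a ← Prog.ask (x + μ • u)
  let b ← Prog.ask (x - μ • u)
  pure (((d : ℝ) * ((a - b) / (2 * μ))) • u)

/-- The coordinate-wise Hessian-vector product estimator `𝓗_f(x) v`, equal to
`∑ᵢ (f(x + v + μ eᵢ) - f(x + v - μ eᵢ) + f(x - μ eᵢ) - f(x + μ eᵢ)) / (2μ) eᵢ`. -/
def hessVecEst {d : ℕ} (μ : ℝ) (x v : Vec d) : Prog (Vec d) (Vec d) := do
  let c ← Prog.collect (fun i : Fin d => do
    let a₁ ← Prog.ask (x + v + μ • basisVec i)
    let a₂ ← Prog.ask (x + v - μ • basisVec i)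
    let a₃ ← Prog.ask (x - μ • basisVec i)
    let a₄ ← Prog.ask (x + μ • basisVec i)
    pure ((a₁ - a₂ + a₃ - a₄) / (2 * μ)))
  pure (∑ i, c i • basisVec i)

/-! ### ZO-NCF-Deterministic -/

/-- The main loop of ZO-NCF-Deterministic, with the given number of remaining iterations.
The last two arguments are `y_{t-1}` and `y_t`; the result `none` is the symbol `⊥`. -/
def ncfLoop {d : ℕ} (l δ r : ℝ) (x₀ : Vec d) :
    ℕ → Vec d → Vec d → Prog (Vec d) (Option (Vec d))
  | 0, _, _ => pure none
  | T + 1, yprev, y => do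
      let h ← hessVecEst ‖y‖ x₀ y
      let My : Vec d := -((1 / l) • h) + (1 - 3 * δ / (4 * l)) • y
      let ynext : Vec d := (2 : ℝ) • My - yprev
      let xnext : Vec d := x₀ + ynext - My
      if r ≤ ‖xnext - x₀‖ then
        pure (some ((1 / ‖xnext - x₀‖) • (xnext - x₀)))
      else
        ncfLoop l δ r x₀ T y ynext

/-- The iteration number of ZO-NCF-Deterministic, `T = C₁² log(d/q) √ℓ / √δ`, rounded up. -/
def ncfT (d : ℕ) (l δ q C₁ : ℝ) : ℕ :=
  ⌈C₁ ^ 2 * Real.log (d / q) * √l / √δ⌉₊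

/-- The perturbation size `σ = (d/q)^(-2C₁) δ / (T⁴ ρ)`. -/
def ncfSigma (d : ℕ) (l ρ δ q C₁ : ℝ) : ℝ :=
  ((d : ℝ) / q) ^ (-(2 * C₁)) * (δ / ((ncfT d l δ q C₁ : ℝ) ^ 4 * ρ))

/-- The stopping radius `r = (d/q)^C₁ σ`. -/
def ncfRadius (d : ℕ) (l ρ δ q C₁ : ℝ) : ℝ :=
  ((d : ℝ) / q) ^ C₁ * ncfSigma d l ρ δ q C₁

/-- ZO-NCF-Deterministic at the point `x₀` with accuracy `δ`, confidence parameter `q` and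
constant `C₁`; `ξ'` is the sampled standard Gaussian vector. -/
def ncfDeterministic {d : ℕ} (l ρ δ q C₁ : ℝ) (ξ' x₀ : Vec d) :
    Prog (Vec d) (Option (Vec d)) :=
  ncfLoop l δ (ncfRadius d l ρ δ q C₁) x₀ (ncfT d l δ q C₁) 0
    ((ncfSigma d l ρ δ q C₁ / ‖ξ'‖) • ξ')

/-! ### ZO-GD-NCF -/

/-- The two versions of the gradient step: Option I (coordinate-wise estimator) and
Option II (random estimator). -/
inductive Version : Type
  | optionI : Version
  | optionII : Version

/-- The step size: `1/(4ℓ)` for Option I, `1/(8dℓ)` for Option II. -/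
def stepSize (o : Version) (d : ℕ) (l : ℝ) : ℝ :=
  match o with
  | Version.optionI => 1 / (4 * l)
  | Version.optionII => 1 / (8 * d * l)

/-- The smoothing parameter of the gradient test. -/
def mu₁ (d : ℕ) (ρ ε : ℝ) : ℝ := √(3 * ε / (2 * ρ * √(d : ℝ)))

/-- The smoothing parameter of the gradient step. -/
def mu₂ (o : Version) (d : ℕ) (l ρ ε : ℝ) : ℝ :=
  match o with
  | Version.optionI => √(3 * ε / (4 * ρ * √(d : ℝ)))
  | Version.optionII => min (√(3 * ε / (4 * ρ * d))) (ε / (16 * √(d : ℝ) * l))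

/-- The fresh randomness of one iteration of ZO-GD-NCF: the Gaussian vector handed to
ZO-NCF-Deterministic, the direction of the random gradient estimator, and the sign of the
negative curvature step. -/
abbrev Seed (d : ℕ) : Type := Vec d × Vec d × Bool

/-- The Gaussian vector of a seed. -/
def Seed.gauss {d : ℕ} (s : Seed d) : Vec d := s.1

/-- The random direction of a seed. -/
def Seed.dir {d : ℕ} (s : Seed d) : Vec d := s.2.1

/-- The random sign of a seed. -/
def Seed.sign {d : ℕ} (s : Seed d) : Bool := s.2.2

/-- `+1` or `-1`. -/
def signValue (b : Bool) : ℝ := if b then 1 else -1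

/-- The gradient estimate used in the gradient step. -/
def stepGrad {d : ℕ} (o : Version) (l ρ ε : ℝ) (s : Seed d) (x : Vec d) :
    Prog (Vec d) (Vec d) :=
  match o with
  | Version.optionI => coordGradEst (mu₂ o d l ρ ε) x
  | Version.optionII => randGradEst (mu₂ o d l ρ ε) (Seed.dir s) x

/-- The main loop of ZO-GD-NCF with `m` remaining iterations, current point `x`, and confidence
parameter `q` for the calls of ZO-NCF-Deterministic.
The result `none` means that the iterations were used up without returning a point. -/
def gdLoop {d : ℕ} (o : Version) (l ρ ε δ q C₁ : ℝ) :
    (m : ℕ) → (Fin m → Seed d) → Vec d → Prog (Vec d) (Option (Vec d))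
  | 0, _, _ => pure none
  | m + 1, ω, x => do
      let g ← coordGradEst (mu₁ d ρ ε) x
      if 3 * ε / 4 ≤ ‖g‖ then do
        let h ← stepGrad o l ρ ε (ω 0) x
        gdLoop o l ρ ε δ q C₁ m (fun i => ω i.succ) (x - stepSize o d l • h)
      else do
        let w ← ncfDeterministic l ρ δ q C₁ (Seed.gauss (ω 0)) x
        match w with
        | none => pure (some x)
        | some v =>
            gdLoop o l ρ ε δ q C₁ m (fun i => ω i.succ)
              (x + (signValue (Seed.sign (ω 0)) * (δ / ρ)) • v)

/-- ZO-GD-NCF with `K` iterations, started at `x₀`; each call of ZO-NCF-Deterministic gets the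
confidence parameter `p / K`. -/
def zoGDNCF {d : ℕ} (o : Version) (l ρ ε δ p C₁ : ℝ) (K : ℕ) (ω : Fin K → Seed d)
    (x₀ : Vec d) : Prog (Vec d) (Option (Vec d)) :=
  gdLoop o l ρ ε δ (p / K) C₁ K ω x₀

/-! ### The law of the randomness -/

/-- The uniform distribution on the unit sphere of `ℝ^d`, as a measure on `ℝ^d`. -/
def sphereUniform (d : ℕ) : Measure (Vec d) :=
  (((volume : Measure (Vec d)).toSphere Set.univ)⁻¹ •
    (volume : Measure (Vec d)).toSphere).map Subtype.val

/-- The fair coin. -/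
def coin : Measure Bool := (PMF.uniformOfFintype Bool).toMeasure

/-- The law of the randomness of one iteration: a standard Gaussian vector, a uniform direction
and a uniform sign, independent. -/
def seedLaw (d : ℕ) : Measure (Seed d) :=
  (stdGaussian (Vec d)).prod ((sphereUniform d).prod coin)

/-- The law of the randomness of `K` independent iterations. -/
def runLaw (d K : ℕ) : Measure (Fin K → Seed d) :=
  Measure.pi (fun _ => seedLaw d)

/-! ### Parameters and complexity bounds -/

/-- The constant `C₁` of ZO-NCF-Deterministic: an absolute constant times `1 + log(ℓ/δ)`. -/
def ncfConst (c₁ l δ : ℝ) : ℝ := c₁ * (1 + Real.log (l / δ))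

/-- The dimension factor of the gradient steps: `1` for Option I, `d` for Option II. -/
def dimFactor (o : Version) (d : ℕ) : ℝ :=
  match o with
  | Version.optionI => 1
  | Version.optionII => d

/-- The confidence factor `Λ = min {1/p, (1 + ρ²ε²/δ⁴) log²(2/p)}`. -/
def confFactor (ρ ε δ p : ℝ) : ℝ :=
  min (1 / p) ((1 + ρ ^ 2 * ε ^ 2 / δ ^ 4) * Real.log (2 / p) ^ 2)

/-- The number of iterations `K = ⌈c (ρ²Δ/δ³ + κ ℓΔ/ε² + 1) Λ⌉` with `κ = 1` for Option I and
`κ = d` for Option II. -/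
def iterations (o : Version) (d : ℕ) (c l ρ ε δ p Δ : ℝ) : ℕ :=
  ⌈c * (ρ ^ 2 * Δ / δ ^ 3 + dimFactor o d * (l * Δ / ε ^ 2) + 1) * confFactor ρ ε δ p⌉₊

/-- The leading term of the query complexity,
`d κ ℓΔ/ε² + d √(ℓ/δ) (ρ²Δ/δ³ + 1)`. -/
def queryTerm (o : Version) (d : ℕ) (l ρ ε δ Δ : ℝ) : ℝ :=
  d * dimFactor o d * (l * Δ / ε ^ 2) + d * (√l / √δ) * (ρ ^ 2 * Δ / δ ^ 3 + 1)

/-- The logarithm whose powers are hidden in the soft-O notation. -/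
def logTerm (d : ℕ) (l ρ ε δ p Δ : ℝ) : ℝ :=
  Real.log (3 * (d / p) * (l / δ) * (1 + ρ ^ 2 * Δ / δ ^ 3 + l * Δ / ε ^ 2))

end ZO

end

noncomputable section
namespace ZO

/-! ### Taylor estimates -/

/-! The proof combines a deterministic analysis of one negative curvature call, the average effect
of one step on `f`, and a potential argument over the whole run.

A call at `x` runs the Chebyshev recurrence for `M = (1 - 3δ/(4ℓ)) I - ∇²f(x)/ℓ`. Without estimation
error the tested vector `w` is `T_t(M) y₁`. Hessian eigenvalues at least `-3δ/4` land in `[-1, 1]`,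
where `T_t` is bounded by one; an eigenvalue below `-δ` lands beyond `1 + δ/(4ℓ)`, where `T_t` grows
like `exp(t √(δ/ℓ)/2)`. This accelerated rate is the source of the factor `√(ℓ/δ)`. A large `w` is
therefore dominated by negative curvature, and its absence after `T` steps certifies `∇²f ⪰ -δ I`.
The estimation error is quadratic in the tiny iterates, so it stays a small fraction of the growing
component (`chebyshev_recurrence_error`, `exists_direction_forall_chebyshev_recurrence`). All this
needs only that `y₁` is not almost orthogonal to a bottom eigenvector, which a Gaussian direction
violates with probability at most `q/4` (`stdGaussian_not_ncfCorrect_le`).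

On average a gradient step lowers `f` by `G = gradDecrease` and a curvature step by `N =
curvDecrease`; the random sign cancels the first-order term of the latter. Option II uses the second
and fourth moments of a uniform direction.

A run fails if it ends without a correct output or exceeds a separate budget of `k` curvature steps;
the second budget keeps the expensive calls proportional to `ρ²Δ/δ³ + 1` rather than to `K`. Any
potential that is at least one on exhausted budgets and does not increase on average bounds the
failure probability (`runLaw_fails_le`). A potential linear in `f - inf f` gives the factor `1/p`.
Exponential ones give the factor `(1 + ρ²ε²/δ⁴) log²(2/p)`: one tolerates the fluctuation of the
signed steps, the other treats an initial gap so small that most likely no curvature step ever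
occurs. -/

lemma norm_sub_le_of_norm_deriv_le_mul_pow {E : Type*} [NormedAddCommGroup E] [NormedSpace ℝ E]
    {φ φ' : ℝ → E} (hφ : ∀ t, HasDerivAt φ (φ' t) t) (C : ℝ) (n : ℕ)
    (hb : ∀ t ∈ Set.Ico (0 : ℝ) 1, ‖φ' t‖ ≤ C * t ^ n) : ‖φ 1 - φ 0‖ ≤ C / (n + 1) := by
  have hB : ∀ t : ℝ, HasDerivAt (fun t : ℝ => C / (n + 1) * t ^ (n + 1)) (C * t ^ n) t := by
    intro t
    have h := (hasDerivAt_pow (n + 1) t).const_mul (C / ((n : ℝ) + 1))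
    refine h.congr_deriv ?_
    have : (n : ℝ) + 1 ≠ 0 := by positivity
    simp only [Nat.cast_add, Nat.cast_one, Nat.add_sub_cancel]
    field_simp
  -- Comparison with the explicit primitive `C t^(n+1)/(n+1)` replaces integration of `φ'`; the
  -- cases `n = 1` and `n = 2` give every Taylor bound below.
  have := image_norm_le_of_norm_deriv_right_le_deriv_boundary (f := fun t => φ t - φ 0)
    (f' := φ') (a := 0) (b := 1)
    (fun t _ => ((hφ t).sub_const (φ 0)).continuousAt.continuousWithinAt)
    (fun t _ => ((hφ t).sub_const (φ 0)).hasDerivWithinAt)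
    (B := fun t : ℝ => C / (n + 1) * t ^ (n + 1)) (B' := fun t => C * t ^ n) (by simp)
    (fun t => hB t) hb (x := 1) (by simp)
  simpa using this

/-- `f` is twice differentiable with `l`-Lipschitz gradient and `ρ`-Lipschitz Hessian. -/
structure IsSmooth {d : ℕ} (l ρ : ℝ) (f : Vec d → ℝ) : Prop where
  diff : TwiceDifferentiable f
  lip : LipschitzSmooth l f
  hess : HessianLipschitz ρ f

lemma hasGradientAt_finiteSum {d n : ℕ} {fs : Fin n → Vec d → ℝ}
    (h : ∀ i, Differentiable ℝ (fs i)) (x : Vec d) :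
    HasGradientAt (finiteSum fs) ((1 / (n : ℝ)) • ∑ i, gradient (fs i) x) x := by
  rw [hasGradientAt_iff_hasFDerivAt]
  have h1 : HasFDerivAt (fun x => ∑ i, fs i x)
      (∑ i, InnerProductSpace.toDual ℝ (Vec d) (gradient (fs i) x)) x :=
    HasFDerivAt.fun_sum fun i _ => (h i x).hasGradientAt.hasFDerivAt
  have h2 := h1.const_mul (1 / (n : ℝ))
  refine h2.congr_fderiv ?_
  rw [map_smulₛₗ, map_sum]
  rfl

lemma gradient_finiteSum {d n : ℕ} {fs : Fin n → Vec d → ℝ}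
    (h : ∀ i, Differentiable ℝ (fs i)) :
    gradient (finiteSum fs) = fun x => (1 / (n : ℝ)) • ∑ i, gradient (fs i) x :=
  funext fun x => (hasGradientAt_finiteSum h x).gradient

lemma norm_average_le {n : ℕ} (hn : 0 < n) {E : Type*} [NormedAddCommGroup E] [NormedSpace ℝ E]
    {v : Fin n → E} {C : ℝ} (h : ∀ i, ‖v i‖ ≤ C) : ‖(1 / (n : ℝ)) • ∑ i, v i‖ ≤ C := by
  have hn' : (0 : ℝ) < n := by exact_mod_cast hn
  have h1 : ‖∑ i, v i‖ ≤ n * C := by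
    refine (norm_sum_le _ _).trans ((Finset.sum_le_sum fun i _ => h i).trans ?_)
    simp
  rw [norm_smul, Real.norm_of_nonneg (by positivity)]
  calc 1 / (n : ℝ) * ‖∑ i, v i‖ ≤ 1 / (n : ℝ) * (n * C) := by gcongr
    _ = C := by field_simp

/-- Gradient and Hessian are averages, so both Lipschitz constants survive; from here on only the
average `f` matters. -/
lemma IsSmooth.finiteSum {d n : ℕ} (hn : 0 < n) {l ρ : ℝ} {fs : Fin n → Vec d → ℝ}
    (h : ∀ i, IsSmooth l ρ (fs i)) : IsSmooth l ρ (finiteSum fs) := by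
  have hg := gradient_finiteSum fun i => (h i).diff.1
  have hd : ∀ x, HasFDerivAt (gradient (ZO.finiteSum fs))
      ((1 / (n : ℝ)) • ∑ i, hessian (fs i) x) x := by
    intro x
    rw [hg]
    exact (HasFDerivAt.fun_sum (u := Finset.univ)
      fun i _ => ((h i).diff.2 x).hasFDerivAt).const_smul (1 / (n : ℝ))
  refine ⟨⟨fun x => (hasGradientAt_finiteSum (fun i => (h i).diff.1) x).differentiableAt,
    fun x => (hd x).differentiableAt⟩, fun x y => ?_, fun x y => ?_⟩
  · simp only [hg, ← smul_sub, ← Finset.sum_sub_distrib]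
    exact norm_average_le hn fun i => (h i).lip x y
  · have e : ∀ z, hessian (ZO.finiteSum fs) z = (1 / (n : ℝ)) • ∑ i, hessian (fs i) z :=
      fun z => (hd z).fderiv
    have e' : hessian (ZO.finiteSum fs) x - hessian (ZO.finiteSum fs) y =
        (1 / (n : ℝ)) • ∑ i, (hessian (fs i) x - hessian (fs i) y) := by
      rw [e, e, Finset.sum_sub_distrib, smul_sub]
    rw [e']
    exact norm_average_le hn fun i => (h i).hess x y

section Taylor

variable {d : ℕ} {l ρ : ℝ} {f : Vec d → ℝ}

lemma IsSmooth.continuous (h : IsSmooth l ρ f) : Continuous f := h.diff.1.continuous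

lemma IsSmooth.continuous_gradient (h : IsSmooth l ρ f) : Continuous (gradient f) :=
  h.diff.2.continuous

lemma IsSmooth.continuous_hessian (h : IsSmooth l ρ f) : Continuous (hessian f) := by
  have : LipschitzWith ρ.toNNReal (hessian f) := by
    refine LipschitzWith.of_dist_le_mul fun x y => ?_
    rw [dist_eq_norm, dist_eq_norm]
    refine (h.hess x y).trans ?_
    gcongr
    exact Real.le_coe_toNNReal ρ
  exact this.continuous

lemma IsSmooth.hasDerivAt_line (h : IsSmooth l ρ f) (x v : Vec d) (t : ℝ) :
    HasDerivAt (fun t : ℝ => f (x + t • v)) (inner ℝ (gradient f (x + t • v)) v) t := by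
  have h1 : HasDerivAt (fun t : ℝ => x + t • v) v t := by
    simpa using ((hasDerivAt_id t).smul_const v).const_add x
  exact ((h.diff.1 (x + t • v)).hasGradientAt.hasFDerivAt).comp_hasDerivAt t h1

lemma IsSmooth.hasDerivAt_gradient_line (h : IsSmooth l ρ f) (x v : Vec d) (t : ℝ) :
    HasDerivAt (fun t : ℝ => gradient f (x + t • v)) (hessian f (x + t • v) v) t := by
  have h1 : HasDerivAt (fun t : ℝ => x + t • v) v t := by
    simpa using ((hasDerivAt_id t).smul_const v).const_add x
  exact ((h.diff.2 (x + t • v)).hasFDerivAt).comp_hasDerivAt t h1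

lemma IsSmooth.abs_sub_linear_le (h : IsSmooth l ρ f) (x v : Vec d) :
    |f (x + v) - f x - inner ℝ (gradient f x) v| ≤ l / 2 * ‖v‖ ^ 2 := by
  have key := norm_sub_le_of_norm_deriv_le_mul_pow
    (φ := fun t : ℝ => f (x + t • v) - t * inner ℝ (gradient f x) v)
    (φ' := fun t => inner ℝ (gradient f (x + t • v)) v - inner ℝ (gradient f x) v)
    (fun t => ((h.hasDerivAt_line x v t).fun_sub
      ((hasDerivAt_id' t).mul_const (inner ℝ (gradient f x) v))).congr_deriv (by ring)) (l * ‖v‖ ^ 2) 1 ?_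
  · have e : f (x + v) - f x - inner ℝ (gradient f x) v =
        (fun t : ℝ => f (x + t • v) - t * inner ℝ (gradient f x) v) 1 -
        (fun t : ℝ => f (x + t • v) - t * inner ℝ (gradient f x) v) 0 := by
      simp; ring
    rw [e, ← Real.norm_eq_abs]
    refine key.trans (le_of_eq ?_)
    norm_num; ring
  · intro t ht
    rw [← inner_sub_left]
    refine (norm_inner_le_norm _ _).trans ?_
    have := h.lip (x + t • v) x
    rw [add_sub_cancel_left, norm_smul, Real.norm_of_nonneg ht.1] at this
    calc _ ≤ (l * (t * ‖v‖)) * ‖v‖ := by gcongr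
      _ = _ := by ring

lemma IsSmooth.norm_gradient_sub_linear_le (h : IsSmooth l ρ f) (x v : Vec d) :
    ‖gradient f (x + v) - gradient f x - hessian f x v‖ ≤ ρ / 2 * ‖v‖ ^ 2 := by
  have key := norm_sub_le_of_norm_deriv_le_mul_pow
    (φ := fun t : ℝ => gradient f (x + t • v) - t • hessian f x v)
    (φ' := fun t => hessian f (x + t • v) v - hessian f x v)
    (fun t => ((h.hasDerivAt_gradient_line x v t).fun_sub
      ((hasDerivAt_id' t).smul_const (hessian f x v))).congr_deriv (by rw [one_smul])) (ρ * ‖v‖ ^ 2) 1 ?_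
  · have e : gradient f (x + v) - gradient f x - hessian f x v =
        (fun t : ℝ => gradient f (x + t • v) - t • hessian f x v) 1 -
        (fun t : ℝ => gradient f (x + t • v) - t • hessian f x v) 0 := by
      simp; abel
    rw [e]
    refine key.trans (le_of_eq ?_)
    norm_num; ring
  · intro t ht
    rw [← sub_apply]
    refine (ContinuousLinearMap.le_opNorm _ _).trans ?_
    have := h.hess (x + t • v) x
    rw [add_sub_cancel_left, norm_smul, Real.norm_of_nonneg ht.1] at this
    calc _ ≤ (ρ * (t * ‖v‖)) * ‖v‖ := by gcongr
      _ = _ := by ring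

lemma IsSmooth.abs_sub_quadratic_le (h : IsSmooth l ρ f) (x v : Vec d) :
    |f (x + v) - f x - inner ℝ (gradient f x) v - inner ℝ v (hessian f x v) / 2| ≤
      ρ / 6 * ‖v‖ ^ 3 := by
  have key := norm_sub_le_of_norm_deriv_le_mul_pow
    (φ := fun t : ℝ => f (x + t • v) - t * inner ℝ (gradient f x) v
      - t ^ 2 * (inner ℝ v (hessian f x v) / 2))
    (φ' := fun t => inner ℝ (gradient f (x + t • v)) v - inner ℝ (gradient f x) v
      - t * inner ℝ v (hessian f x v))
    (fun t => (((h.hasDerivAt_line x v t).fun_sub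
      ((hasDerivAt_id' t).mul_const (inner ℝ (gradient f x) v))).fun_sub
      ((hasDerivAt_pow 2 t).mul_const (inner ℝ v (hessian f x v) / 2))).congr_deriv
        (by norm_num; ring)) (ρ / 2 * ‖v‖ ^ 3) 2 ?_
  · have e : f (x + v) - f x - inner ℝ (gradient f x) v - inner ℝ v (hessian f x v) / 2 =
        (fun t : ℝ => f (x + t • v) - t * inner ℝ (gradient f x) v
          - t ^ 2 * (inner ℝ v (hessian f x v) / 2)) 1 -
        (fun t : ℝ => f (x + t • v) - t * inner ℝ (gradient f x) v
          - t ^ 2 * (inner ℝ v (hessian f x v) / 2)) 0 := by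
      simp; ring
    rw [e, ← Real.norm_eq_abs]
    refine key.trans (le_of_eq ?_)
    norm_num; ring
  · intro t ht
    have e : inner ℝ (gradient f (x + t • v)) v - inner ℝ (gradient f x) v
        - t * inner ℝ v (hessian f x v)
        = inner ℝ (gradient f (x + t • v) - gradient f x - hessian f x (t • v)) v := by
      rw [inner_sub_left, inner_sub_left, map_smul, real_inner_smul_left,
        real_inner_comm v (hessian f x v)]
    rw [e]
    refine (norm_inner_le_norm _ _).trans ?_
    have := h.norm_gradient_sub_linear_le x (t • v)
    rw [norm_smul, Real.norm_of_nonneg ht.1] at this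
    calc _ ≤ (ρ / 2 * (t * ‖v‖) ^ 2) * ‖v‖ := by gcongr
      _ = _ := by ring

/-- The quadratic Taylor terms at `v` and `-v` cancel, leaving a cubic error; divided by the radius,
this makes the coordinate estimator accurate to second order. -/
lemma IsSmooth.abs_central_sub_le (h : IsSmooth l ρ f) (x v : Vec d) :
    |(f (x + v) - f (x - v)) / 2 - inner ℝ (gradient f x) v| ≤ ρ / 6 * ‖v‖ ^ 3 := by
  have h1 := abs_le.1 (h.abs_sub_quadratic_le x v)
  have h2 := abs_le.1 (h.abs_sub_quadratic_le x (-v))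
  simp only [map_neg, inner_neg_right, inner_neg_left, norm_neg, ← sub_eq_add_neg, neg_neg] at h2
  rw [abs_le]
  constructor <;> linarith [h1.1, h1.2, h2.1, h2.2]

/-- The first-order version, paid for by gradient smoothness only; it serves the random estimator of
Option II. -/
lemma IsSmooth.abs_central_sub_le' (h : IsSmooth l ρ f) (x v : Vec d) :
    |(f (x + v) - f (x - v)) / 2 - inner ℝ (gradient f x) v| ≤ l / 2 * ‖v‖ ^ 2 := by
  have h1 := abs_le.1 (h.abs_sub_linear_le x v)
  have h2 := abs_le.1 (h.abs_sub_linear_le x (-v))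
  simp only [inner_neg_right, norm_neg, ← sub_eq_add_neg] at h2
  rw [abs_le]
  constructor <;> linarith [h1.1, h1.2, h2.1, h2.2]

lemma IsSmooth.norm_hessian_le (h : IsSmooth l ρ f) (hl : 0 ≤ l) (x : Vec d) :
    ‖hessian f x‖ ≤ l := by
  have : LipschitzWith l.toNNReal (gradient f) := by
    refine LipschitzWith.of_dist_le_mul fun x y => ?_
    rw [dist_eq_norm, dist_eq_norm, Real.coe_toNNReal l hl]
    exact h.lip x y
  exact (norm_fderiv_le_of_lipschitz ℝ (x₀ := x) this).trans (Real.coe_toNNReal l hl).le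

/-- Symmetry gives access to an orthonormal eigenbasis of the Hessian. -/
lemma IsSmooth.inner_hessian_comm (h : IsSmooth l ρ f) (x v w : Vec d) :
    inner ℝ (hessian f x v) w = inner ℝ v (hessian f x w) := by
  have hf : ∀ y, HasFDerivAt f (InnerProductSpace.toDual ℝ (Vec d) (gradient f y)) y :=
    fun y => (h.diff.1 y).hasGradientAt.hasFDerivAt
  have hx : HasFDerivAt (fun y => innerSL ℝ (gradient f y))
      ((innerSL ℝ).comp (hessian f x)) x :=
    (innerSL ℝ (E := Vec d)).hasFDerivAt.comp x (h.diff.2 x).hasFDerivAt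
  have := second_derivative_symmetric (f := f) (f' := fun y => innerSL ℝ (gradient f y)) hf hx v w
  simpa [real_inner_comm] using this

end Taylor

end ZO
end

noncomputable section
namespace ZO

/-! ### Running programs -/

namespace Prog

variable {X α β : Type} (f : X → ℝ)

@[simp] lemma eval_pure (a : α) : (pure a : Prog X α).eval f = a := rfl

@[simp] lemma cost_pure (a : α) : (pure a : Prog X α).cost f = 0 := rfl

@[simp] lemma eval_ask (x : X) : (ask x).eval f = f x := rfl

@[simp] lemma cost_ask (x : X) : (ask x).cost f = 1 := rfl

@[simp] lemma eval_bind (a : Prog X α) (g : α → Prog X β) :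
    (a >>= g).eval f = (g (a.eval f)).eval f := by
  induction a with
  | ret a => rfl
  | query x next ih => exact ih (f x)

@[simp] lemma cost_bind (a : Prog X α) (g : α → Prog X β) :
    (a >>= g).cost f = a.cost f + (g (a.eval f)).cost f := by
  induction a with
  | ret a => exact (Nat.zero_add _).symm
  | query x next ih =>
    have : (query x next >>= g).cost f = (next (f x) >>= g).cost f + 1 := rfl
    rw [this, ih (f x)]
    simp only [cost, eval]
    omega

@[simp] lemma eval_collect {n : ℕ} (g : Fin n → Prog X α) :
    (collect g).eval f = fun i => (g i).eval f := by
  induction n with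
  | zero => funext i; exact i.elim0
  | succ n ih =>
    funext i
    simp only [collect, eval_bind, eval_pure, ih]
    refine Fin.cases ?_ (fun j => ?_) i <;> simp

lemma cost_collect {n : ℕ} (g : Fin n → Prog X α) {c : ℕ} (h : ∀ i, (g i).cost f = c) :
    (collect g).cost f = n * c := by
  induction n with
  | zero => simp [collect]
  | succ n ih =>
    simp only [collect, cost_bind, cost_pure, h, ih (fun i => g i.succ) fun i => h i.succ]
    ring

end Prog

variable {d : ℕ} {l ρ : ℝ} {f : Vec d → ℝ}

/-! ### The estimators -/

lemma coordGradEst_eval (μ : ℝ) (x : Vec d) :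
    (coordGradEst μ x).eval f =
      ∑ i, ((f (x + μ • basisVec i) - f (x - μ • basisVec i)) / (2 * μ)) • basisVec i := by
  simp [coordGradEst]

lemma coordGradEst_cost (μ : ℝ) (x : Vec d) : (coordGradEst μ x).cost f = d * 2 := by
  simp only [coordGradEst, Prog.cost_bind, Prog.cost_pure, add_zero]
  exact Prog.cost_collect f _ fun i => by simp

lemma randGradEst_eval (μ : ℝ) (u x : Vec d) :
    (randGradEst μ u x).eval f =
      ((d : ℝ) * ((f (x + μ • u) - f (x - μ • u)) / (2 * μ))) • u := by
  simp [randGradEst]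

lemma randGradEst_cost (μ : ℝ) (u x : Vec d) : (randGradEst μ u x).cost f = 2 := by
  simp [randGradEst]

lemma hessVecEst_eval (μ : ℝ) (x v : Vec d) :
    (hessVecEst μ x v).eval f =
      ∑ i, ((f (x + v + μ • basisVec i) - f (x + v - μ • basisVec i) + f (x - μ • basisVec i)
        - f (x + μ • basisVec i)) / (2 * μ)) • basisVec i := by
  simp [hessVecEst]

lemma hessVecEst_cost (μ : ℝ) (x v : Vec d) : (hessVecEst μ x v).cost f = d * 4 := by
  simp only [hessVecEst, Prog.cost_bind, Prog.cost_pure, add_zero]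
  exact Prog.cost_collect f _ fun i => by simp

lemma norm_basisVec (i : Fin d) : ‖(basisVec i : Vec d)‖ = 1 := by
  simp [basisVec]

lemma inner_basisVec (v : Vec d) (i : Fin d) : inner ℝ v (basisVec i) = v i := by
  simp [basisVec, EuclideanSpace.inner_single_right]

lemma sum_smul_basisVec_apply (c : Fin d → ℝ) (j : Fin d) :
    (∑ i, c i • basisVec i : Vec d) j = c j := by
  simp [basisVec, Finset.sum_apply, Pi.single_apply]

lemma norm_le_sqrt_mul_of_abs_apply_le {v : Vec d} {c : ℝ} (h : ∀ i, |v i| ≤ c) :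
    ‖v‖ ≤ √d * c := by
  rcases Nat.eq_zero_or_pos d with rfl | hd
  · simp [EuclideanSpace.norm_eq]
  have hc : 0 ≤ c := (abs_nonneg _).trans (h ⟨0, hd⟩)
  rw [EuclideanSpace.norm_eq]
  refine Real.sqrt_le_iff.2 ⟨by positivity, ?_⟩
  rw [mul_pow, Real.sq_sqrt (Nat.cast_nonneg d)]
  calc ∑ i, ‖v i‖ ^ 2 ≤ ∑ _i : Fin d, c ^ 2 := by
        refine Finset.sum_le_sum fun i _ => ?_
        have := h i
        rw [Real.norm_eq_abs]
        gcongr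
    _ = d * c ^ 2 := by simp

lemma IsSmooth.abs_coord_sub_le (h : IsSmooth l ρ f) {μ : ℝ} (hμ : 0 < μ) (x : Vec d)
    (i : Fin d) :
    |(f (x + μ • basisVec i) - f (x - μ • basisVec i)) / (2 * μ) - gradient f x i| ≤
      ρ / 6 * μ ^ 2 := by
  have := h.abs_central_sub_le x (μ • basisVec i)
  rw [norm_smul, norm_basisVec, inner_smul_right, inner_basisVec, Real.norm_of_nonneg hμ.le,
    mul_one] at this
  have e : (f (x + μ • basisVec i) - f (x - μ • basisVec i)) / (2 * μ) - gradient f x i =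
      ((f (x + μ • basisVec i) - f (x - μ • basisVec i)) / 2 - μ * gradient f x i) / μ := by
    field_simp
  rw [e, abs_div, abs_of_pos hμ, div_le_iff₀ hμ]
  linarith

lemma IsSmooth.norm_coordGradEst_sub_le (h : IsSmooth l ρ f) {μ : ℝ} (hμ : 0 < μ) (x : Vec d) :
    ‖(coordGradEst μ x).eval f - gradient f x‖ ≤ √d * (ρ / 6 * μ ^ 2) := by
  refine norm_le_sqrt_mul_of_abs_apply_le fun i => ?_
  rw [coordGradEst_eval, PiLp.sub_apply, sum_smul_basisVec_apply]
  exact h.abs_coord_sub_le hμ x i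

/-- With radius `‖v‖`, the two coordinate estimates and the linearization of the gradient all err by
`O(ρ ‖v‖²)`. This quadratic order is what the perturbation analysis relies on. -/
lemma IsSmooth.norm_hessVecEst_sub_le (h : IsSmooth l ρ f) (hρ : 0 ≤ ρ) (hd : 0 < d)
    (x v : Vec d) :
    ‖(hessVecEst ‖v‖ x v).eval f - hessian f x v‖ ≤ √d * ρ * ‖v‖ ^ 2 := by
  -- At `v = 0` the radius vanishes, but the four function values cancel and both sides are zero.
  rcases eq_or_ne v 0 with rfl | hv
  · simp [hessVecEst_eval]
  have hμ : 0 < ‖v‖ := norm_pos_iff.2 hv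
  have h1 : ‖(hessVecEst ‖v‖ x v).eval f - (gradient f (x + v) - gradient f x)‖ ≤
      √d * (ρ / 3 * ‖v‖ ^ 2) := by
    refine norm_le_sqrt_mul_of_abs_apply_le fun i => ?_
    rw [hessVecEst_eval, PiLp.sub_apply, sum_smul_basisVec_apply, PiLp.sub_apply]
    have a := h.abs_coord_sub_le hμ (x + v) i
    have b := h.abs_coord_sub_le hμ x i
    have e : (f (x + v + ‖v‖ • basisVec i) - f (x + v - ‖v‖ • basisVec i)
        + f (x - ‖v‖ • basisVec i) - f (x + ‖v‖ • basisVec i)) / (2 * ‖v‖)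
        = (f (x + v + ‖v‖ • basisVec i) - f (x + v - ‖v‖ • basisVec i)) / (2 * ‖v‖)
          - (f (x + ‖v‖ • basisVec i) - f (x - ‖v‖ • basisVec i)) / (2 * ‖v‖) := by
      ring
    rw [e]
    rw [abs_le] at a b ⊢
    constructor <;> linarith [a.1, a.2, b.1, b.2]
  have h2 := h.norm_gradient_sub_linear_le x v
  have h3 : (1 : ℝ) ≤ √d := by
    rw [Real.one_le_sqrt]
    exact_mod_cast hd
  calc ‖(hessVecEst ‖v‖ x v).eval f - hessian f x v‖
      = ‖((hessVecEst ‖v‖ x v).eval f - (gradient f (x + v) - gradient f x)) +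
          (gradient f (x + v) - gradient f x - hessian f x v)‖ := by congr 1; abel
    _ ≤ √d * (ρ / 3 * ‖v‖ ^ 2) + 1 * (ρ / 2 * ‖v‖ ^ 2) := by
        rw [one_mul]; exact (norm_add_le _ _).trans (add_le_add h1 h2)
    _ ≤ √d * (ρ / 3 * ‖v‖ ^ 2) + √d * (ρ / 2 * ‖v‖ ^ 2) := by gcongr
    _ ≤ √d * ρ * ‖v‖ ^ 2 := by
        have : 0 ≤ √d * ρ * ‖v‖ ^ 2 := by positivity
        linarith

end ZO
end

noncomputable section
namespace ZO

/-! ### Chebyshev polynomials -/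

open Polynomial Polynomial.Chebyshev

/-- On `[-1, 1]` the polynomial is bounded by one; beyond it, `T_k(cosh φ) = cosh(kφ)`. -/
lemma abs_eval_T_le_exp {θ x : ℝ} (hθ : 0 ≤ θ) (h₁ : -1 ≤ x) (h₂ : x ≤ Real.cosh θ) (k : ℕ) :
    |(T ℝ k).eval x| ≤ Real.exp θ ^ k := by
  have he : 1 ≤ Real.exp θ ^ k := one_le_pow₀ (Real.one_le_exp hθ)
  rcases le_total x 1 with hx | hx
  · exact (abs_eval_T_real_le_one k (abs_le.2 ⟨h₁, hx⟩)).trans he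
  · have h3 : Real.arcosh x ≤ θ := by
      rw [← Real.arcosh_cosh hθ]
      exact (Real.arcosh_le_arcosh (by linarith) (Real.cosh_pos θ)).2 h₂
    have h4 : 0 ≤ Real.arcosh x := Real.arcosh_nonneg hx
    rw [← Real.cosh_arcosh hx, T_real_cosh, abs_of_pos (Real.cosh_pos _), ← Real.exp_nat_mul]
    have h5 : 0 ≤ (k : ℝ) * Real.arcosh x := by positivity
    have h6 : Real.cosh ((k : ℝ) * Real.arcosh x) ≤ Real.exp ((k : ℝ) * Real.arcosh x) := by
      rw [Real.cosh_eq]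
      have : Real.exp (-((k : ℝ) * Real.arcosh x)) ≤ Real.exp ((k : ℝ) * Real.arcosh x) :=
        Real.exp_le_exp.2 (by linarith)
      linarith
    refine h6.trans (Real.exp_le_exp.2 ?_)
    gcongr

/-- In `U_{k+1} = X U_k + T_{k+1}` multiplication by `x` costs a factor `exp θ`, and each `T` adds
one more unit of `exp θ ^ (k+1)`. -/
lemma abs_eval_U_le_exp {θ x : ℝ} (hθ : 0 ≤ θ) (h₁ : -1 ≤ x) (h₂ : x ≤ Real.cosh θ) (k : ℕ) :
    |(U ℝ k).eval x| ≤ (k + 1) * Real.exp θ ^ k := by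
  have hx : |x| ≤ Real.exp θ := by
    refine abs_le.2 ⟨by linarith [Real.one_le_exp hθ], h₂.trans ?_⟩
    have : Real.exp (-θ) ≤ Real.exp θ := Real.exp_le_exp.2 (by linarith)
    rw [Real.cosh_eq]
    linarith
  induction k with
  | zero => simp
  | succ k ih =>
    have hT := abs_eval_T_le_exp hθ h₁ h₂ (k + 1)
    push_cast at hT ⊢
    rw [U_eq_X_mul_U_add_T, eval_add, eval_mul, eval_X]
    refine (abs_add_le _ _).trans ?_
    rw [abs_mul]
    calc |x| * |(U ℝ k).eval x| + |(T ℝ (k + 1)).eval x|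
        ≤ Real.exp θ * ((k + 1) * Real.exp θ ^ k) + Real.exp θ ^ (k + 1) := by gcongr
      _ = _ := by ring

lemma exp_pow_le_two_mul_eval_T (θ : ℝ) (k : ℕ) :
    Real.exp θ ^ k ≤ 2 * (T ℝ k).eval (Real.cosh θ) := by
  rw [T_real_cosh, ← Real.exp_nat_mul, Real.cosh_eq]
  have := Real.exp_pos (-((k : ℤ) * θ : ℝ))
  push_cast at this ⊢
  linarith

/-! ### Chebyshev polynomials of a diagonalized operator and the perturbed recurrence. -/

section Operator

variable {d : ℕ} {M : Vec d →ₗ[ℝ] Vec d} {b : OrthonormalBasis (Fin d) ℝ (Vec d)}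
  {x : Fin d → ℝ}

lemma inner_aeval_apply (hM : ∀ j, M (b j) = x j • b j) (p : ℝ[X]) (v : Vec d) (j : Fin d) :
    inner ℝ (b j) (aeval M p v) = p.eval (x j) * inner ℝ (b j) v := by
  have hb : ∀ i, aeval M p (b i) = p.eval (x i) • b i := fun i =>
    Module.End.aeval_apply_of_hasEigenvector
      ⟨Module.End.mem_eigenspace_iff.2 (hM i), b.orthonormal.ne_zero i⟩
  conv_lhs => rw [← b.sum_repr' v]
  simp only [map_sum, map_smul, hb, inner_sum, inner_smul_right,
    orthonormal_iff_ite.1 b.orthonormal]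
  simp [mul_comm]

lemma norm_aeval_apply_le (hM : ∀ j, M (b j) = x j • b j) {p : ℝ[X]} {C : ℝ} (hC : 0 ≤ C)
    (hp : ∀ j, |p.eval (x j)| ≤ C) (v : Vec d) : ‖aeval M p v‖ ≤ C * ‖v‖ := by
  refine le_of_sq_le_sq ?_ (by positivity)
  rw [mul_pow, ← b.sum_sq_norm_inner_right, ← b.sum_sq_norm_inner_right v, Finset.mul_sum]
  refine Finset.sum_le_sum fun j _ => ?_
  rw [inner_aeval_apply hM, norm_mul, mul_pow, Real.norm_eq_abs]
  gcongr
  exact hp j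

lemma aeval_two_mul_apply (M : Vec d →ₗ[ℝ] Vec d) (p : ℝ[X]) (v : Vec d) :
    aeval M (2 * p) v = (2 : ℝ) • aeval M p v := by
  rw [two_mul, map_add, LinearMap.add_apply, two_smul]

/-- Discrete Duhamel formula: a source injected at time `i` is propagated by the fundamental
solution `U`. The last summand has index `-1` and vanishes. -/
lemma chebyshev_recurrence_eq {D g : ℕ → Vec d} (h0 : D 0 = 0) (h1 : D 1 = 0)
    (hD : ∀ n, D (n + 2) = (2 : ℝ) • M (D (n + 1)) - D n + g n) (n : ℕ) :
    D n = ∑ i ∈ Finset.range n, aeval M (U ℝ ((n : ℤ) - 2 - i)) (g i) := by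
  induction n using Nat.twoStepInduction with
  | zero => simp [h0]
  | one => simp [h1]
  | more n ih1 ih2 =>
    have hU : ∀ i : ℕ, ∀ v, aeval M (U ℝ ((n : ℤ) - i)) v =
        (2 : ℝ) • M (aeval M (U ℝ ((n : ℤ) - 1 - i)) v) - aeval M (U ℝ ((n : ℤ) - 2 - i)) v := by
      intro i v
      rw [U_eq ℝ ((n : ℤ) - i)]
      have e1 : (n : ℤ) - i - 1 = n - 1 - i := by ring
      have e2 : (n : ℤ) - i - 2 = n - 2 - i := by ring
      rw [e1, e2]
      rw [mul_assoc, map_sub, LinearMap.sub_apply, aeval_two_mul_apply, map_mul, aeval_X,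
        Module.End.mul_apply]
    rw [hD, Finset.sum_range_succ, Finset.sum_range_succ, ih1, ih2, Finset.sum_range_succ]
    push_cast
    have e0 : ∀ i : ℕ, (n : ℤ) + 2 - 2 - i = n - i := fun i => by ring
    have e1 : ∀ i : ℕ, (n : ℤ) + 1 - 2 - i = n - 1 - i := fun i => by ring
    have e2 : (n : ℤ) - 1 - n = -1 := by ring
    have e3 : (n : ℤ) + 2 - 2 - (n + 1) = -1 := by ring
    simp only [e3, e0, e1, e2, hU, Finset.sum_sub_distrib, U_neg_one, map_zero,
      LinearMap.zero_apply, add_zero, Finset.smul_sum, map_sum, sub_self, U_zero, map_one, Module.End.one_apply]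

/-- Of the two factors in `‖y‖²`, one is bounded by `2Nr`, which holds before stopping, and the
other by the exponential growth of the exact solution. The quadratic error thus acts as a linear one
with small coefficient, and Duhamel's formula adds at most `N` terms, each bounded by `8cN³r ‖y 1‖
z^s`. -/
lemma chebyshev_recurrence_error (hM : ∀ j, M (b j) = x j • b j) {z : ℝ} (hz : 1 ≤ z)
    (hU : ∀ j (k : ℕ), |(U ℝ k).eval (x j)| ≤ (k + 1) * z ^ k)
    {y e : ℕ → Vec d} {c r κ : ℝ} {N : ℕ} (hc : 0 ≤ c)
    (hy0 : y 0 = 0) (hy : ∀ n, y (n + 2) = (2 : ℝ) • (M (y (n + 1)) - e n) - y n)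
    (he : ∀ n, ‖e n‖ ≤ c * ‖y (n + 1)‖ ^ 2) (hr : ‖y 1‖ ≤ r)
    (hκ : 8 * c * N ^ 4 * r ≤ κ) (hκ1 : κ ≤ 1) {n : ℕ} (hn : n < N)
    (hw : ∀ m < n, ‖(1 / 2 : ℝ) • (y (m + 2) - y m)‖ < r) :
    ‖(1 / 2 : ℝ) • (y (n + 2) - y n) - aeval M (T ℝ ((n + 1 : ℕ) : ℤ)) (y 1)‖ ≤
      κ * ‖y 1‖ * z ^ (n + 1) := by
  have hr0 : 0 ≤ r := (norm_nonneg _).trans hr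
  have hN : (1 : ℝ) ≤ N := by exact_mod_cast (show 1 ≤ N by omega)
  have hκ0 : 0 ≤ κ := le_trans (by positivity) hκ
  have hz0 : 0 ≤ z := by linarith
  -- a priori bound before stopping
  have hy1 : ∀ s, s ≤ n + 1 → ‖y s‖ ≤ r + s * r := by
    intro s
    induction s using Nat.twoStepInduction with
    | zero => intro _; simp [hy0, hr0]
    | one => intro _; simp; linarith
    | more s ih1 _ =>
      intro hs
      have h1 := (hw s (by omega)).le
      rw [norm_smul, Real.norm_of_nonneg (by norm_num)] at h1
      have h2 := ih1 (by omega)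
      have h3 : ‖y (s + 2)‖ ≤ ‖y (s + 2) - y s‖ + ‖y s‖ := by
        simpa using norm_add_le (y (s + 2) - y s) (y s)
      push_cast
      linarith
  have hyN : ∀ s, s ≤ n + 1 → ‖y s‖ ≤ 2 * N * r := by
    intro s hs
    have hs' : (s : ℝ) ≤ N := by exact_mod_cast (show s ≤ N by omega)
    have : (s : ℝ) * r ≤ N * r := by gcongr
    have : 1 * r ≤ N * r := by gcongr
    linarith [hy1 s hs]
  let D : ℕ → Vec d := fun s => y s - aeval M (U ℝ ((s : ℤ) - 1)) (y 1)
  have hD0 : D 0 = 0 := by simp [D, hy0]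
  have hD1 : D 1 = 0 := by simp [D]
  have hD : ∀ s, D (s + 2) = (2 : ℝ) • M (D (s + 1)) - D s + (-(2 : ℝ)) • e s := by
    intro s
    simp only [D]
    rw [hy]
    have e1 : ((s + 2 : ℕ) : ℤ) - 1 = (s - 1) + 2 := by push_cast; ring
    have e2 : ((s + 1 : ℕ) : ℤ) - 1 = (s - 1) + 1 := by push_cast; ring
    rw [e1, e2, U_add_two, mul_assoc, map_sub, LinearMap.sub_apply, aeval_two_mul_apply, map_mul,
      aeval_X, Module.End.mul_apply, map_sub]
    module
  have hsum := chebyshev_recurrence_eq hD0 hD1 hD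
  have hUn : ∀ (k : ℕ) (v : Vec d), ‖aeval M (U ℝ k) v‖ ≤ ((k + 1) * z ^ k) * ‖v‖ := fun k v =>
    norm_aeval_apply_le hM (by positivity) (fun j => hU j k) v
  have hDb : ∀ s, s ≤ n + 1 → ‖D (s + 1)‖ ≤ κ * ‖y 1‖ * z ^ s := by
    intro s
    induction s using Nat.strong_induction_on with
    | _ s ih =>
      intro hs
      have hyz : ∀ i < s, ‖y (i + 1)‖ ≤ 2 * ((i + 1) * z ^ i) * ‖y 1‖ := by
        intro i hi
        have h1 := ih i hi (by omega)
        have h2 : y (i + 1) = D (i + 1) + aeval M (U ℝ i) (y 1) := by simp [D]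
        have h3 := hUn i (y 1)
        rw [h2]
        refine (norm_add_le _ _).trans ?_
        have h4 : κ * ‖y 1‖ * z ^ i ≤ (i + 1) * ‖y 1‖ * z ^ i := by
          gcongr
          have : (0 : ℝ) ≤ i := Nat.cast_nonneg i
          linarith
        linarith
      rw [hsum, Finset.sum_range_succ]
      have e1 : ((s + 1 : ℕ) : ℤ) - 2 - s = -1 := by push_cast; ring
      rw [e1, U_neg_one, map_zero, LinearMap.zero_apply, add_zero]
      have hsN : (s : ℝ) ≤ N := by exact_mod_cast (show s ≤ N by omega)
      have hterm : ∀ i ∈ Finset.range s,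
          ‖aeval M (U ℝ (((s + 1 : ℕ) : ℤ) - 2 - i)) (-(2 : ℝ) • e i)‖ ≤
            8 * c * N ^ 3 * r * ‖y 1‖ * z ^ s := by
        intro i hi
        have hi := Finset.mem_range.1 hi
        obtain ⟨k, rfl⟩ : ∃ k, s = i + k + 1 := ⟨s - i - 1, by omega⟩
        have e2 : ((i + k + 1 + 1 : ℕ) : ℤ) - 2 - i = (k : ℕ) := by push_cast; ring
        rw [e2]
        refine (hUn k _).trans ?_
        rw [norm_smul, norm_neg, Real.norm_of_nonneg zero_le_two]
        have hk : ((k : ℝ) + 1) ≤ N := by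
          have : (0 : ℝ) ≤ i := Nat.cast_nonneg i
          push_cast at hsN
          linarith
        have hi' : ((i : ℝ) + 1) ≤ N := by
          have : (0 : ℝ) ≤ k := Nat.cast_nonneg k
          push_cast at hsN
          linarith
        have h5 : ‖y (i + 1)‖ ^ 2 ≤ (2 * N * r) * (2 * (N * z ^ i) * ‖y 1‖) := by
          rw [sq]
          have := hyz i hi
          gcongr
          · exact hyN _ (by omega)
          · exact this.trans (by gcongr)
        calc (k + 1) * z ^ k * (2 * ‖e i‖)
            ≤ N * z ^ k * (2 * (c * ((2 * N * r) * (2 * (N * z ^ i) * ‖y 1‖)))) := by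
              gcongr
              exact (he i).trans (by gcongr)
          _ = 8 * c * N ^ 3 * r * ‖y 1‖ * z ^ (i + k) := by rw [pow_add]; ring
          _ ≤ 8 * c * N ^ 3 * r * ‖y 1‖ * z ^ (i + k + 1) :=
              mul_le_mul_of_nonneg_left (pow_le_pow_right₀ hz (Nat.le_succ _)) (by positivity)
      refine (norm_sum_le_of_le _ hterm).trans ?_
      rw [Finset.sum_const, Finset.card_range, nsmul_eq_mul]
      calc (s : ℝ) * (8 * c * N ^ 3 * r * ‖y 1‖ * z ^ s)
          ≤ N * (8 * c * N ^ 3 * r * ‖y 1‖ * z ^ s) := by gcongr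
        _ = (8 * c * N ^ 4 * r) * (‖y 1‖ * z ^ s) := by ring
        _ ≤ κ * (‖y 1‖ * z ^ s) := by gcongr
        _ = κ * ‖y 1‖ * z ^ s := by ring
  have hDn : ‖D n‖ ≤ κ * ‖y 1‖ * z ^ (n + 1) := by
    rcases n with _ | n
    · rw [hD0, norm_zero]; positivity
    · exact (hDb n (by omega)).trans
        (mul_le_mul_of_nonneg_left (pow_le_pow_right₀ hz (by omega)) (by positivity))
  -- The identity `2 T_{n+1} = U_{n+1} - U_{n-1}` transfers the error of `y` to that of the tested
  -- vector.
  have hT : (1 / 2 : ℝ) • (y (n + 2) - y n) - aeval M (T ℝ ((n + 1 : ℕ) : ℤ)) (y 1) =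
      (1 / 2 : ℝ) • (D (n + 2) - D n) := by
    have h2 := two_mul_T_eq_U_sub_U ℝ ((n : ℤ) - 1)
    have e1 : (n : ℤ) - 1 + 2 = ((n + 1 : ℕ) : ℤ) := by push_cast; ring
    rw [e1] at h2
    have h3 := congrArg (fun p => aeval M p (y 1)) h2
    simp only [map_sub, aeval_two_mul_apply, LinearMap.sub_apply] at h3
    have e2 : ((n + 2 : ℕ) : ℤ) - 1 = ((n + 1 : ℕ) : ℤ) := by push_cast; ring
    simp only [D, e2]
    have h4 : aeval M (T ℝ ((n + 1 : ℕ) : ℤ)) (y 1) =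
        (1 / 2 : ℝ) • (aeval M (U ℝ ((n + 1 : ℕ) : ℤ)) (y 1) - aeval M (U ℝ ((n : ℤ) - 1)) (y 1)) := by
      rw [← h3, smul_smul]; norm_num
    rw [h4]
    module
  rw [hT, norm_smul, Real.norm_of_nonneg (by norm_num)]
  have := norm_sub_le (D (n + 2)) (D n)
  have := hDb (n + 1) le_rfl
  linarith

end Operator

end ZO
end

noncomputable section
namespace ZO

/-! ### Negative curvature from the perturbed Chebyshev recurrence -/

open Polynomial.Chebyshev in
-- Here `u` is a bottom eigenvector of `H`, chosen before the sequence `y`, so that it can later be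
-- tested against a random start. The parameters are the perturbation-to-radius ratio `A`, the least
-- admissible overlap `τ` with `u`, and the relative error `κ`.
theorem exists_direction_forall_chebyshev_recurrence {d : ℕ} (hd : 0 < d) {l δ : ℝ}
    (hδ : 0 < δ) (hδl : δ ≤ l) {H : Vec d →L[ℝ] Vec d}
    (hsym : ∀ v w, inner ℝ (H v) w = inner ℝ v (H w)) (hH : ‖H‖ ≤ l) :
    ∃ u : Vec d, ‖u‖ = 1 ∧ ∀ (y e : ℕ → Vec d) (c r τ A κ : ℝ) (N : ℕ),
      0 ≤ c → y 0 = 0 →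
      (∀ n, y (n + 2) = (2 : ℝ) • (-((1 / l) • H (y (n + 1)))
        + (1 - 3 * δ / (4 * l)) • y (n + 1) - e n) - y n) →
      (∀ n, ‖e n‖ ≤ c * ‖y (n + 1)‖ ^ 2) →
      0 < ‖y 1‖ → ‖y 1‖ = A * r → A < 1 / 2 → 0 < r →
      0 < τ → τ ≤ 1 → τ * ‖y 1‖ < |inner ℝ u (y 1)| →
      8 * c * N ^ 4 * r ≤ κ → κ ≤ τ / 4 →
      2 * (A ^ 2 + (4 * κ / τ) ^ 2) ≤ δ / (8 * l) →
      r ≤ ‖y 1‖ * τ / 4 * Real.exp (√(δ / l) / 2 * N) → 0 < N →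
      ((∀ m < N, ‖(1 / 2 : ℝ) • (y (m + 2) - y m)‖ < r) →
        ∀ v, -δ * ‖v‖ ^ 2 ≤ inner ℝ v (H v)) ∧
      ∀ n < N, (∀ m < n, ‖(1 / 2 : ℝ) • (y (m + 2) - y m)‖ < r) →
        ∀ w, w = (1 / 2 : ℝ) • (y (n + 2) - y n) → r ≤ ‖w‖ →
        inner ℝ w (H w) ≤ -(δ / 2) * ‖w‖ ^ 2 := by
  have hl : 0 < l := hδ.trans_le hδl
  have hsymm : (H : Vec d →ₗ[ℝ] Vec d).IsSymmetric := fun v w => hsym v w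
  have hfin : Module.finrank ℝ (Vec d) = d := by simp
  set b := hsymm.eigenvectorBasis hfin with hb
  set ev := hsymm.eigenvalues hfin with hev
  have hHb : ∀ j, H (b j) = ev j • b j := fun j =>
    hsymm.apply_eigenvectorBasis hfin j
  have hevl : ∀ j, |ev j| ≤ l := by
    intro j
    have h1 := H.le_opNorm (b j)
    rw [hHb, norm_smul, b.orthonormal.1 j, mul_one, mul_one] at h1
    exact h1.trans hH
  have : Nonempty (Fin d) := ⟨⟨0, hd⟩⟩
  obtain ⟨j₀, hj₀⟩ := Finite.exists_min ev
  have hquad : ∀ v, inner ℝ v (H v) = ∑ j, ev j * (inner ℝ (b j) v) ^ 2 := by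
    intro v
    rw [← b.sum_inner_mul_inner v (H v)]
    refine Finset.sum_congr rfl fun j _ => ?_
    rw [← hsym, hHb, inner_smul_left, real_inner_comm (b j) v]
    simp; ring
  have hnorm : ∀ v, ‖v‖ ^ 2 = ∑ j, (inner ℝ (b j) v) ^ 2 := by
    intro v
    rw [← b.sum_sq_norm_inner_right v]
    simp
  let M : Vec d →ₗ[ℝ] Vec d := -((1 / l) • (H : Vec d →ₗ[ℝ] Vec d))
    + (1 - 3 * δ / (4 * l)) • LinearMap.id
  let x : Fin d → ℝ := fun j => 1 - (ev j + 3 * δ / 4) / l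
  have hMa : ∀ v, M v = -((1 / l) • H v) + (1 - 3 * δ / (4 * l)) • v := fun v => by simp [M]
  have hM : ∀ j, M (b j) = x j • b j := by
    intro j
    rw [hMa, hHb, smul_smul, ← neg_smul, ← add_smul]
    congr 1
    simp only [x]
    field_simp
    ring
  have hx1 : ∀ j, -1 ≤ x j := by
    intro j
    have h1 := (abs_le.1 (hevl j)).2
    have h2 : (ev j + 3 * δ / 4) / l ≤ 2 := by rw [div_le_iff₀ hl]; linarith
    simp only [x]; linarith
  have hxj₀ : ∀ j, x j ≤ x j₀ := by
    intro j
    simp only [x]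
    have := hj₀ j
    gcongr
  refine ⟨b j₀, b.orthonormal.1 j₀, ?_⟩
  intro y e c r τ A κ N hc hy0 hy he hy1 hA hA2 hr hτ hτ1 hgood hκ hκτ hsmall hlarge hN
  have hκ0 : 0 ≤ κ := le_trans (by positivity) hκ
  have hApos : 0 < A := by
    by_contra hneg
    have := mul_nonpos_of_nonpos_of_nonneg (not_lt.1 hneg) hr.le
    linarith
  have hyr : ‖y 1‖ ≤ r := by rw [hA]; nlinarith
  have hy' : ∀ n, y (n + 2) = (2 : ℝ) • (M (y (n + 1)) - e n) - y n := fun n => by rw [hy, hMa]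
  -- The maximum with `1` covers a spectrum without growth, where `θ = 0`.
  set θ := Real.arcosh (max 1 (x j₀)) with hθd
  have hθ : 0 ≤ θ := Real.arcosh_nonneg (le_max_left _ _)
  have hcosh : Real.cosh θ = max 1 (x j₀) := Real.cosh_arcosh (le_max_left _ _)
  have hxc : ∀ j, x j ≤ Real.cosh θ := fun j => by
    rw [hcosh]; exact (hxj₀ j).trans (le_max_right _ _)
  have hz : 1 ≤ Real.exp θ := Real.one_le_exp hθ
  have herr : ∀ n < N, (∀ m < n, ‖(1 / 2 : ℝ) • (y (m + 2) - y m)‖ < r) →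
      ‖(1 / 2 : ℝ) • (y (n + 2) - y n) - Polynomial.aeval M (T ℝ ((n + 1 : ℕ) : ℤ)) (y 1)‖ ≤
        κ * ‖y 1‖ * Real.exp θ ^ (n + 1) := fun n hn hw =>
    chebyshev_recurrence_error hM hz (fun j k => abs_eval_U_le_exp hθ (hx1 j) (hxc j) k) hc hy0
      hy' he hyr hκ (by linarith) hn hw
  -- Along `b j₀` the exact vector has size at least `τ‖y 1‖ exp(θ)^(n+1)/2`, and the error consumes
  -- at most half of it because `κ ≤ τ/4`.
  have hlow : 1 < x j₀ → ∀ n < N, (∀ m < n, ‖(1 / 2 : ℝ) • (y (m + 2) - y m)‖ < r) →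
      ‖y 1‖ * τ / 4 * Real.exp θ ^ (n + 1) ≤ ‖(1 / 2 : ℝ) • (y (n + 2) - y n)‖ := by
    intro hx n hn hw
    have h1 := herr n hn hw
    set w := (1 / 2 : ℝ) • (y (n + 2) - y n)
    set t := Polynomial.aeval M (T ℝ ((n + 1 : ℕ) : ℤ)) (y 1) with ht
    have h2 : |inner ℝ (b j₀) (w - t)| ≤ κ * ‖y 1‖ * Real.exp θ ^ (n + 1) := by
      have := abs_real_inner_le_norm (b j₀) (w - t)
      rw [b.orthonormal.1 j₀, one_mul] at this
      exact this.trans h1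
    have h3 : |inner ℝ (b j₀) w| ≤ ‖w‖ := by
      have := abs_real_inner_le_norm (b j₀) w
      rwa [b.orthonormal.1 j₀, one_mul] at this
    have h4 : Real.exp θ ^ (n + 1) / 2 * (τ * ‖y 1‖) ≤ |inner ℝ (b j₀) t| := by
      rw [ht, inner_aeval_apply hM, abs_mul]
      have h5 := exp_pow_le_two_mul_eval_T θ (n + 1)
      rw [hcosh, max_eq_right hx.le] at h5
      have h6 := le_abs_self (Polynomial.eval (x j₀) (T ℝ ((n + 1 : ℕ) : ℤ)))
      refine mul_le_mul (by linarith) hgood.le (by positivity) (abs_nonneg _)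
    have h7 : |inner ℝ (b j₀) t| ≤ |inner ℝ (b j₀) w| + |inner ℝ (b j₀) (w - t)| := by
      have : inner ℝ (b j₀) t = inner ℝ (b j₀) w - inner ℝ (b j₀) (w - t) := by
        rw [inner_sub_right]; ring
      rw [this]
      exact abs_sub _ _
    have h8 : κ * ‖y 1‖ * Real.exp θ ^ (n + 1) ≤ τ / 4 * ‖y 1‖ * Real.exp θ ^ (n + 1) := by
      gcongr
    linarith
  refine ⟨fun hall => ?_, ?_⟩
  · by_contra! hneg
    obtain ⟨v, hv⟩ := hneg
    have h1 : ev j₀ * ‖v‖ ^ 2 ≤ inner ℝ v (H v) := by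
      rw [hquad, hnorm, Finset.mul_sum]
      refine Finset.sum_le_sum fun j _ => ?_
      have := hj₀ j
      gcongr
    have h2 : ev j₀ < -δ := by
      by_contra hge
      have := mul_le_mul_of_nonneg_right (not_lt.1 hge) (sq_nonneg ‖v‖)
      linarith
    have h3 : 1 + δ / (4 * l) ≤ x j₀ := by
      simp only [x]
      have : (ev j₀ + 3 * δ / 4) / l ≤ (-δ / 4) / l := by
        gcongr
        linarith
      have e : (-δ / 4) / l = -(δ / (4 * l)) := by field_simp
      linarith
    have hδl0 : 0 < δ / (4 * l) := by positivity
    have hx : 1 < x j₀ := by linarith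
    -- With `s = √(δ/l)/2`, `cosh s ≤ exp(s²/2) = exp(δ/(8l)) ≤ 1 + δ/(4l) ≤ x j₀`.
    have h4 : √(δ / l) / 2 ≤ θ := by
      have hs : 0 ≤ √(δ / l) / 2 := by positivity
      rw [hθd, ← Real.arcosh_cosh hs, Real.arcosh_le_arcosh (Real.cosh_pos _) (by positivity)]
      refine (Real.cosh_le_exp_half_sq _).trans (le_max_of_le_right (le_trans ?_ h3))
      have e : (√(δ / l) / 2) ^ 2 / 2 = δ / l / 8 := by
        rw [div_pow, Real.sq_sqrt (by positivity)]; ring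
      have hd1 : δ / l ≤ 1 := (div_le_one hl).2 hδl
      have hd0 : 0 < δ / l := by positivity
      have e2 : δ / (4 * l) = δ / l / 4 := by field_simp
      rw [e, e2]
      have := Real.abs_exp_sub_one_le (x := δ / l / 8) (by rw [abs_of_pos (by positivity)]; linarith)
      rw [abs_of_pos (by positivity : 0 < δ / l / 8)] at this
      linarith [le_abs_self (Real.exp (δ / l / 8) - 1)]
    obtain ⟨n, rfl⟩ : ∃ n, N = n + 1 := ⟨N - 1, by omega⟩
    have h5 := hlow hx n (by omega) fun m hm => hall m (by omega)
    have h6 := hall n (by omega)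
    have h7 : Real.exp (√(δ / l) / 2 * (n + 1 : ℕ)) ≤ Real.exp θ ^ (n + 1) := by
      rw [← Real.exp_nat_mul, mul_comm]
      exact Real.exp_le_exp.2 (by gcongr)
    have h8 : ‖y 1‖ * τ / 4 * Real.exp (√(δ / l) / 2 * (n + 1 : ℕ)) ≤
        ‖y 1‖ * τ / 4 * Real.exp θ ^ (n + 1) := by gcongr
    linarith
  · intro n hn hw w hwd hrw
    have h1 := herr n hn hw
    rw [← hwd] at h1
    set t := Polynomial.aeval M (T ℝ ((n + 1 : ℕ) : ℤ)) (y 1) with ht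
    -- Without growth `‖w‖ ≤ (1 + κ)‖y 1‖ ≤ 2Ar < r`, so the test could not have succeeded.
    have hx : 1 < x j₀ := by
      by_contra hle
      have hθ0 : θ = 0 := by rw [hθd, max_eq_left (not_lt.1 hle)]; simp
      rw [hθ0, Real.exp_zero, one_pow, mul_one] at h1
      have h2 : ‖t‖ ≤ 1 * ‖y 1‖ := norm_aeval_apply_le hM zero_le_one (fun j =>
        abs_eval_T_real_le_one _ (abs_le.2 ⟨hx1 j, (hxj₀ j).trans (not_lt.1 hle)⟩)) _
      have h3 : ‖w‖ ≤ ‖w - t‖ + ‖t‖ := by simpa using norm_add_le (w - t) t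
      have h4 : κ * ‖y 1‖ ≤ 1 * ‖y 1‖ := by gcongr; linarith
      have h5 : A * r < 1 / 2 * r := by gcongr
      linarith
    have hlw := hlow hx n hn hw
    rw [← hwd] at hlw
    have hE : ‖w - t‖ ≤ 4 * κ / τ * ‖w‖ := by
      refine h1.trans ?_
      calc κ * ‖y 1‖ * Real.exp θ ^ (n + 1)
          = 4 * κ / τ * (‖y 1‖ * τ / 4 * Real.exp θ ^ (n + 1)) := by field_simp
        _ ≤ 4 * κ / τ * ‖w‖ := by gcongr
    have hσ : ‖y 1‖ ≤ A * ‖w‖ := by rw [hA]; gcongr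
    classical
    let S : Finset (Fin d) := Finset.univ.filter fun j => -(3 * δ / 4) ≤ ev j
    -- On these eigenvectors `T` is at most one, so their share of `w` comes from the unamplified
    -- start and the error, both small relative to `‖w‖`.
    have hS : ∑ j ∈ S, (inner ℝ (b j) w) ^ 2 ≤ δ / (8 * l) * ‖w‖ ^ 2 := by
      calc ∑ j ∈ S, (inner ℝ (b j) w) ^ 2
          ≤ ∑ j ∈ S, (2 * (inner ℝ (b j) (y 1)) ^ 2 + 2 * (inner ℝ (b j) (w - t)) ^ 2) := by
            refine Finset.sum_le_sum fun j hj => ?_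
            have hj' : -(3 * δ / 4) ≤ ev j := (Finset.mem_filter.1 hj).2
            have hxj : x j ≤ 1 := by
              have : 0 ≤ (ev j + 3 * δ / 4) / l := div_nonneg (by linarith) hl.le
              simp only [x]; linarith
            have h2 : |(T ℝ ((n + 1 : ℕ) : ℤ)).eval (x j)| ≤ 1 :=
              abs_eval_T_real_le_one _ (abs_le.2 ⟨hx1 j, hxj⟩)
            have h3 : inner ℝ (b j) w =
                (T ℝ ((n + 1 : ℕ) : ℤ)).eval (x j) * inner ℝ (b j) (y 1)
                  + inner ℝ (b j) (w - t) := by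
              rw [← inner_aeval_apply hM, inner_sub_right]; ring
            have h4 : ((T ℝ ((n + 1 : ℕ) : ℤ)).eval (x j) * inner ℝ (b j) (y 1)) ^ 2 ≤
                (inner ℝ (b j) (y 1)) ^ 2 := by
              rw [mul_pow]
              refine mul_le_of_le_one_left (sq_nonneg _) ?_
              rw [← sq_abs]
              exact pow_le_one₀ (abs_nonneg _) h2
            rw [h3]
            refine (add_sq_le).trans ?_
            linarith
        _ ≤ ∑ j, (2 * (inner ℝ (b j) (y 1)) ^ 2 + 2 * (inner ℝ (b j) (w - t)) ^ 2) :=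
            Finset.sum_le_sum_of_subset_of_nonneg (Finset.subset_univ _)
              fun j _ _ => by positivity
        _ = 2 * ‖y 1‖ ^ 2 + 2 * ‖w - t‖ ^ 2 := by
            rw [Finset.sum_add_distrib, ← Finset.mul_sum, ← Finset.mul_sum, ← hnorm, ← hnorm]
        _ ≤ 2 * (A * ‖w‖) ^ 2 + 2 * (4 * κ / τ * ‖w‖) ^ 2 := by gcongr
        _ = 2 * (A ^ 2 + (4 * κ / τ) ^ 2) * ‖w‖ ^ 2 := by ring
        _ ≤ δ / (8 * l) * ‖w‖ ^ 2 := by gcongr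
    calc inner ℝ w (H w) = ∑ j, ev j * (inner ℝ (b j) w) ^ 2 := hquad w
      -- Eigenvalues in `S` are at most `l ≤ -3δ/4 + 2l`; the excess `2l` times the share `δ/(8l)`
      -- costs only `δ/4`.
      _ ≤ ∑ j, (-(3 * δ / 4) * (inner ℝ (b j) w) ^ 2
            + if j ∈ S then 2 * l * (inner ℝ (b j) w) ^ 2 else 0) := by
          refine Finset.sum_le_sum fun j _ => ?_
          split_ifs with hj
          · have h2 := (abs_le.1 (hevl j)).2
            rw [← add_mul]
            gcongr
            linarith
          · have h2 : ev j ≤ -(3 * δ / 4) := by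
              have : ¬ -(3 * δ / 4) ≤ ev j := fun h => hj (by simp [S, h])
              linarith
            rw [add_zero]
            gcongr
      _ = -(3 * δ / 4) * ‖w‖ ^ 2 + 2 * l * ∑ j ∈ S, (inner ℝ (b j) w) ^ 2 := by
          rw [Finset.sum_add_distrib, ← Finset.mul_sum, ← hnorm, Finset.sum_ite_mem,
            Finset.univ_inter, Finset.mul_sum]
      _ ≤ -(3 * δ / 4) * ‖w‖ ^ 2 + 2 * l * (δ / (8 * l) * ‖w‖ ^ 2) := by gcongr
      _ = -(δ / 2) * ‖w‖ ^ 2 := by field_simp; ring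

end ZO
end

noncomputable section
namespace ZO

/-! ### Correctness of ZO-NCF-Deterministic -/

section Loop

variable {d : ℕ} (f : Vec d → ℝ) (l δ : ℝ) (x₀ : Vec d)

/-- The operator `𝓜` of ZO-NCF-Deterministic. -/
def ncfMap (y : Vec d) : Vec d :=
  -((1 / l) • (hessVecEst ‖y‖ x₀ y).eval f) + (1 - 3 * δ / (4 * l)) • y

/-- The iterates of ZO-NCF-Deterministic, continued after the stopping time. -/
def ncfSeq (y₁ : Vec d) : ℕ → Vec d
  | 0 => 0
  | 1 => y₁
  | n + 2 => (2 : ℝ) • ncfMap f l δ x₀ (ncfSeq y₁ (n + 1)) - ncfSeq y₁ n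

lemma ncfLoop_succ_eval (r : ℝ) (k : ℕ) (a b : Vec d) :
    (ncfLoop l δ r x₀ (k + 1) a b).eval f =
      if r ≤ ‖ncfMap f l δ x₀ b - a‖ then
        some ((1 / ‖ncfMap f l δ x₀ b - a‖) • (ncfMap f l δ x₀ b - a))
      else (ncfLoop l δ r x₀ k b ((2 : ℝ) • ncfMap f l δ x₀ b - a)).eval f := by
  have e : x₀ + ((2 : ℝ) • ncfMap f l δ x₀ b - a) - ncfMap f l δ x₀ b - x₀
      = ncfMap f l δ x₀ b - a := by rw [two_smul]; abel
  have hm : -((1 / l) • (hessVecEst ‖b‖ x₀ b).eval f) + (1 - 3 * δ / (4 * l)) • b =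
      ncfMap f l δ x₀ b := rfl
  simp only [ncfLoop, Prog.eval_bind, hm, e]
  split_ifs <;> rfl

/-- The recurrence makes the tested vector half of a two-step difference, so the program reduces to
the first passage time of the sequence `ncfSeq`. -/
lemma ncfLoop_spec (r : ℝ) (y₁ : Vec d) (k t : ℕ) :
    ((ncfLoop l δ r x₀ k (ncfSeq f l δ x₀ y₁ t) (ncfSeq f l δ x₀ y₁ (t + 1))).eval f = none ∧
      ∀ m, t ≤ m → m < t + k →
        ‖(1 / 2 : ℝ) • (ncfSeq f l δ x₀ y₁ (m + 2) - ncfSeq f l δ x₀ y₁ m)‖ < r) ∨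
    ∃ n, t ≤ n ∧ n < t + k ∧
      (∀ m, t ≤ m → m < n →
        ‖(1 / 2 : ℝ) • (ncfSeq f l δ x₀ y₁ (m + 2) - ncfSeq f l δ x₀ y₁ m)‖ < r) ∧
      ∃ w, w = (1 / 2 : ℝ) • (ncfSeq f l δ x₀ y₁ (n + 2) - ncfSeq f l δ x₀ y₁ n) ∧ r ≤ ‖w‖ ∧
        (ncfLoop l δ r x₀ k (ncfSeq f l δ x₀ y₁ t) (ncfSeq f l δ x₀ y₁ (t + 1))).eval f =
          some ((1 / ‖w‖) • w) := by
  induction k generalizing t with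
  | zero => exact Or.inl ⟨rfl, fun m h1 h2 => absurd h2 (by omega)⟩
  | succ k ih =>
    have e : ncfMap f l δ x₀ (ncfSeq f l δ x₀ y₁ (t + 1)) - ncfSeq f l δ x₀ y₁ t =
        (1 / 2 : ℝ) • (ncfSeq f l δ x₀ y₁ (t + 2) - ncfSeq f l δ x₀ y₁ t) := by
      rw [ncfSeq]
      module
    have e2 : (2 : ℝ) • ncfMap f l δ x₀ (ncfSeq f l δ x₀ y₁ (t + 1)) - ncfSeq f l δ x₀ y₁ t =
        ncfSeq f l δ x₀ y₁ (t + 1 + 1) := rfl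
    rw [ncfLoop_succ_eval, e, e2]
    split_ifs with hr
    · exact Or.inr ⟨t, le_rfl, by omega, fun m h1 h2 => absurd h2 (by omega), _, rfl, hr, rfl⟩
    · rw [not_le] at hr
      rcases ih (t + 1) with ⟨h1, h2⟩ | ⟨n, h1, h2, h3, h4⟩
      · refine Or.inl ⟨h1, fun m h3 h4 => ?_⟩
        rcases eq_or_lt_of_le h3 with rfl | h3
        · exact hr
        · exact h2 m h3 (by omega)
      · refine Or.inr ⟨n, by omega, by omega, fun m h5 h6 => ?_, h4⟩
        rcases eq_or_lt_of_le h5 with rfl | h5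
        · exact hr
        · exact h3 m h5 h6

lemma ncfLoop_cost_le (r : ℝ) (k : ℕ) (a b : Vec d) :
    (ncfLoop l δ r x₀ k a b).cost f ≤ k * (d * 4) := by
  induction k generalizing a b with
  | zero => simp [ncfLoop]
  | succ k ih =>
    simp only [ncfLoop, Prog.cost_bind, hessVecEst_cost]
    split_ifs
    · rw [Prog.cost_pure]; nlinarith
    · refine (Nat.add_le_add_left (ih _ _) _).trans (le_of_eq ?_)
      ring

end Loop

/-! ### The parameters of ZO-NCF-Deterministic -/

section Parameters

variable {l ρ δ q c : ℝ} {d : ℕ}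

/-- Since `log Q ≥ 1`, the summand `20 log(l/δ)` of the constant buys the factor `δ/l`. -/
lemma ncfConst_bounds {Q : ℝ} (hδ : 0 < δ) (hδl : δ ≤ l) (hQ : 10 ≤ Q) :
    20 ≤ ncfConst 20 l δ ∧ Q ^ (-ncfConst 20 l δ) ≤ Q ^ (-(20 : ℝ)) * (δ / l) := by
  have hl : 0 < l := hδ.trans_le hδl
  have hlog : 0 ≤ Real.log (l / δ) := Real.log_nonneg ((one_le_div hδ).2 hδl)
  have hQ0 : 0 < Q := by linarith
  refine ⟨by unfold ncfConst; linarith, ?_⟩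
  have e : -ncfConst 20 l δ = -20 + -(20 * Real.log (l / δ)) := by unfold ncfConst; ring
  rw [e, Real.rpow_add hQ0]
  gcongr
  have h1 : δ / l = Real.exp (-Real.log (l / δ)) := by
    rw [Real.exp_neg, Real.exp_log (by positivity), inv_div]
  have h2 : 1 ≤ Real.log Q := by
    rw [Real.le_log_iff_exp_le hQ0]
    linarith [Real.exp_one_lt_d9]
  rw [h1, Real.rpow_def_of_pos hQ0]
  refine Real.exp_le_exp.2 ?_
  nlinarith

lemma rpow_neg_natCast_le {Q : ℝ} (hQ : 10 ≤ Q) (k : ℕ) : Q ^ (-(k : ℝ)) ≤ (1 / 10) ^ k := by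
  rw [Real.rpow_neg (by linarith), Real.rpow_natCast, one_div, inv_pow]
  gcongr

set_option maxHeartbeats 1000000 in
-- The factor `N⁴` in the error cancels the one in the denominator of `σ`, leaving `κ = 8√d (δ/l)
-- Q^(-C)`. As `√d ≤ Q`, it is far below `τ = Q^(-3)`, even after multiplication by powers of `l/δ`.
lemma ncf_parameter_bounds {C Q A τ σ r κ : ℝ} {N : ℕ} (hd : 0 < d) (hρ : 0 < ρ) (hδ : 0 < δ)
    (hδl : δ ≤ l) (hq : 0 < q) (hq10 : q ≤ 1 / 10) (hC : C = ncfConst 20 l δ) (hQ : Q = d / q)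
    (hA : A = Q ^ (-C)) (hτ : τ = Q ^ (-(3 : ℝ))) (hσ : σ = ncfSigma d l ρ δ q C)
    (hr : r = ncfRadius d l ρ δ q C) (hN : N = ncfT d l δ q C)
    (hκ : κ = 8 * (√d * ρ / l) * (N : ℝ) ^ 4 * r) :
    0 < N ∧ 0 < σ ∧ 0 < r ∧ σ = A * r ∧ A < 1 / 2 ∧ 0 < τ ∧ τ ≤ 1 ∧ κ ≤ τ / 4 ∧
      2 * (A ^ 2 + (4 * κ / τ) ^ 2) ≤ δ / (8 * l) ∧
      r ≤ σ * τ / 4 * Real.exp (√(δ / l) / 2 * N) := by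
  have hl : 0 < l := hδ.trans_le hδl
  have hd1 : (1 : ℝ) ≤ d := by exact_mod_cast hd
  have hdQ : (d : ℝ) ≤ Q := by
    rw [hQ, le_div_iff₀ hq]; nlinarith
  have hQ10 : 10 ≤ Q := by
    rw [hQ, le_div_iff₀ hq]; linarith
  have hQ0 : 0 < Q := by linarith
  obtain ⟨hC20, hQC⟩ := ncfConst_bounds hδ hδl hQ10
  rw [← hC] at hC20 hQC
  have hlogQ : 1 ≤ Real.log Q := by
    rw [Real.le_log_iff_exp_le hQ0]
    linarith [Real.exp_one_lt_d9]
  have hNge : C ^ 2 * Real.log Q * √l / √δ ≤ N := by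
    rw [hN, hQ]; exact Nat.le_ceil _
  have hsl : 0 < √l := Real.sqrt_pos.2 hl
  have hsδ : 0 < √δ := Real.sqrt_pos.2 hδ
  have hNpos : 0 < N := by
    have : (0 : ℝ) < N := lt_of_lt_of_le (by positivity) hNge
    exact_mod_cast this
  have hN1 : (0 : ℝ) < N := by exact_mod_cast hNpos
  have hσ0 : 0 < σ := by
    simp only [hσ, ncfSigma, ← hN, ← hQ]
    positivity
  have hσeq : (N : ℝ) ^ 4 * σ = Q ^ (-(2 * C)) * (δ / ρ) := by
    simp only [hσ, ncfSigma, ← hN, ← hQ]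
    field_simp
  have hrσ : r = Q ^ C * σ := by rw [hr, hσ, hQ]; rfl
  have hr0 : 0 < r := by rw [hrσ]; positivity
  have hA0 : 0 < A := by rw [hA]; positivity
  have hAQ : A * Q ^ C = 1 := by rw [hA, ← Real.rpow_add hQ0]; simp
  have hA2 : Q ^ (-(2 * C)) * Q ^ C = A := by
    rw [hA, ← Real.rpow_add hQ0]; congr 1; ring
  have hδl1 : δ / l ≤ 1 := (div_le_one hl).2 hδl
  have hδl0 : 0 < δ / l := by positivity
  have hτ0 : 0 < τ := by rw [hτ]; positivity
  have hτ1 : τ ≤ (1 / 10) ^ 3 := by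
    have := rpow_neg_natCast_le hQ10 3
    simpa [hτ] using this
  -- the growth parameter of the error
  have hQpow : ∀ a b : ℝ, Q ^ a * Q ^ b = Q ^ (a + b) := fun a b => (Real.rpow_add hQ0 a b).symm
  have hAle : A ≤ Q ^ (-(20 : ℝ)) * (δ / l) := hA ▸ hQC
  have hκ1 : κ ≤ 8 * Q * A := by
    have h1 : κ = 8 * √d * (δ / l) * A := by
      calc κ = 8 * √d * (ρ / l) * ((N : ℝ) ^ 4 * σ) * Q ^ C := by rw [hκ, hrσ]; ring
        _ = 8 * √d * (δ / l) * (Q ^ (-(2 * C)) * Q ^ C) := by rw [hσeq]; field_simp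
        _ = _ := by rw [hA2]
    rw [h1]
    have h2 : √d ≤ Q := by
      refine le_trans ?_ hdQ
      rw [Real.sqrt_le_left (by positivity)]
      nlinarith
    calc 8 * √d * (δ / l) * A ≤ 8 * Q * 1 * A := by gcongr
      _ = _ := by ring
  have hQ1 : Q * Q ^ (-(20 : ℝ)) = Q ^ (-(19 : ℝ)) := by
    nth_rw 1 [← Real.rpow_one Q]; rw [hQpow]; norm_num
  have hκ2 : κ ≤ 8 * Q ^ (-(19 : ℝ)) * (δ / l) := by
    calc κ ≤ 8 * Q * A := hκ1
      _ ≤ 8 * Q * (Q ^ (-(20 : ℝ)) * (δ / l)) := by gcongr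
      _ = 8 * (Q * Q ^ (-(20 : ℝ))) * (δ / l) := by ring
      _ = _ := by rw [hQ1]
  have hκ3 : κ ≤ τ * (8 * (1 / 10) ^ 16 * (δ / l)) := by
    have e : Q ^ (-(19 : ℝ)) = τ * Q ^ (-((16 : ℕ) : ℝ)) := by
      rw [hτ, hQpow]; norm_num
    calc κ ≤ 8 * Q ^ (-(19 : ℝ)) * (δ / l) := hκ2
      _ = τ * (8 * Q ^ (-((16 : ℕ) : ℝ)) * (δ / l)) := by rw [e]; ring
      _ ≤ _ := by gcongr; exact rpow_neg_natCast_le hQ10 16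
  have hA3 : A ≤ (1 / 10) ^ 20 * (δ / l) := by
    refine hAle.trans ?_
    gcongr
    have := rpow_neg_natCast_le hQ10 20
    simpa using this
  refine ⟨hNpos, hσ0, hr0, ?_, by nlinarith, hτ0, by linarith, by nlinarith, ?_, ?_⟩
  · rw [hrσ, ← mul_assoc, hAQ, one_mul]
  · have h1 : 4 * κ / τ ≤ 32 * (1 / 10) ^ 16 * (δ / l) := by
      rw [div_le_iff₀ hτ0]; linarith
    have hκ0 : 0 ≤ κ := by rw [hκ]; positivity
    calc 2 * (A ^ 2 + (4 * κ / τ) ^ 2)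
        ≤ 2 * (((1 / 10) ^ 20 * (δ / l)) ^ 2 + (32 * (1 / 10) ^ 16 * (δ / l)) ^ 2) := by gcongr
      _ = 2 * (((1 / 10) ^ 20) ^ 2 + (32 * (1 / 10) ^ 16) ^ 2) * (δ / l) * (δ / l) := by ring
      _ ≤ 1 / 8 * (δ / l) * 1 := by gcongr; norm_num
      _ = δ / (8 * l) := by field_simp
  · rw [hrσ]
    have h1 : √(δ / l) / 2 * (C ^ 2 * Real.log Q * √l / √δ) ≤ √(δ / l) / 2 * N := by gcongr
    have h2 : √(δ / l) / 2 * (C ^ 2 * Real.log Q * √l / √δ) = Real.log Q * (C ^ 2 / 2) := by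
      rw [Real.sqrt_div hδ.le]; field_simp
    -- The exponent is at least `(C²/2) log Q`, and `C ≥ 20` gives `C²/2 ≥ C + 4`. Three of the four
    -- extra powers pay for `τ`, the last for the factor `4`.
    have h3 : Q ^ (C + 4) ≤ Real.exp (√(δ / l) / 2 * N) := by
      rw [Real.rpow_def_of_pos hQ0]
      refine Real.exp_le_exp.2 ?_
      rw [h2] at h1
      refine le_trans ?_ h1
      gcongr
      nlinarith
    have h4 : Q ^ (C + 4) * τ = Q ^ C * Q := by
      rw [hτ, hQpow]
      nth_rw 3 [← Real.rpow_one Q]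
      rw [hQpow]; congr 1; ring
    calc Q ^ C * σ = σ * (Q ^ C * 4) / 4 := by ring
      _ ≤ σ * (Q ^ C * Q) / 4 := by gcongr; linarith
      _ = σ * τ / 4 * Q ^ (C + 4) := by rw [← h4]; ring
      _ ≤ σ * τ / 4 * Real.exp (√(δ / l) / 2 * N) := by gcongr

end Parameters

/-- A vector returned by a good call of ZO-NCF-Deterministic. -/
def IsCurvatureDir {d : ℕ} (δ : ℝ) (f : Vec d → ℝ) (x v : Vec d) : Prop :=
  ‖v‖ = 1 ∧ inner ℝ v (hessian f x v) ≤ -(δ / 2)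

/-- The answer of ZO-NCF-Deterministic is correct. -/
def NCFCorrect {d : ℕ} (l ρ δ q C₁ : ℝ) (f : Vec d → ℝ) (ξ x : Vec d) : Prop :=
  ((ncfDeterministic l ρ δ q C₁ ξ x).eval f = none →
    ∀ v, -δ * ‖v‖ ^ 2 ≤ inner ℝ v (hessian f x v)) ∧
  ∀ v, (ncfDeterministic l ρ δ q C₁ ξ x).eval f = some v → IsCurvatureDir δ f x v

/-- The direction depends on `f` and `x` but not on `ξ`, so correctness follows from one small-ball
event for a fixed unit vector. -/
theorem exists_direction_ncfCorrect {d : ℕ} (hd : 0 < d) {l ρ δ q : ℝ} {f : Vec d → ℝ}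
    (h : IsSmooth l ρ f) (hρ : 0 < ρ) (hδ : 0 < δ) (hδl : δ ≤ l) (hq : 0 < q) (hq10 : q ≤ 1 / 10)
    (x : Vec d) :
    ∃ u : Vec d, ‖u‖ = 1 ∧ ∀ ξ : Vec d, ((d : ℝ) / q) ^ (-(3 : ℝ)) * ‖ξ‖ < |inner ℝ u ξ| →
      NCFCorrect l ρ δ q (ncfConst 20 l δ) f ξ x := by
  have hl : 0 < l := hδ.trans_le hδl
  obtain ⟨u, hu, hmain⟩ := exists_direction_forall_chebyshev_recurrence hd hδ hδl
    (h.inner_hessian_comm x) (h.norm_hessian_le hl.le x)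
  refine ⟨u, hu, fun ξ hξ => ?_⟩
  have hξ0 : 0 < ‖ξ‖ := by
    refine norm_pos_iff.2 ?_
    rintro rfl
    simp at hξ
  obtain ⟨C, hC⟩ : ∃ C, C = ncfConst 20 l δ := ⟨_, rfl⟩
  obtain ⟨Q, hQ⟩ : ∃ Q : ℝ, Q = d / q := ⟨_, rfl⟩
  obtain ⟨τ, hτ⟩ : ∃ τ, τ = Q ^ (-(3 : ℝ)) := ⟨_, rfl⟩
  obtain ⟨σ, hσ⟩ : ∃ σ, σ = ncfSigma d l ρ δ q C := ⟨_, rfl⟩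
  obtain ⟨r, hr⟩ : ∃ r, r = ncfRadius d l ρ δ q C := ⟨_, rfl⟩
  obtain ⟨N, hN⟩ : ∃ N, N = ncfT d l δ q C := ⟨_, rfl⟩
  obtain ⟨hN0, hσ0, hr0, hσA, hA2, hτ0, hτ1, hκτ, hsmall, hlarge⟩ :=
    ncf_parameter_bounds hd hρ hδ hδl hq hq10 hC hQ rfl hτ hσ hr hN rfl
  rw [← hQ, ← hτ] at hξ
  have hprog : ncfDeterministic l ρ δ q C ξ x =
      ncfLoop l δ r x N 0 ((σ / ‖ξ‖) • ξ) := by rw [hr, hN, hσ]; rfl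
  rw [← hC, NCFCorrect, hprog]
  obtain ⟨y, hy⟩ : ∃ y, y = ncfSeq f l δ x ((σ / ‖ξ‖) • ξ) := ⟨_, rfl⟩
  have hy0 : y 0 = 0 := by rw [hy]; rfl
  have hy1 : y 1 = (σ / ‖ξ‖) • ξ := by rw [hy]; rfl
  have hys : ∀ n, y (n + 2) = (2 : ℝ) • ncfMap f l δ x (y (n + 1)) - y n := by
    rw [hy]; exact fun n => rfl
  have hspec := ncfLoop_spec f l δ x r ((σ / ‖ξ‖) • ξ) N 0
  rw [← hy, zero_add, hy0, hy1] at hspec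
  have hy1n : ‖y 1‖ = σ := by
    rw [hy1, norm_smul, Real.norm_of_nonneg (by positivity)]
    field_simp
  have hfin := hmain y
    (fun n => (1 / l) • ((hessVecEst ‖y (n + 1)‖ x (y (n + 1))).eval f - hessian f x (y (n + 1))))
    (√d * ρ / l) r τ _ _ N (by positivity) hy0
    (fun n => by
      rw [hys, ncfMap]
      module)
    (fun n => by
      rw [norm_smul, Real.norm_of_nonneg (by positivity)]
      have := h.norm_hessVecEst_sub_le hρ.le hd x (y (n + 1))
      calc _ ≤ 1 / l * (√d * ρ * ‖y (n + 1)‖ ^ 2) := by gcongr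
        _ = _ := by ring)
    (by rw [hy1n]; exact hσ0) (by rw [hy1n]; exact hσA) hA2 hr0 hτ0 hτ1
    (by
      rw [hy1n, hy1, inner_smul_right, abs_mul, abs_of_pos (by positivity : 0 < σ / ‖ξ‖)]
      calc τ * σ = σ / ‖ξ‖ * (τ * ‖ξ‖) := by field_simp
        _ < _ := by gcongr)
    le_rfl hκτ hsmall (by rw [hy1n]; exact hlarge) hN0
  rcases hspec with ⟨h1, h2⟩ | ⟨n, _, h2, h3, w, hw, h4, h5⟩
  · rw [h1]
    exact ⟨fun _ => hfin.1 fun m hm => h2 m (Nat.zero_le _) (by omega), by simp⟩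
  · rw [h5]
    refine ⟨by simp, fun v hv => ?_⟩
    have h6 := hfin.2 n (by omega) (fun m hm => h3 m (Nat.zero_le _) hm) w hw h4
    have hw0 : 0 < ‖w‖ := hr0.trans_le h4
    obtain rfl : (1 / ‖w‖) • w = v := Option.some.inj hv
    refine ⟨?_, ?_⟩
    · rw [norm_smul, Real.norm_of_nonneg (by positivity)]
      field_simp
    · rw [map_smul, inner_smul_left, inner_smul_right]
      simp only [conj_trivial]
      calc 1 / ‖w‖ * (1 / ‖w‖ * inner ℝ w (hessian f x w))
          ≤ 1 / ‖w‖ * (1 / ‖w‖ * (-(δ / 2) * ‖w‖ ^ 2)) := by gcongr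
        _ = -(δ / 2) := by field_simp

end ZO
end

noncomputable section
namespace ZO

/-! ### Small-ball estimate for the Gaussian direction -/

/-- The standard Gaussian density is at most `1/√(2π) ≤ 1/2`. -/
lemma gaussianReal_Icc_le (s : ℝ) :
    gaussianReal 0 1 (Set.Icc (-s) s) ≤ ENNReal.ofReal s := by
  rw [gaussianReal_apply 0 one_ne_zero]
  have hpdf : ∀ x, gaussianPDF 0 1 x ≤ ENNReal.ofReal (1 / 2) := by
    intro x
    refine ENNReal.ofReal_le_ofReal ?_
    rw [gaussianPDFReal_def]
    have h1 : (2 : ℝ) ≤ √(2 * Real.pi * (1 : NNReal)) := by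
      refine Real.le_sqrt_of_sq_le ?_
      have := Real.pi_gt_three
      norm_num
      linarith
    have h2 : Real.exp (-(x - 0) ^ 2 / (2 * (1 : NNReal))) ≤ 1 := by
      rw [Real.exp_le_one_iff, neg_div, neg_nonpos]
      positivity
    calc (√(2 * Real.pi * (1 : NNReal)))⁻¹ * Real.exp (-(x - 0) ^ 2 / (2 * (1 : NNReal)))
        ≤ 2⁻¹ * 1 := by gcongr
      _ = 1 / 2 := by norm_num
  calc ∫⁻ x in Set.Icc (-s) s, gaussianPDF 0 1 x
      ≤ ∫⁻ _ in Set.Icc (-s) s, ENNReal.ofReal (1 / 2) := lintegral_mono fun x => hpdf x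
    _ = ENNReal.ofReal s := by
        rw [setLIntegral_const, Real.volume_Icc, ← ENNReal.ofReal_mul (by norm_num)]
        congr 1; ring

variable {d : ℕ}

lemma stdGaussian_map_inner {u : Vec d} (hu : ‖u‖ = 1) :
    (stdGaussian (Vec d)).map (fun ξ => inner ℝ u ξ) = gaussianReal 0 1 := by
  have := IsGaussian.map_eq_gaussianReal (μ := stdGaussian (Vec d)) (innerSL ℝ u)
  rw [variance_dual_stdGaussian, integral_strongDual_stdGaussian, innerSL_apply_norm, hu] at this
  simpa using this

lemma integral_inner_sq_stdGaussian {u : Vec d} (hu : ‖u‖ = 1) :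
    ∫ ξ, (inner ℝ u ξ) ^ 2 ∂(stdGaussian (Vec d)) = 1 := by
  have h1 := variance_dual_stdGaussian (E := Vec d) (innerSL ℝ u)
  rw [variance_eq_integral (by fun_prop), integral_strongDual_stdGaussian, innerSL_apply_norm,
    hu] at h1
  simpa using h1

lemma lintegral_norm_sq_stdGaussian :
    ∫⁻ ξ, ENNReal.ofReal (‖ξ‖ ^ 2) ∂(stdGaussian (Vec d)) = d := by
  have hint : ∀ i : Fin d, ∫⁻ ξ, ENNReal.ofReal ((ξ i) ^ 2) ∂(stdGaussian (Vec d)) = 1 := by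
    intro i
    have h2 := integral_inner_sq_stdGaussian (norm_basisVec i)
    -- A Bochner integral different from its default value `0` certifies integrability.
    have h3 : Integrable (fun ξ : Vec d => (inner ℝ (basisVec i) ξ) ^ 2) (stdGaussian (Vec d)) := by
      by_contra hne
      rw [integral_undef hne] at h2
      exact zero_ne_one h2
    have h4 := ofReal_integral_eq_lintegral_ofReal h3
      (Filter.Eventually.of_forall fun ξ => sq_nonneg _)
    rw [h2, ENNReal.ofReal_one] at h4
    rw [h4]
    refine lintegral_congr fun ξ => ?_
    rw [real_inner_comm, inner_basisVec]
  have e : ∀ ξ : Vec d, ENNReal.ofReal (‖ξ‖ ^ 2) = ∑ i, ENNReal.ofReal ((ξ i) ^ 2) := by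
    intro ξ
    rw [EuclideanSpace.real_norm_sq_eq, ENNReal.ofReal_sum_of_nonneg fun i _ => sq_nonneg _]
  simp_rw [e]
  rw [lintegral_finsetSum _ fun i _ => by fun_prop]
  simp [hint]

/-- Either `‖ξ‖² ≥ 16Q`, of probability at most `d/(16Q) = q/16` by Markov, or the one-dimensional
Gaussian `⟨u, ξ⟩` falls in an interval of probability at most `3q/16`. -/
lemma stdGaussian_small_ball_le (hd : 0 < d) {u : Vec d} (hu : ‖u‖ = 1) {q : ℝ} (hq : 0 < q)
    (hq10 : q ≤ 1 / 10) :
    stdGaussian (Vec d) {ξ | |inner ℝ u ξ| ≤ ((d : ℝ) / q) ^ (-(3 : ℝ)) * ‖ξ‖} ≤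
      ENNReal.ofReal (q / 4) := by
  have hd1 : (1 : ℝ) ≤ d := by exact_mod_cast hd
  set Q : ℝ := (d : ℝ) / q with hQ
  have hQ10 : 10 ≤ Q := by rw [hQ, le_div_iff₀ hq]; linarith
  have hQ0 : 0 < Q := by linarith
  have hQq : 1 / Q ≤ q := by
    rw [hQ, one_div_div, div_le_iff₀ (by linarith)]; nlinarith
  have hτ : Q ^ (-(3 : ℝ)) = 1 / Q ^ 3 := by
    rw [Real.rpow_neg hQ0.le, one_div]; norm_cast
  have hsub : {ξ : Vec d | |inner ℝ u ξ| ≤ Q ^ (-(3 : ℝ)) * ‖ξ‖} ⊆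
      {ξ | ENNReal.ofReal (16 * Q) ≤ ENNReal.ofReal (‖ξ‖ ^ 2)} ∪
        (fun ξ => inner ℝ u ξ) ⁻¹' Set.Icc (-(3 * q / 16)) (3 * q / 16) := by
    intro ξ hξ
    simp only [Set.mem_ofPred_eq] at hξ
    rcases le_or_gt (16 * Q) (‖ξ‖ ^ 2) with h1 | h1
    · exact Or.inl (ENNReal.ofReal_le_ofReal h1)
    · refine Or.inr (abs_le.1 (hξ.trans ?_))
      have h2 : ‖ξ‖ ≤ 3 / 2 * Q := by
        refine le_of_sq_le_sq ?_ (by positivity)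
        nlinarith
      rw [hτ]
      calc 1 / Q ^ 3 * ‖ξ‖ ≤ 1 / Q ^ 3 * (3 / 2 * Q) := by gcongr
        _ = 3 / 2 * (1 / Q) * (1 / Q) := by field_simp
        _ ≤ 3 / 2 * (1 / 10) * q := by gcongr
        _ ≤ 3 * q / 16 := by linarith
  refine (measure_mono hsub).trans ((measure_union_le _ _).trans ?_)
  have h1 : stdGaussian (Vec d) {ξ | ENNReal.ofReal (16 * Q) ≤ ENNReal.ofReal (‖ξ‖ ^ 2)} ≤
      ENNReal.ofReal (q / 16) := by
    refine (meas_ge_le_lintegral_div (by fun_prop) (by simpa using hQ0) ENNReal.ofReal_ne_top).trans ?_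
    rw [lintegral_norm_sq_stdGaussian, ← ENNReal.ofReal_natCast, ← ENNReal.ofReal_div_of_pos (by positivity)]
    refine ENNReal.ofReal_le_ofReal (le_of_eq ?_)
    rw [hQ]; field_simp
  have h2 : stdGaussian (Vec d) ((fun ξ => inner ℝ u ξ) ⁻¹' Set.Icc (-(3 * q / 16)) (3 * q / 16)) ≤
      ENNReal.ofReal (3 * q / 16) := by
    rw [← Measure.map_apply (by fun_prop) measurableSet_Icc, stdGaussian_map_inner hu]
    exact gaussianReal_Icc_le _
  refine (add_le_add h1 h2).trans ?_
  rw [← ENNReal.ofReal_add (by positivity) (by positivity)]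
  exact ENNReal.ofReal_le_ofReal (by linarith)

theorem stdGaussian_not_ncfCorrect_le (hd : 0 < d) {l ρ δ q : ℝ} {f : Vec d → ℝ}
    (h : IsSmooth l ρ f) (hρ : 0 < ρ) (hδ : 0 < δ) (hδl : δ ≤ l) (hq : 0 < q) (hq10 : q ≤ 1 / 10)
    (x : Vec d) :
    stdGaussian (Vec d) {ξ | ¬ NCFCorrect l ρ δ q (ncfConst 20 l δ) f ξ x} ≤
      ENNReal.ofReal (q / 4) := by
  obtain ⟨u, hu, hgood⟩ := exists_direction_ncfCorrect hd h hρ hδ hδl hq hq10 x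
  refine (measure_mono fun ξ hξ => ?_).trans (stdGaussian_small_ball_le hd hu hq hq10)
  by_contra hlt
  exact hξ (hgood ξ (not_le.1 hlt))

end ZO
end

noncomputable section
namespace ZO

/-! ### Moments of the uniform distribution on the sphere -/

section Sphere

variable {d : ℕ}

lemma isProbabilityMeasure_sphereUniform (hd : 0 < d) : IsProbabilityMeasure (sphereUniform d) := by
  have : Nonempty (Fin d) := ⟨⟨0, hd⟩⟩
  have h0 : (volume : Measure (Vec d)).toSphere Set.univ ≠ 0 := by
    rw [Measure.measure_univ_ne_zero]
    exact Measure.toSphere_ne_zero _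
  refine ⟨?_⟩
  rw [sphereUniform, Measure.map_apply measurable_subtype_coe MeasurableSet.univ, Set.preimage_univ,
    Measure.smul_apply, smul_eq_mul, ENNReal.inv_mul_cancel h0 (measure_ne_top _ _)]

lemma ae_sphereUniform_norm_eq_one : ∀ᵐ u ∂(sphereUniform d), ‖u‖ = 1 := by
  rw [sphereUniform, ae_map_iff measurable_subtype_coe.aemeasurable
    (measurableSet_eq_fun (by fun_prop) (by fun_prop))]
  exact Filter.Eventually.of_forall fun u => norm_eq_of_mem_sphere u

open scoped Pointwise in
-- `toSphere` measures a set by the volume of the cone over it; isometries preserve volume and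
-- commute with forming cones.
lemma map_sphereUniform (T : Vec d ≃ₗᵢ[ℝ] Vec d) :
    (sphereUniform d).map T = sphereUniform d := by
  have hT : Measurable T := T.continuous.measurable
  refine Measure.ext fun s hs => ?_
  rw [Measure.map_apply hT hs, sphereUniform, Measure.map_apply measurable_subtype_coe (hT hs),
    Measure.map_apply measurable_subtype_coe hs, Measure.smul_apply, Measure.smul_apply,
    Measure.toSphere_apply' _ (measurable_subtype_coe (hT hs)),
    Measure.toSphere_apply' _ (measurable_subtype_coe hs)]
  have himg : ∀ s : Set (Vec d), (Subtype.val '' (Subtype.val ⁻¹' s : Set (Metric.sphere (0 : Vec d) 1)))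
      = Metric.sphere 0 1 ∩ s := fun s => Subtype.image_preimage_coe _ _
  have hset : Set.Ioo (0 : ℝ) 1 • (Metric.sphere (0 : Vec d) 1 ∩ T ⁻¹' s) =
      T ⁻¹' (Set.Ioo (0 : ℝ) 1 • (Metric.sphere (0 : Vec d) 1 ∩ s)) := by
    ext v
    simp only [Set.mem_smul, Set.mem_inter_iff, Set.mem_preimage, mem_sphere_zero_iff_norm]
    constructor
    · rintro ⟨a, ha, w, ⟨hw1, hw2⟩, rfl⟩
      exact ⟨a, ha, T w, ⟨by rw [T.norm_map, hw1], hw2⟩, by rw [map_smul]⟩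
    · rintro ⟨a, ha, w, ⟨hw1, hw2⟩, hv⟩
      refine ⟨a, ha, T.symm w, ⟨by rw [T.symm.norm_map, hw1], by simpa using hw2⟩, ?_⟩
      rw [← map_smul, hv]; simp
  rw [himg, himg, hset]
  congr 2
  exact (T.measurePreserving).measure_preimage_equiv (f := T.toMeasurableEquiv) _

lemma integrable_sphereUniform (hd : 0 < d) {g : Vec d → ℝ} (hg : Continuous g) (C : ℝ)
    (hb : ∀ u, ‖u‖ = 1 → |g u| ≤ C) : Integrable g (sphereUniform d) := by
  have := isProbabilityMeasure_sphereUniform hd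
  refine Integrable.of_bound hg.aestronglyMeasurable C ?_
  filter_upwards [ae_sphereUniform_norm_eq_one] with u hu
  exact hb u hu

lemma integrable_inner_pow (hd : 0 < d) (v : Vec d) (k : ℕ) :
    Integrable (fun u => (inner ℝ v u) ^ k) (sphereUniform d) := by
  refine integrable_sphereUniform hd (by fun_prop) (‖v‖ ^ k) fun u hu => ?_
  rw [abs_pow]
  have := abs_real_inner_le_norm v u
  rw [hu, mul_one] at this
  gcongr

/-- The reflection in the hyperplane orthogonal to `v - w` carries `v` to `w` and preserves the law.
-/
lemma integral_inner_pow_congr {v w : Vec d} (h : ‖v‖ = ‖w‖) (k : ℕ) :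
    ∫ u, (inner ℝ v u) ^ k ∂(sphereUniform d) = ∫ u, (inner ℝ w u) ^ k ∂(sphereUniform d) := by
  let T : Vec d ≃ₗᵢ[ℝ] Vec d := (ℝ ∙ (v - w))ᗮ.reflection
  have hT : T v = w := Submodule.reflection_sub h
  conv_rhs => rw [← map_sphereUniform T]
  rw [integral_map T.continuous.aemeasurable (by fun_prop)]
  refine integral_congr_ae (Filter.Eventually.of_forall fun u => ?_)
  simp only
  rw [← hT, T.inner_map_map]

lemma integral_inner_sq_sphereUniform (hd : 0 < d) {v : Vec d} (hv : ‖v‖ = 1) :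
    ∫ u, (inner ℝ v u) ^ 2 ∂(sphereUniform d) = 1 / d := by
  have := isProbabilityMeasure_sphereUniform hd
  have h1 : ∫ u, ∑ i : Fin d, (inner ℝ (basisVec i) u) ^ 2 ∂(sphereUniform d) = 1 := by
    have : ∀ᵐ u ∂(sphereUniform d), ∑ i : Fin d, (inner ℝ (basisVec i) u) ^ 2 = (1 : ℝ) := by
      filter_upwards [ae_sphereUniform_norm_eq_one] with u hu
      have := EuclideanSpace.real_norm_sq_eq u
      simp only [real_inner_comm, inner_basisVec] at *
      rw [← this, hu, one_pow]
    rw [integral_congr_ae this]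
    simp
  rw [integral_finsetSum _ fun i _ => integrable_inner_pow hd _ 2] at h1
  rw [Finset.sum_congr rfl fun i _ => integral_inner_pow_congr ((norm_basisVec i).trans hv.symm) 2]
    at h1
  rw [Finset.sum_const, Finset.card_univ, Fintype.card_fin, nsmul_eq_mul] at h1
  have hd' : (d : ℝ) ≠ 0 := by exact_mod_cast hd.ne'
  field_simp
  linarith

/-- Comparing the fourth moments along `e_i ± e_j` (norm `√2`) with those along the axes shows that
`u_i² u_j²` has mean `m/3` for `i ≠ j`, and mean `m` for `i = j`. Summing all pairs in `(∑ u_i²)² =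
1` yields `d² m/3 ≤ 1`. -/
lemma integral_inner_pow_four_sphereUniform_le (hd : 0 < d) {v : Vec d} (hv : ‖v‖ = 1) :
    ∫ u, (inner ℝ v u) ^ 4 ∂(sphereUniform d) ≤ 3 / (d : ℝ) ^ 2 := by
  have := isProbabilityMeasure_sphereUniform hd
  set m := ∫ u, (inner ℝ v u) ^ 4 ∂(sphereUniform d) with hm
  have hm0 : 0 ≤ m := integral_nonneg fun u => by positivity
  have hint : ∀ i j : Fin d, Integrable
      (fun u : Vec d => (inner ℝ (basisVec i) u) ^ 2 * (inner ℝ (basisVec j) u) ^ 2)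
      (sphereUniform d) := by
    intro i j
    refine integrable_sphereUniform hd (by fun_prop) 1 fun u hu => ?_
    have h1 : ∀ i : Fin d, |inner ℝ (basisVec i) u| ≤ 1 := fun i => by
      have := abs_real_inner_le_norm (basisVec i) u
      rwa [norm_basisVec, hu, mul_one] at this
    rw [abs_mul, abs_pow, abs_pow]
    exact mul_le_one₀ (pow_le_one₀ (abs_nonneg _) (h1 i)) (by positivity)
      (pow_le_one₀ (abs_nonneg _) (h1 j))
  have hpair : ∀ i j : Fin d, m / 3 ≤
      ∫ u, (inner ℝ (basisVec i) u) ^ 2 * (inner ℝ (basisVec j) u) ^ 2 ∂(sphereUniform d) := by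
    intro i j
    rcases eq_or_ne i j with rfl | hij
    · have : m = ∫ u, (inner ℝ (basisVec i) u) ^ 2 * (inner ℝ (basisVec i) u) ^ 2
          ∂(sphereUniform d) := by
        rw [hm, integral_inner_pow_congr (hv.trans (norm_basisVec i).symm) 4]
        refine integral_congr_ae (Filter.Eventually.of_forall fun u => ?_)
        simp only; ring
      linarith
    · have horth : inner ℝ (basisVec i : Vec d) (basisVec j) = 0 := by
        rw [inner_basisVec]; simp [basisVec, hij.symm]
      have hn : ∀ s : ℝ, s ^ 2 = 1 → ‖(basisVec i : Vec d) + s • basisVec j‖ = ‖√2 • v‖ := by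
        intro s hs
        have : ‖(basisVec i : Vec d) + s • basisVec j‖ ^ 2 = ‖√2 • v‖ ^ 2 := by
          rw [norm_add_sq_real, norm_smul, norm_smul, inner_smul_right, horth, norm_basisVec,
            norm_basisVec, hv, mul_one, mul_one, Real.norm_eq_abs, Real.norm_eq_abs, sq_abs, sq_abs,
            hs, Real.sq_sqrt zero_le_two]
          norm_num
        exact (sq_eq_sq₀ (norm_nonneg _) (norm_nonneg _)).1 this
      have h4 : ∫ u, (inner ℝ (√2 • v) u) ^ 4 ∂(sphereUniform d) = 4 * m := by
        rw [hm, ← integral_const_mul]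
        refine integral_congr_ae (Filter.Eventually.of_forall fun u => ?_)
        simp only [real_inner_smul_left, mul_pow]
        have : √2 ^ 4 = (4 : ℝ) := by
          rw [show (4 : ℕ) = 2 * 2 from rfl, pow_mul, Real.sq_sqrt zero_le_two]; norm_num
        rw [this]
      have h5 := integral_inner_pow_congr (hn 1 (by norm_num)) 4
      have h6 := integral_inner_pow_congr (hn (-1) (by norm_num)) 4
      rw [h4] at h5 h6
      have hsum : Integrable (fun u : Vec d => 2 * (inner ℝ (basisVec i) u) ^ 4
          + 2 * (inner ℝ (basisVec j) u) ^ 4) (sphereUniform d) :=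
        ((integrable_inner_pow hd _ 4).const_mul 2).add ((integrable_inner_pow hd _ 4).const_mul 2)
      have h7 : ∫ u, (inner ℝ ((basisVec i : Vec d) + (1 : ℝ) • basisVec j) u) ^ 4
          + (inner ℝ ((basisVec i : Vec d) + (-1 : ℝ) • basisVec j) u) ^ 4 ∂(sphereUniform d) =
          ∫ u, 2 * (inner ℝ (basisVec i) u) ^ 4 + 2 * (inner ℝ (basisVec j) u) ^ 4
            + 12 * ((inner ℝ (basisVec i) u) ^ 2 * (inner ℝ (basisVec j) u) ^ 2)
            ∂(sphereUniform d) := by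
        refine integral_congr_ae (Filter.Eventually.of_forall fun u => ?_)
        simp only [inner_add_left, real_inner_smul_left]
        ring
      rw [integral_add (integrable_inner_pow hd _ 4) (integrable_inner_pow hd _ 4), h5, h6,
        integral_add hsum ((hint i j).const_mul 12),
        integral_add ((integrable_inner_pow hd _ 4).const_mul 2)
          ((integrable_inner_pow hd _ 4).const_mul 2), integral_const_mul, integral_const_mul,
        integral_const_mul, integral_inner_pow_congr ((norm_basisVec i).trans hv.symm) 4,
        integral_inner_pow_congr ((norm_basisVec j).trans hv.symm) 4, ← hm] at h7
      linarith
  have h1 : ∫ u, ∑ i : Fin d, ∑ j : Fin d,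
      (inner ℝ (basisVec i) u) ^ 2 * (inner ℝ (basisVec j) u) ^ 2 ∂(sphereUniform d) = 1 := by
    have : ∀ᵐ u ∂(sphereUniform d), ∑ i : Fin d, ∑ j : Fin d,
        (inner ℝ (basisVec i) u) ^ 2 * (inner ℝ (basisVec j) u) ^ 2 = (1 : ℝ) := by
      filter_upwards [ae_sphereUniform_norm_eq_one] with u hu
      have := EuclideanSpace.real_norm_sq_eq u
      rw [← Finset.sum_mul_sum]
      simp only [real_inner_comm, inner_basisVec] at *
      rw [← this, hu, one_pow, one_mul]
    rw [integral_congr_ae this]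
    simp
  rw [integral_finsetSum _ fun i _ => integrable_finsetSum _ fun j _ => hint i j] at h1
  simp_rw [integral_finsetSum _ fun j _ => hint _ j] at h1
  have h2 : ∑ i : Fin d, ∑ j : Fin d, m / 3 ≤ 1 := by
    rw [← h1]
    exact Finset.sum_le_sum fun i _ => Finset.sum_le_sum fun j _ => hpair i j
  simp only [Finset.sum_const, Finset.card_univ, Fintype.card_fin, nsmul_eq_mul] at h2
  have hd' : (0 : ℝ) < d := by exact_mod_cast hd
  rw [le_div_iff₀ (by positivity)]
  linarith

end Sphere

end ZO
end

noncomputable section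
namespace ZO

/-! ### Progress of a single iteration -/

/-- The expected decrease of a gradient step. -/
def gradDecrease (o : Version) (d : ℕ) (l ε : ℝ) : ℝ := ε ^ 2 / (256 * l * dimFactor o d)

/-- The expected decrease of a negative curvature step. -/
def curvDecrease (ρ δ : ℝ) : ℝ := δ ^ 3 / (12 * ρ ^ 2)

variable {d : ℕ} {l ρ ε δ : ℝ} {f : Vec d → ℝ}

lemma one_le_dimFactor (o : Version) (hd : 0 < d) : 1 ≤ dimFactor o d := by
  cases o
  · exact le_rfl
  · simp only [dimFactor]; exact_mod_cast hd

lemma gradDecrease_pos (o : Version) (hd : 0 < d) (hl : 0 < l) (hε : 0 < ε) :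
    0 < gradDecrease o d l ε := by
  have := one_le_dimFactor o hd
  unfold gradDecrease
  positivity

lemma curvDecrease_pos (hρ : 0 < ρ) (hδ : 0 < δ) : 0 < curvDecrease ρ δ := by
  unfold curvDecrease
  positivity

/-- With error `ε/4`, the threshold `3ε/4` separates true norms at least `ε/2` from those at most
`ε`. -/
lemma IsSmooth.norm_gradTest_sub_le (h : IsSmooth l ρ f) (hd : 0 < d) (hρ : 0 < ρ) (hε : 0 < ε)
    (x : Vec d) : ‖(coordGradEst (mu₁ d ρ ε) x).eval f - gradient f x‖ ≤ ε / 4 := by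
  have hd1 : (0 : ℝ) < d := by exact_mod_cast hd
  have hs : 0 < √(d : ℝ) := Real.sqrt_pos.2 hd1
  have hμ : 0 < mu₁ d ρ ε := Real.sqrt_pos.2 (by positivity)
  refine (h.norm_coordGradEst_sub_le hμ x).trans (le_of_eq ?_)
  rw [mu₁, Real.sq_sqrt (by positivity)]
  field_simp
  norm_num

lemma IsSmooth.half_le_norm_gradient (h : IsSmooth l ρ f) (hd : 0 < d) (hρ : 0 < ρ) (hε : 0 < ε)
    {x : Vec d} (hx : 3 * ε / 4 ≤ ‖(coordGradEst (mu₁ d ρ ε) x).eval f‖) :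
    ε / 2 ≤ ‖gradient f x‖ := by
  have h1 := h.norm_gradTest_sub_le hd hρ hε x
  have h2 := norm_le_norm_add_norm_sub' ((coordGradEst (mu₁ d ρ ε) x).eval f) (gradient f x)
  linarith

lemma IsSmooth.norm_gradient_le (h : IsSmooth l ρ f) (hd : 0 < d) (hρ : 0 < ρ) (hε : 0 < ε)
    {x : Vec d} (hx : ‖(coordGradEst (mu₁ d ρ ε) x).eval f‖ < 3 * ε / 4) :
    ‖gradient f x‖ ≤ ε := by
  have h1 := h.norm_gradTest_sub_le hd hρ hε x
  have h2 := norm_le_norm_add_norm_sub ((coordGradEst (mu₁ d ρ ε) x).eval f) (gradient f x)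
  linarith

lemma IsSmooth.apply_sub_le (h : IsSmooth l ρ f) (x v : Vec d) :
    f (x - v) ≤ f x - inner ℝ (gradient f x) v + l / 2 * ‖v‖ ^ 2 := by
  have := (abs_le.1 (h.abs_sub_linear_le x (-v))).2
  rw [← sub_eq_add_neg, inner_neg_right, norm_neg] at this
  linarith

/-- The estimation error `ε/8` is at most a quarter of the gradient norm, so the decrease is that of
gradient descent up to a constant, for every seed. -/
lemma IsSmooth.optionI_step_le (h : IsSmooth l ρ f) (hd : 0 < d) (hl : 0 < l) (hρ : 0 < ρ)
    (hε : 0 < ε) {x : Vec d} (hx : ε / 2 ≤ ‖gradient f x‖) (s : Seed d) :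
    f (x - stepSize .optionI d l • (stepGrad .optionI l ρ ε s x).eval f) ≤
      f x - gradDecrease .optionI d l ε := by
  have hd1 : (0 : ℝ) < d := by exact_mod_cast hd
  have hs : 0 < √(d : ℝ) := Real.sqrt_pos.2 hd1
  have hμ : 0 < mu₂ .optionI d l ρ ε := Real.sqrt_pos.2 (by positivity)
  have herr : ‖(stepGrad .optionI l ρ ε s x).eval f - gradient f x‖ ≤ ε / 8 := by
    refine (h.norm_coordGradEst_sub_le hμ x).trans (le_of_eq ?_)
    simp only [mu₂]
    rw [Real.sq_sqrt (by positivity)]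
    field_simp
    norm_num
  set w := (stepGrad .optionI l ρ ε s x).eval f
  set g := gradient f x
  have h1 := h.apply_sub_le x (stepSize .optionI d l • w)
  rw [inner_smul_right, norm_smul, mul_pow, Real.norm_eq_abs, sq_abs] at h1
  have h2 : ‖w‖ ^ 2 = ‖g‖ ^ 2 + 2 * inner ℝ g (w - g) + ‖w - g‖ ^ 2 := by
    rw [← norm_add_sq_real]; congr 2; abel
  have h3 : inner ℝ g w = ‖g‖ ^ 2 + inner ℝ g (w - g) := by
    rw [← real_inner_self_eq_norm_sq, ← inner_add_right]; congr 1; abel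
  have h4 : |inner ℝ g (w - g)| ≤ ‖g‖ * (‖g‖ / 4) :=
    (abs_real_inner_le_norm _ _).trans (by gcongr; linarith)
  have h5 : ‖w - g‖ ^ 2 ≤ (‖g‖ / 4) ^ 2 := by gcongr; linarith
  have h6 := (abs_le.1 h4).1
  have h7 := (abs_le.1 h4).2
  refine h1.trans ?_
  have h8 : (ε / 2) ^ 2 ≤ ‖g‖ ^ 2 := by gcongr
  have e1 : l / 2 * ((stepSize .optionI d l) ^ 2 * ‖w‖ ^ 2) = 1 / (32 * l) * ‖w‖ ^ 2 := by
    simp only [stepSize]; field_simp; ring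
  have e2 : gradDecrease .optionI d l ε = 1 / (32 * l) * (ε ^ 2 / 8) := by
    simp only [gradDecrease, dimFactor]; field_simp; norm_num
  have e3 : stepSize .optionI d l * inner ℝ g w = 1 / (32 * l) * (8 * inner ℝ g w) := by
    simp only [stepSize]; field_simp; ring
  rw [e1, e2, e3]
  have h9 : 1 / (32 * l) * (‖w‖ ^ 2 + ε ^ 2 / 8) ≤ 1 / (32 * l) * (8 * inner ℝ g w) := by
    gcongr
    nlinarith
  linarith

lemma IsSmooth.optionII_step_le (h : IsSmooth l ρ f) (hd : 0 < d) (hl : 0 < l) (hρ : 0 < ρ)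
    (hε : 0 < ε) (x : Vec d) {s : Seed d} (hs : ‖Seed.dir s‖ = 1) :
    f (x - stepSize .optionII d l • (stepGrad .optionII l ρ ε s x).eval f) ≤
      f x - 1 / (16 * l) * ((inner ℝ (gradient f x) (Seed.dir s)) ^ 2 - ε ^ 2 / (1024 * d)) := by
  have hd1 : (0 : ℝ) < d := by exact_mod_cast hd
  have hsd : 0 < √(d : ℝ) := Real.sqrt_pos.2 hd1
  set μ := mu₂ .optionII d l ρ ε with hμd
  have hμ : 0 < μ := lt_min (Real.sqrt_pos.2 (by positivity)) (by positivity)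
  have hμ2 : μ ≤ ε / (16 * √(d : ℝ) * l) := min_le_right _ _
  set u := Seed.dir s
  set g := gradient f x
  set a := (f (x + μ • u) - f (x - μ • u)) / (2 * μ) with ha
  have hstep : stepSize .optionII d l • (stepGrad .optionII l ρ ε s x).eval f = (a / (8 * l)) • u := by
    simp only [stepGrad, randGradEst_eval, stepSize, smul_smul]
    congr 1
    rw [← hμd, ← ha]
    field_simp
  have herr : |a - inner ℝ g u| ≤ ε / (32 * √d) := by
    have h1 := h.abs_central_sub_le' x (μ • u)
    rw [norm_smul, hs, mul_one, inner_smul_right, Real.norm_of_nonneg hμ.le] at h1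
    have e : a - inner ℝ g u = ((f (x + μ • u) - f (x - μ • u)) / 2 - μ * inner ℝ g u) / μ := by
      rw [ha]; field_simp
    rw [e, abs_div, abs_of_pos hμ, div_le_iff₀ hμ]
    refine h1.trans ?_
    calc l / 2 * μ ^ 2 = l / 2 * μ * μ := by ring
      _ ≤ l / 2 * (ε / (16 * √(d : ℝ) * l)) * μ := by gcongr
      _ = ε / (32 * √d) * μ := by field_simp; norm_num
  have herr2 : (a - inner ℝ g u) ^ 2 ≤ ε ^ 2 / (1024 * d) := by
    rw [← sq_abs]
    calc |a - inner ℝ g u| ^ 2 ≤ (ε / (32 * √d)) ^ 2 := by gcongr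
      _ = ε ^ 2 / (1024 * d) := by rw [div_pow, mul_pow, Real.sq_sqrt hd1.le]; norm_num
  rw [hstep]
  refine (h.apply_sub_le x _).trans ?_
  rw [inner_smul_right, norm_smul, hs, mul_one, Real.norm_eq_abs, sq_abs]
  set t := inner ℝ g u
  have e1 : a / (8 * l) * t = 1 / (16 * l) * (2 * a * t) := by field_simp; ring
  -- What remains follows from `t² - (a - t)² = 2at - a² ≤ 2at - a²/8`.
  have e2 : l / 2 * (a / (8 * l)) ^ 2 = 1 / (16 * l) * (a ^ 2 / 8) := by field_simp; ring
  rw [e1, e2]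
  have : 1 / (16 * l) * (t ^ 2 - ε ^ 2 / (1024 * d)) ≤ 1 / (16 * l) * (2 * a * t - a ^ 2 / 8) := by
    refine mul_le_mul_of_nonneg_left ?_ (by positivity)
    nlinarith [sq_nonneg (a - t), sq_nonneg (a + t), sq_nonneg t]
  linarith

lemma measurePreserving_dir (hd : 0 < d) :
    MeasurePreserving (Seed.dir : Seed d → Vec d) (seedLaw d) (sphereUniform d) := by
  have := isProbabilityMeasure_sphereUniform hd
  have : IsProbabilityMeasure coin := by unfold coin; infer_instance
  exact measurePreserving_fst.comp measurePreserving_snd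

lemma isProbabilityMeasure_coin : IsProbabilityMeasure coin := by unfold coin; infer_instance

lemma isProbabilityMeasure_seedLaw (hd : 0 < d) : IsProbabilityMeasure (seedLaw d) := by
  have := isProbabilityMeasure_sphereUniform hd
  have := isProbabilityMeasure_coin
  unfold seedLaw; infer_instance

lemma ae_seedLaw_norm_dir (hd : 0 < d) : ∀ᵐ s ∂(seedLaw d), ‖Seed.dir s‖ = 1 :=
  (measurePreserving_dir hd).quasiMeasurePreserving.ae ae_sphereUniform_norm_eq_one

lemma inner_eq_norm_mul_inner_normalized {g : Vec d} (hg : 0 < ‖g‖) (u : Vec d) :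
    ‖(1 / ‖g‖) • g‖ = 1 ∧ inner ℝ g u = ‖g‖ * inner ℝ ((1 / ‖g‖) • g) u := by
  constructor
  · rw [norm_smul, Real.norm_of_nonneg (by positivity)]; field_simp
  · rw [real_inner_smul_left]; field_simp

/-- Multiply by `exp t ≥ 1 + t + t²/2`: the product of the two quadratics is `1 + t⁴/4`. -/
lemma exp_neg_le_quadratic {t : ℝ} (ht : 0 ≤ t) : Real.exp (-t) ≤ 1 - t + t ^ 2 / 2 := by
  have h1 := Real.quadratic_le_exp_of_nonneg ht
  rw [Real.exp_neg, inv_le_iff_one_le_mul₀ (Real.exp_pos t)]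
  have h2 : 0 ≤ 1 - t + t ^ 2 / 2 := by nlinarith [sq_nonneg (t - 1)]
  nlinarith [mul_le_mul_of_nonneg_left h1 h2, sq_nonneg (t ^ 2)]

/-- Expected decrease in a gradient step. -/
lemma IsSmooth.lintegral_gradStep_le (h : IsSmooth l ρ f) (hd : 0 < d) (hl : 0 < l) (hρ : 0 < ρ)
    (hε : 0 < ε) (o : Version) {x : Vec d} (hx : ε / 2 ≤ ‖gradient f x‖) {b : ℝ}
    (hb : ∀ y, b ≤ f y) :
    ∫⁻ s, ENNReal.ofReal (f (x - stepSize o d l • (stepGrad o l ρ ε s x).eval f) - b) ∂(seedLaw d) ≤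
      ENNReal.ofReal (f x - b - gradDecrease o d l ε) := by
  have hprob := isProbabilityMeasure_seedLaw hd
  cases o with
  | optionI =>
    calc _ ≤ ∫⁻ _, ENNReal.ofReal (f x - b - gradDecrease .optionI d l ε) ∂(seedLaw d) := by
          refine lintegral_mono fun s => ENNReal.ofReal_le_ofReal ?_
          have := h.optionI_step_le hd hl hρ hε hx s
          linarith
      _ = _ := by simp
  | optionII =>
    have hd1 : (0 : ℝ) < d := by exact_mod_cast hd
    have hg : 0 < ‖gradient f x‖ := by linarith
    obtain ⟨v, hv⟩ : ∃ v, v = (1 / ‖gradient f x‖) • gradient f x := ⟨_, rfl⟩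
    have hv1 : ‖v‖ = 1 := hv ▸ (inner_eq_norm_mul_inner_normalized hg 0).1
    have hin : ∀ u, inner ℝ (gradient f x) u = ‖gradient f x‖ * inner ℝ v u := fun u =>
      hv ▸ (inner_eq_norm_mul_inner_normalized hg u).2
    have := isProbabilityMeasure_sphereUniform hd
    set G : Vec d → ℝ := fun u => f x - b - 1 / (16 * l) *
      (‖gradient f x‖ ^ 2 * (inner ℝ v u) ^ 2 - ε ^ 2 / (1024 * d)) with hG
    have hGc : Continuous G := by fun_prop
    have hle : ∀ᵐ s ∂(seedLaw d), f (x - stepSize .optionII d l •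
        (stepGrad .optionII l ρ ε s x).eval f) - b ≤ G (Seed.dir s) := by
      filter_upwards [ae_seedLaw_norm_dir hd] with s hs
      have := h.optionII_step_le hd hl hρ hε x hs
      rw [hin, mul_pow] at this
      simp only [hG]
      linarith
    -- `G` dominates the gap `f - b` after the step; nonnegativity lets the truncated integral
    -- become a Bochner integral.
    have hG0 : ∀ᵐ u ∂(sphereUniform d), 0 ≤ G u := by
      rw [← (measurePreserving_dir hd).map_eq, ae_map_iff (measurePreserving_dir hd).aemeasurable
        (measurableSet_le measurable_const hGc.measurable)]
      filter_upwards [hle] with s hs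
      exact le_trans (sub_nonneg.2 (hb _)) hs
    have hi := (integrable_inner_pow hd v 2)
    have hi2 : Integrable (fun u => 1 / (16 * l) *
      (‖gradient f x‖ ^ 2 * (inner ℝ v u) ^ 2 - ε ^ 2 / (1024 * d))) (sphereUniform d) :=
      ((hi.const_mul _).sub (integrable_const _)).const_mul _
    have hGi : Integrable G (sphereUniform d) := (integrable_const _).sub hi2
    calc _ ≤ ∫⁻ s, ENNReal.ofReal (G (Seed.dir s)) ∂(seedLaw d) := by
          refine lintegral_mono_ae ?_
          filter_upwards [hle] with s hs
          exact ENNReal.ofReal_le_ofReal hs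
      _ = ∫⁻ u, ENNReal.ofReal (G u) ∂(sphereUniform d) :=
          (measurePreserving_dir hd).lintegral_comp (f := fun u => ENNReal.ofReal (G u))
            hGc.measurable.ennreal_ofReal
      _ = ENNReal.ofReal (∫ u, G u ∂(sphereUniform d)) :=
          (ofReal_integral_eq_lintegral_ofReal hGi hG0).symm
      _ ≤ _ := by
          refine ENNReal.ofReal_le_ofReal ?_
          have hval : ∫ u, G u ∂(sphereUniform d) =
              f x - b - 1 / (16 * l) * (‖gradient f x‖ ^ 2 * (1 / d) - ε ^ 2 / (1024 * d)) := by
            simp only [hG]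
            rw [integral_sub (integrable_const _) hi2, integral_const_mul,
              integral_sub (hi.const_mul _) (integrable_const _), integral_const_mul,
              integral_inner_sq_sphereUniform hd hv1]
            simp
          rw [hval]
          have h1 : (ε / 2) ^ 2 ≤ ‖gradient f x‖ ^ 2 := by gcongr
          have h2 : gradDecrease .optionII d l ε ≤
              1 / (16 * l) * ((ε / 2) ^ 2 * (1 / d) - ε ^ 2 / (1024 * d)) := by
            have e : 1 / (16 * l) * ((ε / 2) ^ 2 * (1 / d) - ε ^ 2 / (1024 * d)) =
              255 / 64 * gradDecrease .optionII d l ε := by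
              simp only [gradDecrease, dimFactor]; field_simp; norm_num
            rw [e]
            have := gradDecrease_pos .optionII hd hl hε
            linarith
          have h3 : 1 / (16 * l) * ((ε / 2) ^ 2 * (1 / d) - ε ^ 2 / (1024 * d)) ≤
              1 / (16 * l) * (‖gradient f x‖ ^ 2 * (1 / d) - ε ^ 2 / (1024 * d)) := by gcongr
          linarith

/-- Exponential moment of the change in a gradient step. -/
lemma IsSmooth.lintegral_exp_gradStep_le (h : IsSmooth l ρ f) (hd : 0 < d) (hl : 0 < l)
    (hρ : 0 < ρ) (hε : 0 < ε) (o : Version) {x : Vec d} (hx : ε / 2 ≤ ‖gradient f x‖) {θ : ℝ}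
    (hθ : 0 ≤ θ) (hθD : θ * gradDecrease o d l ε ≤ 1 / 16) :
    ∫⁻ s, ENNReal.ofReal (Real.exp
        (θ * (f (x - stepSize o d l • (stepGrad o l ρ ε s x).eval f) - f x))) ∂(seedLaw d) ≤
      ENNReal.ofReal (Real.exp (-(θ * gradDecrease o d l ε))) := by
  have hprob := isProbabilityMeasure_seedLaw hd
  cases o with
  | optionI =>
    calc _ ≤ ∫⁻ _, ENNReal.ofReal (Real.exp (-(θ * gradDecrease .optionI d l ε))) ∂(seedLaw d) := by
          refine lintegral_mono fun s => ENNReal.ofReal_le_ofReal (Real.exp_le_exp.2 ?_)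
          have := h.optionI_step_le hd hl hρ hε hx s
          nlinarith
      _ = _ := by simp
  | optionII =>
    have hd1 : (0 : ℝ) < d := by exact_mod_cast hd
    have hg : 0 < ‖gradient f x‖ := by linarith
    obtain ⟨v, hv⟩ : ∃ v, v = (1 / ‖gradient f x‖) • gradient f x := ⟨_, rfl⟩
    have hv1 : ‖v‖ = 1 := hv ▸ (inner_eq_norm_mul_inner_normalized hg 0).1
    have hin : ∀ u, inner ℝ (gradient f x) u = ‖gradient f x‖ * inner ℝ v u := fun u =>
      hv ▸ (inner_eq_norm_mul_inner_normalized hg u).2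
    have := isProbabilityMeasure_sphereUniform hd
    -- This makes the random exponent `-t d ⟨v, u⟩²`, whose mean is `-t`.
    obtain ⟨t, ht⟩ : ∃ t, t = 4 * (θ * gradDecrease .optionII d l ε) := ⟨_, rfl⟩
    have hDg := gradDecrease_pos .optionII hd hl hε
    have ht0 : 0 ≤ t := by rw [ht]; positivity
    have ht1 : t ≤ 1 / 4 := by linarith
    have eθ : θ / (16 * l) * (ε / 2) ^ 2 = t * d := by
      rw [ht]; simp only [gradDecrease, dimFactor]; field_simp; ring
    have eθ2 : θ / (16 * l) * (ε ^ 2 / (1024 * d)) = t / 256 := by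
      rw [ht]; simp only [gradDecrease, dimFactor]; field_simp; ring
    set G : Vec d → ℝ := fun u => Real.exp (t / 256) *
      (1 - (t * d) * (inner ℝ v u) ^ 2 + (t * d) ^ 2 / 2 * (inner ℝ v u) ^ 4) with hG
    have hGc : Continuous G := by fun_prop
    have hG0 : ∀ u, 0 ≤ G u := fun u => by
      refine mul_nonneg (Real.exp_pos _).le ?_
      nlinarith [sq_nonneg ((t * d) * (inner ℝ v u) ^ 2 - 1)]
    have hle : ∀ᵐ s ∂(seedLaw d), Real.exp (θ * (f (x - stepSize .optionII d l •
        (stepGrad .optionII l ρ ε s x).eval f) - f x)) ≤ G (Seed.dir s) := by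
      filter_upwards [ae_seedLaw_norm_dir hd] with s hs
      have h1 := h.optionII_step_le hd hl hρ hε x hs
      rw [hin, mul_pow] at h1
      have h2 : (ε / 2) ^ 2 * (inner ℝ v (Seed.dir s)) ^ 2 ≤
        ‖gradient f x‖ ^ 2 * (inner ℝ v (Seed.dir s)) ^ 2 := by gcongr
      have h3 : θ * (f (x - stepSize .optionII d l •
        (stepGrad .optionII l ρ ε s x).eval f) - f x) ≤
          t / 256 + -((t * d) * (inner ℝ v (Seed.dir s)) ^ 2) := by
        calc _ ≤ θ * (-(1 / (16 * l) * ((ε / 2) ^ 2 * (inner ℝ v (Seed.dir s)) ^ 2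
              - ε ^ 2 / (1024 * d)))) := by
              gcongr
              have : 1 / (16 * l) * ((ε / 2) ^ 2 * (inner ℝ v (Seed.dir s)) ^ 2
                - ε ^ 2 / (1024 * d)) ≤ 1 / (16 * l) *
                (‖gradient f x‖ ^ 2 * (inner ℝ v (Seed.dir s)) ^ 2 - ε ^ 2 / (1024 * d)) := by
                gcongr
              linarith
          _ = θ / (16 * l) * (ε ^ 2 / (1024 * d))
              - θ / (16 * l) * (ε / 2) ^ 2 * (inner ℝ v (Seed.dir s)) ^ 2 := by ring
          _ = _ := by rw [eθ, eθ2]; ring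
      refine (Real.exp_le_exp.2 h3).trans ?_
      rw [Real.exp_add]
      simp only [hG]
      gcongr
      refine (exp_neg_le_quadratic (by positivity)).trans (le_of_eq ?_)
      ring
    have hi2 := integrable_inner_pow hd v 2
    have hi4 := integrable_inner_pow hd v 4
    have hia : Integrable (fun u => 1 - (t * d) * (inner ℝ v u) ^ 2) (sphereUniform d) :=
      (integrable_const _).sub (hi2.const_mul _)
    have hGi : Integrable G (sphereUniform d) :=
      (hia.add (hi4.const_mul ((t * d) ^ 2 / 2))).const_mul _
    calc _ ≤ ∫⁻ s, ENNReal.ofReal (G (Seed.dir s)) ∂(seedLaw d) := by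
          refine lintegral_mono_ae ?_
          filter_upwards [hle] with s hs
          exact ENNReal.ofReal_le_ofReal hs
      _ = ∫⁻ u, ENNReal.ofReal (G u) ∂(sphereUniform d) :=
          (measurePreserving_dir hd).lintegral_comp (f := fun u => ENNReal.ofReal (G u))
            hGc.measurable.ennreal_ofReal
      _ = ENNReal.ofReal (∫ u, G u ∂(sphereUniform d)) :=
          (ofReal_integral_eq_lintegral_ofReal hGi (Filter.Eventually.of_forall hG0)).symm
      _ ≤ _ := by
          refine ENNReal.ofReal_le_ofReal ?_
          have hval : ∫ u, G u ∂(sphereUniform d) = Real.exp (t / 256) * (1 - (t * d) * (1 / d)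
              + (t * d) ^ 2 / 2 * ∫ u, (inner ℝ v u) ^ 4 ∂(sphereUniform d)) := by
            simp only [hG]
            rw [integral_const_mul, integral_add hia (hi4.const_mul _),
              integral_sub (integrable_const _) (hi2.const_mul _), integral_const_mul,
              integral_const_mul, integral_inner_sq_sphereUniform hd hv1]
            simp
          rw [hval]
          have h4 := integral_inner_pow_four_sphereUniform_le hd hv1
          calc _ ≤ Real.exp (t / 256) * (1 - (t * d) * (1 / d) + (t * d) ^ 2 / 2 * (3 / (d : ℝ) ^ 2)) := by
                gcongr
            _ = Real.exp (t / 256) * (1 - t + 3 / 2 * t ^ 2) := by field_simp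
            -- For `t ≤ 1/4`, `1 - t + 3t²/2 ≤ 1 - 5t/8`; the surplus over the required `t/4`
            -- absorbs `t/256`.
            _ ≤ Real.exp (t / 256) * Real.exp (-(5 / 8 * t)) := by
                gcongr
                have := Real.add_one_le_exp (-(5 / 8 * t))
                nlinarith
            _ = Real.exp (t / 256 + -(5 / 8 * t)) := (Real.exp_add _ _).symm
            _ ≤ _ := by
                refine Real.exp_le_exp.2 ?_
                linarith

/-- At length `δ/ρ` curvature gains `δ³/(4ρ²)` and the cubic remainder costs `δ³/(6ρ²)`. The
first-order term is kept because it changes sign with `s`. -/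
lemma IsSmooth.curvStep_le (h : IsSmooth l ρ f) (hρ : 0 < ρ) (hδ : 0 < δ) {x v : Vec d}
    (hv : IsCurvatureDir δ f x v) {s : ℝ} (hs : s ^ 2 = 1) :
    f (x + (s * (δ / ρ)) • v) ≤
      f x + s * (δ / ρ * inner ℝ (gradient f x) v) - curvDecrease ρ δ := by
  obtain ⟨hv1, hvH⟩ := hv
  have h1 := (abs_le.1 (h.abs_sub_quadratic_le x ((s * (δ / ρ)) • v))).2
  have hs1 : |s| = 1 := by
    rw [← sq_eq_sq₀ (abs_nonneg s) zero_le_one, sq_abs, hs, one_pow]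
  rw [norm_smul, hv1, mul_one, Real.norm_eq_abs, abs_mul, hs1, one_mul,
    abs_of_pos (by positivity), inner_smul_right, map_smul, inner_smul_left, inner_smul_right] at h1
  simp only [conj_trivial] at h1
  have h2 : s * (δ / ρ) * (s * (δ / ρ) * inner ℝ v (hessian f x v)) ≤
      (δ / ρ) ^ 2 * (-(δ / 2)) := by
    calc _ = s ^ 2 * ((δ / ρ) ^ 2 * inner ℝ v (hessian f x v)) := by ring
      _ = (δ / ρ) ^ 2 * inner ℝ v (hessian f x v) := by rw [hs, one_mul]
      _ ≤ _ := by gcongr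
  have e : curvDecrease ρ δ = -((δ / ρ) ^ 2 * (-(δ / 2)) / 2 + ρ / 6 * (δ / ρ) ^ 3) := by
    unfold curvDecrease; field_simp; norm_num
  rw [e]
  linarith

/-- The random first-order term contributes `cosh(θb) ≤ exp(θ²b²/2)` with `|b| ≤ δε/ρ`. The bound on
`θ` is what keeps this within half of the gain `θ N`. -/
lemma IsSmooth.exp_curvStep_le (h : IsSmooth l ρ f) (hρ : 0 < ρ) (hδ : 0 < δ) (hε : 0 < ε)
    {x v : Vec d} (hv : IsCurvatureDir δ f x v) (hx : ‖gradient f x‖ ≤ ε) {θ : ℝ} (hθ : 0 ≤ θ)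
    (hθD : θ ≤ δ / (12 * ε ^ 2)) :
    Real.exp (θ * (f (x + (1 * (δ / ρ)) • v) - f x)) +
      Real.exp (θ * (f (x + (-1 * (δ / ρ)) • v) - f x)) ≤
        2 * Real.exp (-(θ * curvDecrease ρ δ / 2)) := by
  have h1 := h.curvStep_le hρ hδ hv (s := 1) (by norm_num)
  have h2 := h.curvStep_le hρ hδ hv (s := -1) (by norm_num)
  set b := δ / ρ * inner ℝ (gradient f x) v
  have hb : b ^ 2 ≤ (δ / ρ * ε) ^ 2 := by
    have h3 := abs_real_inner_le_norm (gradient f x) v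
    rw [hv.1, mul_one] at h3
    rw [← sq_abs, abs_mul, abs_of_pos (by positivity : 0 < δ / ρ)]
    have := h3.trans hx
    gcongr
  calc _ ≤ Real.exp (θ * b - θ * curvDecrease ρ δ) + Real.exp (-(θ * b) - θ * curvDecrease ρ δ) := by
        gcongr
        · nlinarith
        · nlinarith
    _ = 2 * Real.cosh (θ * b) * Real.exp (-(θ * curvDecrease ρ δ)) := by
        rw [Real.cosh_eq, sub_eq_add_neg, sub_eq_add_neg, Real.exp_add, Real.exp_add]; ring
    _ ≤ 2 * Real.exp ((θ * b) ^ 2 / 2) * Real.exp (-(θ * curvDecrease ρ δ)) := by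
        gcongr
        exact Real.cosh_le_exp_half_sq _
    _ = 2 * Real.exp ((θ * b) ^ 2 / 2 - θ * curvDecrease ρ δ) := by
        rw [sub_eq_add_neg, Real.exp_add]; ring
    _ ≤ _ := by
        gcongr
        have h4 : (θ * b) ^ 2 ≤ θ * curvDecrease ρ δ := by
          calc (θ * b) ^ 2 = θ * θ * b ^ 2 := by ring
            _ ≤ θ * (δ / (12 * ε ^ 2)) * (δ / ρ * ε) ^ 2 := by gcongr
            _ = θ * curvDecrease ρ δ := by unfold curvDecrease; field_simp
        linarith

end ZO
end

noncomputable section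
namespace ZO

/-! ### Failure of a run -/

section Failure

variable {d : ℕ}

/-- The run of the main loop with `m` remaining iterations from `x` has no output, or a wrong one,
or takes more than `k` negative curvature steps. -/
def Fails (o : Version) (l ρ ε δ q C₁ : ℝ) (f : Vec d → ℝ) :
    (m k : ℕ) → (Fin m → Seed d) → Vec d → Prop
  | 0, _, _, _ => True
  | m + 1, k, ω, x =>
    (3 * ε / 4 ≤ ‖(coordGradEst (mu₁ d ρ ε) x).eval f‖ ∧
      Fails o l ρ ε δ q C₁ f m k (fun i => ω i.succ)
        (x - stepSize o d l • (stepGrad o l ρ ε (ω 0) x).eval f)) ∨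
    (¬ 3 * ε / 4 ≤ ‖(coordGradEst (mu₁ d ρ ε) x).eval f‖ ∧
      (ncfDeterministic l ρ δ q C₁ (Seed.gauss (ω 0)) x).eval f = none ∧ ¬ IsSOSP ε δ f x) ∨
    (¬ 3 * ε / 4 ≤ ‖(coordGradEst (mu₁ d ρ ε) x).eval f‖ ∧
      ¬ (ncfDeterministic l ρ δ q C₁ (Seed.gauss (ω 0)) x).eval f = none ∧
      match k with
      | 0 => True
      -- The default `0` of `getD` is never used, since this branch excludes `none`.
      | k + 1 => Fails o l ρ ε δ q C₁ f m k (fun i => ω i.succ)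
          (x + (signValue (Seed.sign (ω 0)) * (δ / ρ)) •
            ((ncfDeterministic l ρ δ q C₁ (Seed.gauss (ω 0)) x).eval f).getD 0))

/-- The gradient test and a gradient step use at most `4d` queries per iteration. Only `k` curvature
calls may return a vector; the extra one in `k + 1` is the final call returning `⊥`. -/
lemma gdLoop_of_not_fails {o : Version} {l ρ ε δ q C₁ : ℝ} {f : Vec d → ℝ} (hd : 0 < d) (m k : ℕ)
    (ω : Fin m → Seed d) (x : Vec d) (h : ¬ Fails o l ρ ε δ q C₁ f m k ω x) :
    (∃ y, (gdLoop o l ρ ε δ q C₁ m ω x).eval f = some y ∧ IsSOSP ε δ f y) ∧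
      (gdLoop o l ρ ε δ q C₁ m ω x).cost f ≤
        4 * d * m + 4 * d * ncfT d l δ q C₁ * (k + 1) := by
  induction m generalizing k x with
  | zero => exact absurd trivial h
  | succ m ih =>
    simp only [Fails, not_or] at h
    obtain ⟨h1, h2, h3⟩ := h
    simp only [gdLoop, Prog.eval_bind, Prog.cost_bind, coordGradEst_cost]
    by_cases hg : 3 * ε / 4 ≤ ‖(coordGradEst (mu₁ d ρ ε) x).eval f‖
    · obtain ⟨ih1, ih2⟩ := ih k _ _ fun hb => h1 ⟨hg, hb⟩
      simp only [if_pos hg, Prog.eval_bind, Prog.cost_bind]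
      refine ⟨ih1, ?_⟩
      have hs : (stepGrad o l ρ ε (ω 0) x).cost f ≤ 2 * d := by
        cases o
        · simp only [stepGrad, coordGradEst_cost]; omega
        · simp only [stepGrad, randGradEst_cost]; omega
      rw [mul_add, mul_one]
      omega
    · have hn : (ncfDeterministic l ρ δ q C₁ (Seed.gauss (ω 0)) x).cost f ≤
          4 * d * ncfT d l δ q C₁ :=
        (ncfLoop_cost_le f l δ x _ _ _ _).trans (le_of_eq (by ring))
      simp only [if_neg hg, Prog.eval_bind, Prog.cost_bind]
      rcases hR : (ncfDeterministic l ρ δ q C₁ (Seed.gauss (ω 0)) x).eval f with _ | v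
      · refine ⟨⟨x, rfl, ?_⟩, ?_⟩
        · by_contra hs
          exact h2 ⟨hg, hR, hs⟩
        · simp only [Prog.cost_pure]
          have : 4 * d * ncfT d l δ q C₁ ≤ 4 * d * ncfT d l δ q C₁ * (k + 1) :=
            Nat.le_mul_of_pos_right _ (Nat.succ_pos k)
          rw [mul_add, mul_one]
          omega
      · have hR' : ¬ (ncfDeterministic l ρ δ q C₁ (Seed.gauss (ω 0)) x).eval f = none := by
          rw [hR]; simp
        rcases k with _ | k
        · exact absurd ⟨hg, hR', trivial⟩ h3
        · obtain ⟨ih1, ih2⟩ := ih k (fun i => ω i.succ)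
            (x + (signValue (Seed.sign (ω 0)) * (δ / ρ)) • v)
            fun hb => h3 ⟨hg, hR', by rw [hR]; exact hb⟩
          refine ⟨ih1, ?_⟩
          have e : 4 * d * ncfT d l δ q C₁ * (k + 1 + 1) =
              4 * d * ncfT d l δ q C₁ + 4 * d * ncfT d l δ q C₁ * (k + 1) := by ring
          rw [e, mul_add, mul_one]
          simp only
          omega

end Failure

/-! ### Measurability -/

section Measurability

variable {d : ℕ} {f : Vec d → ℝ}

lemma measurable_coordGradEst (hf : Measurable f) (μ : ℝ) :
    Measurable fun x => (coordGradEst μ x).eval f := by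
  simp only [coordGradEst_eval]
  fun_prop

lemma measurable_ncfMap {α : Type*} [MeasurableSpace α] (hf : Measurable f) (l δ : ℝ)
    {g h : α → Vec d} (hg : Measurable g) (hh : Measurable h) :
    Measurable fun p => ncfMap f l δ (g p) (h p) := by
  simp only [ncfMap, hessVecEst_eval]
  fun_prop

lemma measurable_stepGrad (hf : Measurable f) (o : Version) (l ρ ε : ℝ) :
    Measurable fun p : Seed d × Vec d => (stepGrad o l ρ ε p.1 p.2).eval f := by
  cases o
  · exact (measurable_coordGradEst hf _).comp measurable_snd
  · simp only [stepGrad, randGradEst_eval, Seed.dir]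
    fun_prop

/-- Splitting the optional result into the event `none` and a vector with default `0` avoids a
σ-algebra on `Option`. -/
lemma measurable_ncfLoop (hf : Measurable f) (l δ r : ℝ) (k : ℕ) :
    MeasurableSet {p : Vec d × Vec d × Vec d | (ncfLoop l δ r p.1 k p.2.1 p.2.2).eval f = none} ∧
      Measurable fun p : Vec d × Vec d × Vec d =>
        ((ncfLoop l δ r p.1 k p.2.1 p.2.2).eval f).getD 0 := by
  induction k with
  | zero =>
    have e : ∀ p : Vec d × Vec d × Vec d,
      (ncfLoop l δ r p.1 0 p.2.1 p.2.2).eval f = none := fun p => rfl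
    simp only [e]
    exact ⟨by simp, by simp⟩
  | succ k ih =>
    have h1 : Measurable fun p : Vec d × Vec d × Vec d => p.1 := measurable_fst
    have h2 : Measurable fun p : Vec d × Vec d × Vec d => p.2.1 := measurable_fst.comp measurable_snd
    have h3 : Measurable fun p : Vec d × Vec d × Vec d => p.2.2 := measurable_snd.comp measurable_snd
    have hM : Measurable fun p : Vec d × Vec d × Vec d => ncfMap f l δ p.1 p.2.2 :=
      measurable_ncfMap hf l δ h1 h3
    have hW : Measurable fun p : Vec d × Vec d × Vec d => ncfMap f l δ p.1 p.2.2 - p.2.1 :=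
      hM.sub h2
    have hN : Measurable fun p : Vec d × Vec d × Vec d =>
        (p.1, p.2.2, (2 : ℝ) • ncfMap f l δ p.1 p.2.2 - p.2.1) :=
      h1.prodMk (h3.prodMk ((hM.const_smul (2 : ℝ)).sub h2))
    have hS : MeasurableSet {p : Vec d × Vec d × Vec d |
        r ≤ ‖ncfMap f l δ p.1 p.2.2 - p.2.1‖} :=
      measurableSet_le measurable_const hW.norm
    simp only [ncfLoop_succ_eval]
    constructor
    · have : {p : Vec d × Vec d × Vec d | (if r ≤ ‖ncfMap f l δ p.1 p.2.2 - p.2.1‖ then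
          some ((1 / ‖ncfMap f l δ p.1 p.2.2 - p.2.1‖) • (ncfMap f l δ p.1 p.2.2 - p.2.1))
          else (ncfLoop l δ r p.1 k p.2.2 ((2 : ℝ) • ncfMap f l δ p.1 p.2.2 - p.2.1)).eval f)
          = none} = {p | r ≤ ‖ncfMap f l δ p.1 p.2.2 - p.2.1‖}ᶜ ∩
          (fun p => (p.1, p.2.2, (2 : ℝ) • ncfMap f l δ p.1 p.2.2 - p.2.1)) ⁻¹'
            {p : Vec d × Vec d × Vec d | (ncfLoop l δ r p.1 k p.2.1 p.2.2).eval f = none} := by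
        ext p
        simp only [Set.mem_ofPred_eq, Set.mem_inter_iff, Set.mem_compl_iff, Set.mem_preimage]
        split_ifs with h <;> simp [h]
      rw [this]
      exact hS.compl.inter (hN ih.1)
    · have : (fun p : Vec d × Vec d × Vec d => (if r ≤ ‖ncfMap f l δ p.1 p.2.2 - p.2.1‖ then
          some ((1 / ‖ncfMap f l δ p.1 p.2.2 - p.2.1‖) • (ncfMap f l δ p.1 p.2.2 - p.2.1))
          else (ncfLoop l δ r p.1 k p.2.2 ((2 : ℝ) • ncfMap f l δ p.1 p.2.2 - p.2.1)).eval f).getD 0)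
          = fun p => if r ≤ ‖ncfMap f l δ p.1 p.2.2 - p.2.1‖ then
            ((1 / ‖ncfMap f l δ p.1 p.2.2 - p.2.1‖) • (ncfMap f l δ p.1 p.2.2 - p.2.1))
          else ((ncfLoop l δ r p.1 k p.2.2
            ((2 : ℝ) • ncfMap f l δ p.1 p.2.2 - p.2.1)).eval f).getD 0 := by
        funext p
        split_ifs with h <;> simp
      rw [this]
      exact Measurable.ite hS ((hW.norm.const_div 1).smul hW) (ih.2.comp hN)

lemma measurable_ncfDeterministic (hf : Measurable f) (l ρ δ q C₁ : ℝ) :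
    MeasurableSet {p : Vec d × Vec d | (ncfDeterministic l ρ δ q C₁ p.1 p.2).eval f = none} ∧
      Measurable fun p : Vec d × Vec d =>
        ((ncfDeterministic l ρ δ q C₁ p.1 p.2).eval f).getD 0 := by
  obtain ⟨h1, h2⟩ := measurable_ncfLoop hf l δ (ncfRadius d l ρ δ q C₁) (ncfT d l δ q C₁)
  have hm : Measurable fun p : Vec d × Vec d =>
      (p.2, (0 : Vec d), (ncfSigma d l ρ δ q C₁ / ‖p.1‖) • p.1) := by
    fun_prop
  exact ⟨hm h1, h2.comp hm⟩

lemma IsSmooth.measurableSet_isSOSP {l ρ : ℝ} (h : IsSmooth l ρ f) (ε δ : ℝ) :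
    MeasurableSet {x | IsSOSP ε δ f x} := by
  have h1 : IsClosed {x | ‖gradient f x‖ ≤ ε} :=
    isClosed_le h.continuous_gradient.norm continuous_const
  have h2 : IsClosed {x | ∀ v : Vec d, -δ * ‖v‖ ^ 2 ≤ inner ℝ v (hessian f x v)} := by
    simp only [Set.ofPred_forall]
    refine isClosed_iInter fun v => isClosed_le continuous_const ?_
    exact continuous_const.inner (h.continuous_hessian.clm_apply continuous_const)
  exact (h1.inter h2).measurableSet

lemma IsSmooth.measurableSet_fails {l ρ : ℝ} (h : IsSmooth l ρ f) (o : Version)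
    (ε δ q C₁ : ℝ) (m k : ℕ) :
    MeasurableSet {p : (Fin m → Seed d) × Vec d | Fails o l ρ ε δ q C₁ f m k p.1 p.2} := by
  have hf : Measurable f := h.continuous.measurable
  induction m generalizing k with
  | zero => simp [Fails]
  | succ m ih =>
    have hx : Measurable fun p : (Fin (m + 1) → Seed d) × Vec d => p.2 := measurable_snd
    have hs : Measurable fun p : (Fin (m + 1) → Seed d) × Vec d => p.1 0 := by fun_prop
    have ht : Measurable fun p : (Fin (m + 1) → Seed d) × Vec d => fun i : Fin m => p.1 i.succ := by
      fun_prop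
    have hG : MeasurableSet {p : (Fin (m + 1) → Seed d) × Vec d |
        3 * ε / 4 ≤ ‖(coordGradEst (mu₁ d ρ ε) p.2).eval f‖} :=
      measurableSet_le measurable_const ((measurable_coordGradEst hf _).comp hx).norm
    have hξx : Measurable fun p : (Fin (m + 1) → Seed d) × Vec d => (Seed.gauss (p.1 0), p.2) :=
      (measurable_fst.comp hs).prodMk hx
    obtain ⟨hN1, hN2⟩ := measurable_ncfDeterministic hf l ρ δ q C₁
    have hN := hξx hN1
    have hV := hN2.comp hξx
    have hsg : Measurable fun p : (Fin (m + 1) → Seed d) × Vec d =>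
        signValue (Seed.sign (p.1 0)) :=
      (Measurable.of_discrete (f := signValue)).comp
        ((measurable_snd.comp measurable_snd).comp hs)
    have hstep : Measurable fun p : (Fin (m + 1) → Seed d) × Vec d =>
        (stepGrad o l ρ ε (p.1 0) p.2).eval f :=
      (measurable_stepGrad hf o l ρ ε).comp (hs.prodMk hx)
    have hA := hG.inter ((ht.prodMk (hx.sub (hstep.const_smul (stepSize o d l)))) (ih k))
    have hB := hG.compl.inter (hN.inter (hx (h.measurableSet_isSOSP ε δ)).compl)
    rcases k with _ | k
    · refine (hA.union (hB.union (hG.compl.inter (hN.compl)))).congr ?_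
      ext p
      simp only [Fails, Set.mem_union, Set.mem_inter_iff, Set.mem_compl_iff, Set.mem_preimage,
        Set.mem_ofPred_eq, and_true]
      rfl
    · have hC := hG.compl.inter (hN.compl.inter
        ((ht.prodMk (hx.add ((hsg.mul_const (δ / ρ)).smul hV))) (ih k)))
      exact hA.union (hB.union hC)

end Measurability

end ZO
end

noncomputable section
namespace ZO

/-! ### Bounding the failure probability by a potential -/

section Potential

open scoped ENNReal

variable {d : ℕ} {f : Vec d → ℝ}

/-- Disintegration along the first seed: the Markov property behind the induction on the remaining
iterations. -/
lemma runLaw_succ_apply (hd : 0 < d) {m : ℕ} {A : Set (Fin (m + 1) → Seed d)}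
    (hA : MeasurableSet A) :
    runLaw d (m + 1) A = ∫⁻ s, runLaw d m {ω | Fin.cons s ω ∈ A} ∂seedLaw d := by
  have := isProbabilityMeasure_seedLaw hd
  have hp := (measurePreserving_piFinSuccAbove (fun _ : Fin (m + 1) => seedLaw d) 0).symm
  rw [runLaw, ← hp.measure_preimage hA.nullMeasurableSet, Measure.prod_apply (hp.measurable hA)]
  refine lintegral_congr fun s => ?_
  congr 1
  ext ω
  simp only [Set.mem_preimage, Set.mem_ofPred_eq, MeasurableEquiv.piFinSuccAbove_symm_apply,
    Fin.insertNthEquiv_zero]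
  rfl

lemma lintegral_coin (g : Bool → ℝ≥0∞) :
    ∫⁻ b, g b ∂coin = 2⁻¹ * g true + 2⁻¹ * g false := by
  rw [lintegral_fintype]
  simp [coin, mul_comm]

/-- A potential that is at least one when the iterations or the negative curvature steps are used
up, and that does not increase on average along the run, bounds the failure probability. -/
lemma IsSmooth.runLaw_fails_le {l ρ ε δ q C₁ : ℝ} (h : IsSmooth l ρ f) (hd : 0 < d) (hρ : 0 < ρ)
    (hε : 0 < ε) (o : Version) {q' : ℝ≥0∞} (Ψ : ℕ → ℕ → Vec d → ℝ≥0∞)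
    (h0 : ∀ k x, 1 ≤ Ψ 0 k x)
    (hg : ∀ m k x, ε / 2 ≤ ‖gradient f x‖ → Ψ (m + 1) k x < 1 →
      ∫⁻ s, Ψ m k (x - stepSize o d l • (stepGrad o l ρ ε s x).eval f) ∂seedLaw d ≤
        Ψ (m + 1) k x)
    (hn0 : ∀ m x v, IsCurvatureDir δ f x v → 1 ≤ Ψ (m + 1) 0 x)
    (hn : ∀ m k x v, ‖gradient f x‖ ≤ ε → IsCurvatureDir δ f x v → Ψ (m + 1) (k + 1) x < 1 →
      2⁻¹ * Ψ m k (x + (1 * (δ / ρ)) • v) + 2⁻¹ * Ψ m k (x + (-1 * (δ / ρ)) • v) ≤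
        Ψ (m + 1) (k + 1) x)
    (hq : ∀ x, stdGaussian (Vec d) {ξ | ¬ NCFCorrect l ρ δ q C₁ f ξ x} ≤ q')
    (m k : ℕ) (x : Vec d) :
    runLaw d m {ω | Fails o l ρ ε δ q C₁ f m k ω x} ≤ m * q' + Ψ m k x := by
  have := isProbabilityMeasure_seedLaw hd
  have := isProbabilityMeasure_sphereUniform hd
  have := isProbabilityMeasure_coin
  have : ∀ m, IsProbabilityMeasure (runLaw d m) := fun m => by unfold runLaw; infer_instance
  induction m generalizing k x with
  | zero => exact prob_le_one.trans ((h0 k x).trans le_add_self)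
  | succ m ih =>
    -- Where the potential reaches one the claim is trivial, so supermartingale inequalities are
    -- needed only below one.
    by_cases hlt : Ψ (m + 1) k x < 1
    swap
    · exact prob_le_one.trans ((not_lt.1 hlt).trans le_add_self)
    have hmeas : MeasurableSet {ω | Fails o l ρ ε δ q C₁ f (m + 1) k ω x} :=
      (measurable_id.prodMk measurable_const) (h.measurableSet_fails o ε δ q C₁ (m + 1) k)
    rw [runLaw_succ_apply hd hmeas]
    by_cases hx : 3 * ε / 4 ≤ ‖(coordGradEst (mu₁ d ρ ε) x).eval f‖
    · calc ∫⁻ s, runLaw d m {ω | Fails o l ρ ε δ q C₁ f (m + 1) k (Fin.cons s ω) x} ∂seedLaw d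
          ≤ ∫⁻ s, (m * q' + Ψ m k (x - stepSize o d l • (stepGrad o l ρ ε s x).eval f))
              ∂seedLaw d := by
            refine lintegral_mono fun s => le_trans (le_of_eq ?_) (ih k _)
            congr 1
            ext ω
            simp [Fails, hx]
        _ = m * q' + ∫⁻ s, Ψ m k (x - stepSize o d l • (stepGrad o l ρ ε s x).eval f)
              ∂seedLaw d := by
            rw [lintegral_add_left measurable_const, lintegral_const, measure_univ, mul_one]
        _ ≤ m * q' + Ψ (m + 1) k x :=
            add_le_add le_rfl (hg m k x (h.half_le_norm_gradient hd hρ hε hx) hlt)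
        _ ≤ (m + 1 : ℕ) * q' + Ψ (m + 1) k x := by
            gcongr
            exact Nat.le_succ m
    · have hx' : ‖gradient f x‖ ≤ ε := h.norm_gradient_le hd hρ hε (not_le.1 hx)
      have hms : Measurable fun s =>
          runLaw d m {ω | Fails o l ρ ε δ q C₁ f (m + 1) k (Fin.cons s ω) x} := by
        refine measurable_measure_prodMk_left (ν := runLaw d m) (s := {p : Seed d × (Fin m → Seed d) |
          Fails o l ρ ε δ q C₁ f (m + 1) k (Fin.cons p.1 p.2) x}) ?_
        exact (measurePreserving_piFinSuccAbove (fun _ : Fin (m + 1) => seedLaw d)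
          0).symm.measurable hmeas
      change ∫⁻ s, runLaw d m {ω | Fails o l ρ ε δ q C₁ f (m + 1) k (Fin.cons s ω) x}
        ∂seedLaw d ≤ _
      -- Fixing the Gaussian fixes the direction `v`, so the sign can be averaged separately.
      -- Incorrect calls cost `q'`; as `B` need not be measurable, only an upper bound for its
      -- indicator integral is used.
      rw [seedLaw, lintegral_prod _ hms.aemeasurable]
      set B := {ξ | ¬ NCFCorrect l ρ δ q C₁ f ξ x} with hB
      calc ∫⁻ ξ, ∫⁻ t, runLaw d m {ω | Fails o l ρ ε δ q C₁ f (m + 1) k (Fin.cons (ξ, t) ω) x}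
            ∂(sphereUniform d).prod coin ∂stdGaussian (Vec d)
          ≤ ∫⁻ ξ, (B.indicator 1 ξ + (m * q' + Ψ (m + 1) k x)) ∂stdGaussian (Vec d) := by
            refine lintegral_mono fun ξ => ?_
            by_cases hξ : ξ ∈ B
            · refine le_trans ?_ (le_add_right (le_of_eq (Set.indicator_of_mem hξ _).symm))
              calc _ ≤ ∫⁻ _, 1 ∂(sphereUniform d).prod coin := lintegral_mono fun t => prob_le_one
                _ = 1 := by simp
            · rw [Set.indicator_of_notMem hξ, zero_add]
              obtain ⟨c1, c2⟩ := not_not.1 hξ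
              rcases hR : (ncfDeterministic l ρ δ q C₁ ξ x).eval f with _ | v
              · have hs : IsSOSP ε δ f x := ⟨hx', c1 hR⟩
                simp [Fails, hx, Seed.gauss, hR, hs]
              · have hv := c2 v hR
                rcases k with _ | k
                · exact absurd hlt (not_lt.2 (hn0 m x v hv))
                · let g : Bool → ℝ≥0∞ := fun b => m * q' +
                    Ψ m k (x + (signValue b * (δ / ρ)) • v)
                  calc _ ≤ ∫⁻ t, g t.2 ∂(sphereUniform d).prod coin := by
                        refine lintegral_mono fun t => le_trans (le_of_eq ?_) (ih k _)
                        congr 1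
                        ext ω
                        simp [Fails, hx, Seed.gauss, Seed.sign, hR]
                    _ = ∫⁻ b, g b ∂coin :=
                        (measurePreserving_snd (μ := sphereUniform d) (ν := coin)).lintegral_comp
                          (Measurable.of_discrete (f := g))
                    _ = m * q' + (2⁻¹ * Ψ m k (x + (1 * (δ / ρ)) • v) +
                          2⁻¹ * Ψ m k (x + (-1 * (δ / ρ)) • v)) := by
                        rw [lintegral_coin]
                        simp only [g, signValue, if_true, Bool.false_eq_true, if_false, mul_add]
                        rw [add_add_add_comm, ← add_mul, ENNReal.inv_two_add_inv_two, one_mul]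
                    _ ≤ _ := add_le_add le_rfl (hn m k x v hx' hv hlt)
        _ = ∫⁻ ξ, B.indicator 1 ξ ∂stdGaussian (Vec d) + (m * q' + Ψ (m + 1) k x) := by
            rw [lintegral_add_right _ measurable_const, lintegral_const, measure_univ, mul_one]
        _ ≤ q' + (m * q' + Ψ (m + 1) k x) :=
            add_le_add ((lintegral_indicator_one_le B).trans (hq x)) le_rfl
        _ = (m + 1 : ℕ) * q' + Ψ (m + 1) k x := by
            push_cast
            ring

end Potential

end ZO
end

noncomputable section
namespace ZO

/-! ### Three potentials -/

section Potentials

open scoped ENNReal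

variable {d : ℕ} {f : Vec d → ℝ} {l ρ ε δ b : ℝ}

lemma inv_two_mul_ofReal_add_le {A B C : ℝ} (hA : 0 ≤ A) (hB : 0 ≤ B) (h : A + B ≤ 2 * C) :
    2⁻¹ * ENNReal.ofReal A + 2⁻¹ * ENNReal.ofReal B ≤ ENNReal.ofReal C := by
  have e : (2⁻¹ : ℝ≥0∞) = ENNReal.ofReal 2⁻¹ := by
    rw [ENNReal.ofReal_inv_of_pos two_pos, ENNReal.ofReal_ofNat]
  rw [e, ← ENNReal.ofReal_mul (by norm_num), ← ENNReal.ofReal_mul (by norm_num),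
    ← ENNReal.ofReal_add (by positivity) (by positivity)]
  exact ENNReal.ofReal_le_ofReal (by linarith)

/-- Averaging the two signs cancels the first-order term: curvature directions exist only where the
gap to the lower bound is at least `N`. -/
lemma IsSmooth.curvDecrease_le (h : IsSmooth l ρ f) (hρ : 0 < ρ) (hδ : 0 < δ) {x v : Vec d}
    (hv : IsCurvatureDir δ f x v) (hb : ∀ y, b ≤ f y) : curvDecrease ρ δ ≤ f x - b := by
  have h1 := h.curvStep_le hρ hδ hv (s := 1) (by norm_num)
  have h2 := h.curvStep_le hρ hδ hv (s := -1) (by norm_num)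
  have h3 := hb (x + (1 * (δ / ρ)) • v)
  have h4 := hb (x + (-1 * (δ / ρ)) • v)
  linarith

lemma IsSmooth.gradDecrease_le (h : IsSmooth l ρ f) (hd : 0 < d) (hl : 0 < l) (hρ : 0 < ρ)
    (hε : 0 < ε) (o : Version) {x : Vec d} (hx : ε / 2 ≤ ‖gradient f x‖) (hb : ∀ y, b ≤ f y) :
    gradDecrease o d l ε ≤ f x - b := by
  have := isProbabilityMeasure_seedLaw hd
  -- Lowering the bound by one keeps the integrand at least `1`, so the truncation in `ofReal` hides
  -- nothing.
  have h1 := h.lintegral_gradStep_le hd hl hρ hε o hx (b := b - 1) fun y => by linarith [hb y]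
  have h2 : ENNReal.ofReal 1 ≤ ∫⁻ s, ENNReal.ofReal
      (f (x - stepSize o d l • (stepGrad o l ρ ε s x).eval f) - (b - 1)) ∂(seedLaw d) := by
    calc ENNReal.ofReal 1 = ∫⁻ _, ENNReal.ofReal 1 ∂(seedLaw d) := by simp
      _ ≤ _ := lintegral_mono fun s => ENNReal.ofReal_le_ofReal (by
          linarith [hb (x - stepSize o d l • (stepGrad o l ρ ε s x).eval f)])
  have h3 := (ENNReal.ofReal_le_ofReal_iff' ).1 (h2.trans h1)
  rcases h3 with h3 | h3
  · linarith
  · norm_num at h3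

/-- Both terms compare the gap with the decrease that the remaining budget would force, giving a
Markov-type bound. -/
lemma IsSmooth.runLaw_fails_le_linear (h : IsSmooth l ρ f) (hd : 0 < d) (hl : 0 < l)
    (hρ : 0 < ρ) (hε : 0 < ε) (hδ : 0 < δ) (o : Version) {q C₁ : ℝ} {q' : ℝ≥0∞}
    (hq : ∀ x, stdGaussian (Vec d) {ξ | ¬ NCFCorrect l ρ δ q C₁ f ξ x} ≤ q')
    (hb : ∀ y, b ≤ f y) {D : ℝ} (hD : 0 < D) (hDg : D ≤ gradDecrease o d l ε)
    (hDn : D ≤ curvDecrease ρ δ) (m k : ℕ) (x : Vec d) :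
    runLaw d m {ω | Fails o l ρ ε δ q C₁ f m k ω x} ≤
      m * q' + ENNReal.ofReal ((f x - b + D) / (D * (m + 1)) +
        (f x - b) / (curvDecrease ρ δ * (k + 1))) := by
  have hC := curvDecrease_pos hρ hδ
  have hF : ∀ y, 0 ≤ f y - b := fun y => sub_nonneg.2 (hb y)
  refine h.runLaw_fails_le hd hρ hε o (fun m k x => ENNReal.ofReal ((f x - b + D) / (D * (m + 1)) +
    (f x - b) / (curvDecrease ρ δ * (k + 1)))) ?_ ?_ ?_ ?_ hq m k x
  · intro k x
    rw [ENNReal.one_le_ofReal]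
    have h1 : 1 ≤ (f x - b + D) / (D * ((0 : ℕ) + 1)) := by
      rw [one_le_div (by positivity)]; push_cast; linarith [hF x]
    have h2 : 0 ≤ (f x - b) / (curvDecrease ρ δ * (k + 1)) := div_nonneg (hF x) (by positivity)
    linarith
  · intro m k x hx hlt
    have hFx := h.gradDecrease_le hd hl hρ hε o hx hb
    have hm : (0 : ℝ) < m + 1 := by positivity
    have hk : (0 : ℝ) < k + 1 := by positivity
    rw [ENNReal.ofReal_lt_one] at hlt
    have h2 : 0 ≤ (f x - b) / (curvDecrease ρ δ * (k + 1)) := div_nonneg (hF x) (by positivity)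
    have h3 : f x - b + D < D * (m + 2) := by
      have : (f x - b + D) / (D * ((m + 1 : ℕ) + 1)) < 1 := by linarith
      rw [div_lt_one (by positivity)] at this
      push_cast at this; linarith
    set α := 1 / (D * (m + 1)) + 1 / (curvDecrease ρ δ * (k + 1)) with hα
    have hα0 : 0 ≤ α := by positivity
    have e : ∀ F : ℝ, (F + D) / (D * (m + 1)) + F / (curvDecrease ρ δ * (k + 1)) =
        α * F + 1 / (m + 1) := by
      intro F; rw [hα]; field_simp; ring
    calc _ = ∫⁻ s, (ENNReal.ofReal α * ENNReal.ofReal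
            (f (x - stepSize o d l • (stepGrad o l ρ ε s x).eval f) - b) +
            ENNReal.ofReal (1 / (m + 1))) ∂seedLaw d := by
          refine lintegral_congr fun s => ?_
          rw [e, ENNReal.ofReal_add (mul_nonneg hα0 (hF _)) (by positivity),
            ENNReal.ofReal_mul hα0]
      _ ≤ ENNReal.ofReal α * ENNReal.ofReal (f x - b - gradDecrease o d l ε) +
            ENNReal.ofReal (1 / (m + 1)) := by
          have := isProbabilityMeasure_seedLaw hd
          rw [lintegral_add_right _ measurable_const, lintegral_const, measure_univ, mul_one,
            lintegral_const_mul' _ _ ENNReal.ofReal_ne_top]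
          gcongr
          exact h.lintegral_gradStep_le hd hl hρ hε o hx hb
      _ = ENNReal.ofReal (α * (f x - b - gradDecrease o d l ε) + 1 / (m + 1)) := by
          rw [← ENNReal.ofReal_mul hα0, ← ENNReal.ofReal_add
            (mul_nonneg hα0 (by linarith)) (by positivity)]
      _ ≤ _ := by
          refine ENNReal.ofReal_le_ofReal ?_
          rw [← e]
          refine add_le_add ?_ ?_
          -- After cross-multiplication and `D ≤ G`, it suffices that the gap is at most `D(m+1)`,
          -- which `h3` supplies because the potential is below one.
          · rw [div_le_div_iff₀ (by positivity) (by positivity)]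
            push_cast
            nlinarith [mul_pos hD hm, mul_nonneg (mul_pos hD hm).le (sub_nonneg.2 hDg)]
          · exact div_le_div_of_nonneg_right (by linarith) (by positivity)
  · intro m x v hv
    have hFx := h.curvDecrease_le hρ hδ hv hb
    rw [ENNReal.one_le_ofReal]
    have h1 : 0 ≤ (f x - b + D) / (D * ((m + 1 : ℕ) + 1)) :=
      div_nonneg (by linarith [hF x]) (by positivity)
    have h2 : 1 ≤ (f x - b) / (curvDecrease ρ δ * ((0 : ℕ) + 1)) := by
      rw [one_le_div (by positivity)]; push_cast; linarith
    linarith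
  · intro m k x v _ hv hlt
    have hFx := h.curvDecrease_le hρ hδ hv hb
    have hm : (0 : ℝ) < m + 1 := by positivity
    have hk : (0 : ℝ) < k + 1 := by positivity
    rw [ENNReal.ofReal_lt_one] at hlt
    have h2 : 0 ≤ (f x - b) / (curvDecrease ρ δ * ((k + 1 : ℕ) + 1)) :=
      div_nonneg (hF x) (by positivity)
    have h1 : 0 ≤ (f x - b + D) / (D * ((m + 1 : ℕ) + 1)) :=
      div_nonneg (by linarith [hF x]) (by positivity)
    have h3 : f x - b + D < D * (m + 2) := by
      have : (f x - b + D) / (D * ((m + 1 : ℕ) + 1)) < 1 := by linarith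
      rw [div_lt_one (by positivity)] at this
      push_cast at this; linarith
    have h4 : f x - b < curvDecrease ρ δ * (k + 2) := by
      have : (f x - b) / (curvDecrease ρ δ * ((k + 1 : ℕ) + 1)) < 1 := by linarith
      rw [div_lt_one (by positivity)] at this
      push_cast at this; linarith
    have s1 := h.curvStep_le hρ hδ hv (s := 1) (by norm_num)
    have s2 := h.curvStep_le hρ hδ hv (s := -1) (by norm_num)
    have hF1 := hF (x + (1 * (δ / ρ)) • v)
    have hF2 := hF (x + (-1 * (δ / ρ)) • v)
    set F1 := f (x + (1 * (δ / ρ)) • v)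
    set F2 := f (x + (-1 * (δ / ρ)) • v)
    refine inv_two_mul_ofReal_add_le (by positivity) (by positivity) ?_
    have a1 : (F1 - b + D) / (D * (m + 1)) + (F2 - b + D) / (D * (m + 1)) ≤
        2 * ((f x - b + D) / (D * ((m + 1 : ℕ) + 1))) := by
      rw [← add_div, ← mul_div_assoc, div_le_div_iff₀ (by positivity) (by positivity)]
      have : F1 - b + D + (F2 - b + D) ≤ 2 * (f x - b) := by linarith
      push_cast
      calc _ ≤ 2 * (f x - b) * (D * (m + 1 + 1)) := by gcongr
        _ ≤ _ := by nlinarith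
    have a2 : (F1 - b) / (curvDecrease ρ δ * (k + 1)) + (F2 - b) / (curvDecrease ρ δ * (k + 1)) ≤
        2 * ((f x - b) / (curvDecrease ρ δ * ((k + 1 : ℕ) + 1))) := by
      rw [← add_div, ← mul_div_assoc, div_le_div_iff₀ (by positivity) (by positivity)]
      have : F1 - b + (F2 - b) ≤ 2 * (f x - b - curvDecrease ρ δ) := by linarith
      push_cast
      calc _ ≤ 2 * (f x - b - curvDecrease ρ δ) * (curvDecrease ρ δ * (k + 1 + 1)) := by gcongr
        _ ≤ _ := by nlinarith
    linarith

lemma IsSmooth.lintegral_const_mul_exp_gradStep_le (h : IsSmooth l ρ f) (hd : 0 < d) (hl : 0 < l)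
    (hρ : 0 < ρ) (hε : 0 < ε) (o : Version) {x : Vec d} (hx : ε / 2 ≤ ‖gradient f x‖) {θ c : ℝ}
    (hθ : 0 ≤ θ) (hθD : θ * gradDecrease o d l ε ≤ 1 / 16) (hc : 0 ≤ c) :
    ∫⁻ s, ENNReal.ofReal (c * Real.exp
        (θ * (f (x - stepSize o d l • (stepGrad o l ρ ε s x).eval f) - b))) ∂(seedLaw d) ≤
      ENNReal.ofReal (c * Real.exp (θ * (f x - b) - θ * gradDecrease o d l ε)) := by
  have hc' : 0 ≤ c * Real.exp (θ * (f x - b)) := by positivity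
  calc _ = ∫⁻ s, ENNReal.ofReal (c * Real.exp (θ * (f x - b))) * ENNReal.ofReal (Real.exp
        (θ * (f (x - stepSize o d l • (stepGrad o l ρ ε s x).eval f) - f x))) ∂(seedLaw d) := by
        refine lintegral_congr fun s => ?_
        rw [← ENNReal.ofReal_mul hc', mul_assoc, ← Real.exp_add]
        congr 3
        ring
    _ ≤ ENNReal.ofReal (c * Real.exp (θ * (f x - b))) *
          ENNReal.ofReal (Real.exp (-(θ * gradDecrease o d l ε))) := by
        rw [lintegral_const_mul' _ _ ENNReal.ofReal_ne_top]
        gcongr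
        exact h.lintegral_exp_gradStep_le hd hl hρ hε o hx hθ hθD
    _ = _ := by
        rw [← ENNReal.ofReal_mul hc', mul_assoc, ← Real.exp_add]
        rfl

/-- A curvature step uses one unit of both budgets and gains `exp(-θN/2)`, while a gradient step
gains `exp(-θG)`; discounting `m` by `θD/2` and `k` by `θN/2` is compatible with both. -/
lemma IsSmooth.runLaw_fails_le_exp (h : IsSmooth l ρ f) (hd : 0 < d) (hl : 0 < l)
    (hρ : 0 < ρ) (hε : 0 < ε) (hδ : 0 < δ) (o : Version) {q C₁ : ℝ} {q' : ℝ≥0∞}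
    (hq : ∀ x, stdGaussian (Vec d) {ξ | ¬ NCFCorrect l ρ δ q C₁ f ξ x} ≤ q')
    (hb : ∀ y, b ≤ f y) {D θ : ℝ} (hDg : D ≤ gradDecrease o d l ε)
    (hDn : D ≤ curvDecrease ρ δ) (hθ : 0 ≤ θ) (hθδ : θ ≤ δ / (12 * ε ^ 2))
    (hθD : θ * gradDecrease o d l ε ≤ 1 / 16) (m k : ℕ) (x : Vec d) :
    runLaw d m {ω | Fails o l ρ ε δ q C₁ f m k ω x} ≤
      m * q' + ENNReal.ofReal ((Real.exp (-(m * (θ * D / 2))) +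
        Real.exp (-(k * (θ * curvDecrease ρ δ / 2)))) * Real.exp (θ * (f x - b))) := by
  have hC := curvDecrease_pos hρ hδ
  have hG := gradDecrease_pos o hd hl hε
  have hF : ∀ y, 0 ≤ f y - b := fun y => sub_nonneg.2 (hb y)
  refine h.runLaw_fails_le hd hρ hε o (fun m k x => ENNReal.ofReal
    ((Real.exp (-(m * (θ * D / 2))) + Real.exp (-(k * (θ * curvDecrease ρ δ / 2)))) *
      Real.exp (θ * (f x - b)))) ?_ ?_ ?_ ?_ hq m k x
  · intro k x
    rw [ENNReal.one_le_ofReal]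
    have h1 := Real.one_le_exp (mul_nonneg hθ (hF x))
    have h2 := Real.exp_pos (-(k * (θ * curvDecrease ρ δ / 2)))
    simp only [Nat.cast_zero, zero_mul, neg_zero, Real.exp_zero]
    nlinarith
  · intro m k x hx _
    refine (h.lintegral_const_mul_exp_gradStep_le hd hl hρ hε o hx hθ hθD (by positivity)).trans
      (ENNReal.ofReal_le_ofReal ?_)
    rw [sub_eq_add_neg, add_comm (θ * (f x - b)), Real.exp_add, ← mul_assoc]
    refine mul_le_mul_of_nonneg_right ?_ (Real.exp_pos _).le
    rw [add_mul, ← Real.exp_add, ← Real.exp_add]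
    have h1 : θ * D ≤ θ * gradDecrease o d l ε := by gcongr
    have h2 : 0 ≤ θ * gradDecrease o d l ε := by positivity
    refine add_le_add (Real.exp_le_exp.2 ?_) (Real.exp_le_exp.2 ?_)
    · push_cast; linarith
    · linarith
  · intro m x v _
    rw [ENNReal.one_le_ofReal]
    have h1 := Real.one_le_exp (mul_nonneg hθ (hF x))
    have h2 := Real.exp_pos (-((m + 1 : ℕ) * (θ * D / 2)))
    simp only [Nat.cast_zero, zero_mul, neg_zero, Real.exp_zero]
    nlinarith
  · intro m k x v hx hv _
    refine inv_two_mul_ofReal_add_le (by positivity) (by positivity) ?_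
    have h1 := h.exp_curvStep_le hρ hδ hε hv hx hθ hθδ
    have e : ∀ y, Real.exp (θ * (f y - b)) = Real.exp (θ * (f y - f x)) *
        Real.exp (θ * (f x - b)) := by
      intro y; rw [← Real.exp_add]; congr 1; ring
    rw [e (x + _), e (x + (-1 * (δ / ρ)) • v)]
    have h2 : (Real.exp (-(m * (θ * D / 2))) + Real.exp (-(k * (θ * curvDecrease ρ δ / 2)))) *
        Real.exp (-(θ * curvDecrease ρ δ / 2)) ≤ Real.exp (-((m + 1 : ℕ) * (θ * D / 2))) +
          Real.exp (-((k + 1 : ℕ) * (θ * curvDecrease ρ δ / 2))) := by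
      rw [add_mul, ← Real.exp_add, ← Real.exp_add]
      have h3 : θ * D ≤ θ * curvDecrease ρ δ := by gcongr
      refine add_le_add (Real.exp_le_exp.2 ?_) (Real.exp_le_exp.2 ?_)
      · push_cast; linarith
      · push_cast; linarith
    set a := Real.exp (-(m * (θ * D / 2))) + Real.exp (-(k * (θ * curvDecrease ρ δ / 2))) with ha
    have ha0 : 0 ≤ a := by positivity
    have hE := Real.exp_pos (θ * (f x - b))
    calc _ = a * (Real.exp (θ * (f (x + (1 * (δ / ρ)) • v) - f x)) +
              Real.exp (θ * (f (x + (-1 * (δ / ρ)) • v) - f x))) * Real.exp (θ * (f x - b)) := by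
            ring
      _ ≤ a * (2 * Real.exp (-(θ * curvDecrease ρ δ / 2))) * Real.exp (θ * (f x - b)) := by gcongr
      _ = 2 * ((a * Real.exp (-(θ * curvDecrease ρ δ / 2))) * Real.exp (θ * (f x - b))) := by ring
      _ ≤ _ := by gcongr

/-- For a gap well below `N`: the term `exp(-θN)` pays for the gap ever rising to `N`, without which
no curvature step is possible. No bound on `θ` in terms of `ε` is then needed. -/
lemma IsSmooth.runLaw_fails_le_exp_sub (h : IsSmooth l ρ f) (hd : 0 < d) (hl : 0 < l)
    (hρ : 0 < ρ) (hε : 0 < ε) (hδ : 0 < δ) (o : Version) {q C₁ : ℝ} {q' : ℝ≥0∞}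
    (hq : ∀ x, stdGaussian (Vec d) {ξ | ¬ NCFCorrect l ρ δ q C₁ f ξ x} ≤ q')
    (hb : ∀ y, b ≤ f y) {θ : ℝ} (hθ : 0 ≤ θ)
    (hθD : θ * gradDecrease o d l ε ≤ 1 / 16) (m k : ℕ) (x : Vec d) :
    runLaw d m {ω | Fails o l ρ ε δ q C₁ f m k ω x} ≤
      m * q' + ENNReal.ofReal ((Real.exp (-(m * (θ * gradDecrease o d l ε))) +
        Real.exp (-(θ * curvDecrease ρ δ))) * Real.exp (θ * (f x - b))) := by
  have hC := curvDecrease_pos hρ hδ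
  have hG := gradDecrease_pos o hd hl hε
  have hF : ∀ y, 0 ≤ f y - b := fun y => sub_nonneg.2 (hb y)
  have hcurv : ∀ (m : ℕ) (x v : Vec d), IsCurvatureDir δ f x v → 1 ≤ ENNReal.ofReal
      ((Real.exp (-(m * (θ * gradDecrease o d l ε))) + Real.exp (-(θ * curvDecrease ρ δ))) *
        Real.exp (θ * (f x - b))) := by
    intro m x v hv
    rw [ENNReal.one_le_ofReal, add_mul, ← Real.exp_add, ← Real.exp_add]
    have h1 : θ * curvDecrease ρ δ ≤ θ * (f x - b) := by
      gcongr; exact h.curvDecrease_le hρ hδ hv hb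
    have h2 : 1 ≤ Real.exp (-(θ * curvDecrease ρ δ) + θ * (f x - b)) :=
      Real.one_le_exp (by linarith)
    have h3 := Real.exp_pos (-(m * (θ * gradDecrease o d l ε)) + θ * (f x - b))
    linarith
  refine h.runLaw_fails_le hd hρ hε o (fun m _ x => ENNReal.ofReal
    ((Real.exp (-(m * (θ * gradDecrease o d l ε))) + Real.exp (-(θ * curvDecrease ρ δ))) *
      Real.exp (θ * (f x - b)))) ?_ ?_ (fun m x v hv => hcurv _ x v hv)
      (fun m k x v _ hv hlt => absurd hlt (not_lt.2 (hcurv _ x v hv))) hq m k x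
  · intro _ x
    rw [ENNReal.one_le_ofReal]
    have h1 := Real.one_le_exp (mul_nonneg hθ (hF x))
    have h2 := Real.exp_pos (-(θ * curvDecrease ρ δ))
    simp only [Nat.cast_zero, zero_mul, neg_zero, Real.exp_zero]
    nlinarith
  · intro m _ x hx _
    refine (h.lintegral_const_mul_exp_gradStep_le hd hl hρ hε o hx hθ hθD (by positivity)).trans
      (ENNReal.ofReal_le_ofReal ?_)
    rw [sub_eq_add_neg, add_comm (θ * (f x - b)), Real.exp_add, ← mul_assoc]
    refine mul_le_mul_of_nonneg_right ?_ (Real.exp_pos _).le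
    rw [add_mul, ← Real.exp_add, ← Real.exp_add]
    have h2 : 0 ≤ θ * gradDecrease o d l ε := by positivity
    refine add_le_add (Real.exp_le_exp.2 ?_) (Real.exp_le_exp.2 ?_)
    · push_cast; linarith
    · linarith

end Potentials

end ZO
end

noncomputable section
namespace ZO

/-! ### The failure probability for the chosen number of iterations -/

/-! ### Arithmetic: budgets that make each potential at most `p/2`. -/

section Numerics

lemma curv_budget_bound {Δ N θ L a k : ℝ} (hΔ : 0 ≤ Δ) (hN : 0 < N) (hθ : 0 < θ)
    (ha : 144 * (a * (θ * N)) = 1) (hL : 2 / 3 ≤ L)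
    (hk : 10 ^ 6 * (Δ / (12 * N) + 1) * ((1 + a) * L ^ 2) ≤ k) :
    2 * L + θ * Δ ≤ k * (θ * N / 2) := by
  have ht : 0 < θ * N := mul_pos hθ hN
  have ha0 : 0 < a := by
    by_contra h0
    nlinarith [mul_nonneg (neg_nonneg.2 (not_lt.1 h0)) ht.le]
  have hA : 0 ≤ Δ / (12 * N) := by positivity
  have e : θ * Δ = 12 * (Δ / (12 * N) * (θ * N)) := by field_simp
  set A := Δ / (12 * N)
  have hL2 : 2 / 3 * L ≤ L ^ 2 := by nlinarith
  have h1 : 10 ^ 6 * (A + 1) * ((1 + a) * L ^ 2) * (θ * N / 2) ≤ k * (θ * N / 2) := by gcongr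
  have h2 : L ^ 2 * (A * (θ * N) + a * (θ * N)) ≤ (A + 1) * ((1 + a) * L ^ 2) * (θ * N) := by
    have : 0 ≤ L ^ 2 * (θ * N) * (1 + A * a) := by positivity
    nlinarith
  have h3 : 4 / 9 * (A * (θ * N)) ≤ L ^ 2 * (A * (θ * N)) := by
    gcongr; nlinarith
  have h4 : a * (θ * N) = 1 / 144 := by linarith
  rw [h4] at h2
  rw [e]
  have h5 : 0 ≤ A * (θ * N) := by positivity
  nlinarith

/-- The difficulty is to obtain `2L` when `θG` is tiny. Since `aθN = 1/144`, it is enough to compare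
with `N`: either `Δ ≥ N/2` supplies it through the term `Δ/G`, or `N ≤ 64GL` through the second
factor `L`. -/
lemma grad_budget_bound {Δ N G θ L a K : ℝ} (hΔ : 0 ≤ Δ) (hN : 0 < N) (hG : 0 < G) (hθ : 0 < θ)
    (ha : 144 * (a * (θ * N)) = 1) (hL : 2 / 3 ≤ L) (hcase : N / 2 ≤ Δ ∨ N / (64 * G) ≤ L)
    (hK : 10 ^ 6 * (Δ / (256 * G) + 1) * ((1 + a) * L ^ 2) ≤ K) :
    2 * L + θ * Δ ≤ K * (θ * G / 2) := by
  have ht : 0 < θ * N := mul_pos hθ hN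
  have hg : 0 < θ * G := mul_pos hθ hG
  have ha0 : 0 < a := by
    by_contra h0
    nlinarith [mul_nonneg (neg_nonneg.2 (not_lt.1 h0)) ht.le]
  have hB : 0 ≤ Δ / (256 * G) := by positivity
  have e : θ * Δ = 256 * (Δ / (256 * G) * (θ * G)) := by field_simp
  have hL2 : 2 / 3 * L ≤ L ^ 2 := by nlinarith
  have hL0 : 0 < L := by linarith
  have h1 : 10 ^ 6 * (Δ / (256 * G) + 1) * ((1 + a) * L ^ 2) * (θ * G / 2) ≤ K * (θ * G / 2) := by
    gcongr
  have h3 : 4 / 9 * (Δ / (256 * G) * (θ * G)) ≤ L ^ 2 * (Δ / (256 * G) * (θ * G)) := by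
    gcongr; nlinarith
  have h4 : a * (θ * N) = 1 / 144 := by linarith
  have h5 : L / 110592 ≤ L ^ 2 * (a * (Δ / (256 * G) + 1) * (θ * G)) := by
    rcases hcase with h | h
    · have h6 : 1 / 73728 ≤ a * (Δ / (256 * G) * (θ * G)) := by
        have : a * (Δ / (256 * G) * (θ * G)) = a * (θ * Δ) / 256 := by rw [e]; ring
        rw [this]
        have : a * (θ * (N / 2)) ≤ a * (θ * Δ) := by gcongr
        linarith
      have h7 : 0 ≤ a * (θ * G) := by positivity
      calc L / 110592 = 2 / 3 * L * (1 / 73728) := by ring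
        _ ≤ L ^ 2 * (a * (Δ / (256 * G) + 1) * (θ * G)) := by
          gcongr; linarith
    · have h6 : N ≤ L * (64 * G) := (div_le_iff₀ (by positivity)).1 h
      have h7 : a * (θ * N) ≤ a * (θ * (L * (64 * G))) := by gcongr
      have h8 : 1 / 9216 ≤ L * (a * (θ * G)) := by linarith
      have h9 : 0 ≤ a * (Δ / (256 * G)) * (θ * G) := by positivity
      calc L / 110592 ≤ L * (1 / 9216) := by linarith
        _ ≤ L * (L * (a * (θ * G))) := by gcongr
        _ ≤ L ^ 2 * (a * (Δ / (256 * G) + 1) * (θ * G)) := by nlinarith [sq_nonneg L]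
  set B := Δ / (256 * G)
  have h2 : L ^ 2 * (B * (θ * G)) + L ^ 2 * (a * (B + 1) * (θ * G)) ≤
      (B + 1) * ((1 + a) * L ^ 2) * (θ * G) := by
    have : 0 ≤ L ^ 2 * (θ * G) := by positivity
    nlinarith
  rw [e]
  have h6 : 0 ≤ B * (θ * G) := by positivity
  nlinarith

/-- The complementary case, with `θ = 1/(16G)`: the gap can be at most `N/2`, and the other half of
`θN` already exceeds `2L`. -/
lemma small_gap_budget_bound {Δ N G L a K : ℝ} (hΔ : 0 ≤ Δ) (hN : 0 < N) (hG : 0 < G) (ha : 0 ≤ a)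
    (hL : 2 / 3 ≤ L) (hc1 : Δ < N / 2) (hc2 : L < N / (64 * G))
    (hK : 10 ^ 6 * (Δ / (256 * G) + 1) * ((1 + a) * L ^ 2) ≤ K) :
    -(K * (1 / 16)) + 1 / (16 * G) * Δ ≤ -(2 * L) ∧
      -(1 / (16 * G) * N) + 1 / (16 * G) * Δ ≤ -(2 * L) := by
  constructor
  · have e1 : 1 / (16 * G) * Δ = 16 * (Δ / (256 * G)) := by
      rw [mul_comm 16 G, mul_comm 256 G, one_div_mul_eq_div, ← mul_div_assoc, div_eq_div_iff
        (by positivity) (by positivity)]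
      ring
    have hB : 0 ≤ Δ / (256 * G) := by positivity
    rw [e1]
    set B := Δ / (256 * G)
    have h1 : (B + 1) * L ^ 2 ≤ (B + 1) * ((1 + a) * L ^ 2) := by
      gcongr
      exact le_mul_of_one_le_left (sq_nonneg L) (by linarith)
    have h2 : B * (4 / 9) ≤ B * L ^ 2 := by
      gcongr; nlinarith
    have h3 : 2 / 3 * L ≤ L ^ 2 := by nlinarith
    linarith
  · have h1 : 1 / (16 * G) * Δ ≤ 1 / (16 * G) * (N / 2) := by gcongr
    have h2 : 1 / (16 * G) * (N / 2) = 2 * (N / (64 * G)) := by field_simp; norm_num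
    linarith

lemma linear_budget_bound {Δ N G p K k : ℝ} (hΔ : 0 ≤ Δ) (hN : 0 < N) (hG : 0 < G) (hp : 0 < p)
    (hK : 10 ^ 6 * (Δ / (12 * N) + Δ / (256 * G) + 1) ≤ K * p)
    (hk : 10 ^ 6 * (Δ / (12 * N) + 1) ≤ k * p) :
    (Δ + min G N) / (min G N * (K + 1)) + Δ / (N * (k + 1)) ≤ p / 2 := by
  have hD : 0 < min G N := lt_min hG hN
  have hA : 0 ≤ Δ / (12 * N) := by positivity
  have hB : 0 ≤ Δ / (256 * G) := by positivity
  have hK0 : 0 < K := pos_of_mul_pos_left (lt_of_lt_of_le (by positivity) hK) hp.le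
  have hk0 : 0 < k := pos_of_mul_pos_left (lt_of_lt_of_le (by positivity) hk) hp.le
  have e1 : 256 * (Δ / (256 * G)) = Δ / G := by field_simp
  have e2 : 12 * (Δ / (12 * N)) = Δ / N := by field_simp
  have h1 : (Δ + min G N) / (min G N * (K + 1)) ≤ p / 4 := by
    rw [div_le_iff₀ (by positivity)]
    have h2 : Δ ≤ min G N * (256 * (Δ / (256 * G)) + 12 * (Δ / (12 * N))) := by
      rw [e1, e2]
      rcases min_cases G N with ⟨h, _⟩ | ⟨h, _⟩
      · rw [h, mul_add, mul_div_cancel₀ _ hG.ne']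
        exact le_add_of_nonneg_right (by positivity)
      · rw [h, mul_add, mul_div_cancel₀ _ hN.ne']
        exact le_add_of_nonneg_left (by positivity)
    have h3 : 256 * (Δ / (256 * G)) + 12 * (Δ / (12 * N)) + 1 ≤ p / 4 * (K + 1) := by linarith
    calc Δ + min G N ≤ min G N * (256 * (Δ / (256 * G)) + 12 * (Δ / (12 * N)) + 1) := by linarith
      _ ≤ min G N * (p / 4 * (K + 1)) := by gcongr
      _ = _ := by ring
  have h2 : Δ / (N * (k + 1)) ≤ p / 4 := by
    rw [div_le_iff₀ (by positivity)]
    calc Δ = N * (12 * (Δ / (12 * N))) := by rw [e2, mul_div_cancel₀ _ hN.ne']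
      _ ≤ N * (p / 4 * (k + 1)) := mul_le_mul_of_nonneg_left (by linarith) hN.le
      _ = _ := by ring
  linarith

lemma exp_neg_two_mul_log {p : ℝ} (hp : 0 < p) (hp1 : p < 1) :
    Real.exp (-(2 * Real.log (2 / p))) ≤ p / 4 := by
  have : -(2 * Real.log (2 / p)) = Real.log ((p / 2) ^ 2) := by
    rw [Real.log_pow, ← inv_div p 2, Real.log_inv]
    push_cast; ring
  rw [this, Real.exp_log (by positivity)]
  nlinarith

lemma two_thirds_le_log {p : ℝ} (hp : 0 < p) (hp1 : p < 1) : 2 / 3 ≤ Real.log (2 / p) := by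
  have h1 := Real.log_two_gt_d9
  have h2 : Real.log 2 ≤ Real.log (2 / p) := by
    apply Real.log_le_log two_pos
    rw [le_div_iff₀ hp]; linarith
  linarith

end Numerics

/-! ### Choice among the three potentials. -/

section Confidence

open scoped ENNReal

variable {d : ℕ} {f : Vec d → ℝ} {l ρ ε δ b p : ℝ}

lemma IsSmooth.runLaw_fails_le_of_budget (h : IsSmooth l ρ f) (hd : 0 < d) (hδl : δ ≤ l)
    (hρ : 0 < ρ) (hε : 0 < ε) (hδ : 0 < δ) (hp : 0 < p) (hp1 : p < 1) (o : Version) {q C₁ : ℝ}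
    {q' : ℝ≥0∞} (hq : ∀ x, stdGaussian (Vec d) {ξ | ¬ NCFCorrect l ρ δ q C₁ f ξ x} ≤ q')
    (hb : ∀ y, b ≤ f y) (x : Vec d) {K k : ℕ}
    (hK : 10 ^ 6 * (ρ ^ 2 * (f x - b) / δ ^ 3 + dimFactor o d * (l * (f x - b) / ε ^ 2) + 1) *
      confFactor ρ ε δ p ≤ K)
    (hk : 10 ^ 6 * (ρ ^ 2 * (f x - b) / δ ^ 3 + 1) * confFactor ρ ε δ p ≤ k) :
    runLaw d K {ω | Fails o l ρ ε δ q C₁ f K k ω x} ≤ K * q' + ENNReal.ofReal (p / 2) := by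
  have hl : 0 < l := hδ.trans_le hδl
  have hN := curvDecrease_pos hρ hδ
  have hG := gradDecrease_pos o hd hl hε
  have hκ := one_le_dimFactor o hd
  have hκ0 : 0 < dimFactor o d := by linarith
  have hΔ : 0 ≤ f x - b := sub_nonneg.2 (hb x)
  have eN : ρ ^ 2 * (f x - b) / δ ^ 3 = (f x - b) / (12 * curvDecrease ρ δ) := by
    unfold curvDecrease; field_simp
  have eG : dimFactor o d * (l * (f x - b) / ε ^ 2) = (f x - b) / (256 * gradDecrease o d l ε) := by
    unfold gradDecrease; field_simp
  have hL := two_thirds_le_log hp hp1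
  have hE := exp_neg_two_mul_log hp hp1
  rw [eN] at hk
  rw [eN, eG] at hK
  set N := curvDecrease ρ δ with hNd
  set G := gradDecrease o d l ε with hGd
  set L := Real.log (2 / p) with hLd
  set Δ := f x - b with hΔd
  have hA : 0 ≤ Δ / (12 * N) := by positivity
  have hB : 0 ≤ Δ / (256 * G) := by positivity
  have hD : 0 < min G N := lt_min hG hN
  rcases le_total (1 / p) ((1 + ρ ^ 2 * ε ^ 2 / δ ^ 4) * L ^ 2) with hΛ | hΛ
  · have eΛ : confFactor ρ ε δ p = 1 / p := min_eq_left hΛ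
    rw [eΛ] at hK hk
    refine (h.runLaw_fails_le_linear hd hl hρ hε hδ o hq hb hD (min_le_left _ _) (min_le_right _ _)
      K k x).trans (add_le_add le_rfl (ENNReal.ofReal_le_ofReal ?_))
    rw [mul_one_div, div_le_iff₀ hp] at hK hk
    have := linear_budget_bound hΔ hN hG hp hK hk
    linarith
  · have eΛ : confFactor ρ ε δ p = (1 + ρ ^ 2 * ε ^ 2 / δ ^ 4) * L ^ 2 := min_eq_right hΛ
    rw [eΛ] at hK hk
    set a := ρ ^ 2 * ε ^ 2 / δ ^ 4 with ha
    have ha0 : 0 ≤ a := by positivity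
    have hΛ0 : 0 ≤ (1 + a) * L ^ 2 := by positivity
    have hKG : 10 ^ 6 * (Δ / (256 * G) + 1) * ((1 + a) * L ^ 2) ≤ K := by
      refine le_trans ?_ hK
      gcongr; linarith
    have hKN : 10 ^ 6 * (Δ / (12 * N) + 1) * ((1 + a) * L ^ 2) ≤ K := by
      refine le_trans ?_ hK
      gcongr; linarith
    -- In the first case `θ = δ/(12ε²)` is the largest value tolerating the signed steps; otherwise
    -- `θ = 1/(16G)` is the largest allowed by the gradient moment.
    by_cases hcase : N / 2 ≤ Δ ∨ N / (64 * G) ≤ L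
    · have hθ : 0 < δ / (12 * ε ^ 2) := by positivity
      have haθ : 144 * (a * (δ / (12 * ε ^ 2) * N)) = 1 := by
        rw [ha, hNd, curvDecrease]; field_simp; norm_num
      have hθD : δ / (12 * ε ^ 2) * G ≤ 1 / 16 := by
        have : δ / (12 * ε ^ 2) * G = δ / (3072 * (l * dimFactor o d)) := by
          rw [hGd, gradDecrease]; field_simp; norm_num
        rw [this, div_le_div_iff₀ (by positivity) (by norm_num)]
        nlinarith
      refine (h.runLaw_fails_le_exp hd hl hρ hε hδ o hq hb (min_le_left _ _) (min_le_right _ _)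
        hθ.le le_rfl hθD K k x).trans (add_le_add le_rfl (ENNReal.ofReal_le_ofReal ?_))
      have b1 := grad_budget_bound hΔ hN hG hθ haθ hL hcase hKG
      have b2 := curv_budget_bound hΔ hN hθ haθ hL hKN
      have b3 := curv_budget_bound hΔ hN hθ haθ hL hk
      set θ := δ / (12 * ε ^ 2)
      rw [add_mul, ← Real.exp_add, ← Real.exp_add]
      have c1 : Real.exp (-(K * (θ * min G N / 2)) + θ * Δ) ≤ p / 4 := by
        refine le_trans (Real.exp_le_exp.2 ?_) hE
        rcases le_total G N with hGN | hGN
        · rw [min_eq_left hGN]; linarith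
        · rw [min_eq_right hGN]; linarith
      have c2 : Real.exp (-(k * (θ * N / 2)) + θ * Δ) ≤ p / 4 :=
        le_trans (Real.exp_le_exp.2 (by linarith)) hE
      linarith
    · obtain ⟨hc1, hc2⟩ := not_or.1 hcase
      rw [not_le] at hc1 hc2
      have hθ : 0 < 1 / (16 * G) := by positivity
      have hθG : 1 / (16 * G) * G = 1 / 16 := by field_simp
      refine (h.runLaw_fails_le_exp_sub hd hl hρ hε hδ o hq hb hθ.le hθG.le K k x).trans
        (add_le_add le_rfl (ENNReal.ofReal_le_ofReal ?_))
      rw [← hGd, ← hNd, ← hΔd, hθG, add_mul, ← Real.exp_add, ← Real.exp_add]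
      obtain ⟨c1, c2⟩ := small_gap_budget_bound hΔ hN hG ha0 hL hc1 hc2 hKG
      have e1 := (Real.exp_le_exp.2 c1).trans hE
      have e2 := (Real.exp_le_exp.2 c2).trans hE
      linarith

lemma four_ninths_le_confFactor (ρ ε δ : ℝ) (hp : 0 < p) (hp1 : p < 1) :
    4 / 9 ≤ confFactor ρ ε δ p := by
  have hL := two_thirds_le_log hp hp1
  refine le_min ?_ ?_
  · rw [le_div_iff₀ hp]; linarith
  · have : 0 ≤ ρ ^ 2 * ε ^ 2 / δ ^ 4 := by positivity
    nlinarith [sq_nonneg (Real.log (2 / p))]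

end Confidence

end ZO
end

noncomputable section
namespace ZO

/-! ### The number of queries -/

section Queries

variable {d : ℕ} {l ρ ε δ p Δ : ℝ}

lemma one_le_logTerm (hd : 0 < d) (hδ : 0 < δ) (hδl : δ ≤ l) (hρ : 0 < ρ) (hε : 0 < ε)
    (hp : 0 < p) (hp1 : p < 1) (hΔ : 0 ≤ Δ) : 1 ≤ logTerm d l ρ ε δ p Δ := by
  have hl : 0 < l := hδ.trans_le hδl
  have hd1 : (1 : ℝ) ≤ d := by exact_mod_cast hd
  have h1 : 1 ≤ (d : ℝ) / p := by rw [one_le_div hp]; linarith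
  have h2 : 1 ≤ l / δ := by rwa [one_le_div hδ]
  have hA : 0 ≤ ρ ^ 2 * Δ / δ ^ 3 := by positivity
  have hB : 0 ≤ l * Δ / ε ^ 2 := by positivity
  have h3 : 1 ≤ 1 + ρ ^ 2 * Δ / δ ^ 3 + l * Δ / ε ^ 2 := by linarith
  have h4 : Real.exp 1 ≤ 3 := by linarith [Real.exp_one_lt_d9]
  rw [logTerm, Real.le_log_iff_exp_le (by positivity)]
  calc Real.exp 1 ≤ 3 * 1 * 1 * 1 := by linarith
    _ ≤ _ := by gcongr

lemma log_ratio_le_logTerm (hd : 0 < d) (hδ : 0 < δ) (hδl : δ ≤ l) (hρ : 0 < ρ) (hε : 0 < ε)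
    (hp : 0 < p) (hp1 : p < 1) (hΔ : 0 ≤ Δ) :
    Real.log (l / δ) ≤ logTerm d l ρ ε δ p Δ := by
  have hl : 0 < l := hδ.trans_le hδl
  have hd1 : (1 : ℝ) ≤ d := by exact_mod_cast hd
  have h1 : 1 ≤ (d : ℝ) / p := by rw [one_le_div hp]; linarith
  have hA : 0 ≤ ρ ^ 2 * Δ / δ ^ 3 := by positivity
  have hB : 0 ≤ l * Δ / ε ^ 2 := by positivity
  have h3 : 1 ≤ 1 + ρ ^ 2 * Δ / δ ^ 3 + l * Δ / ε ^ 2 := by linarith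
  rw [logTerm]
  refine Real.log_le_log (by positivity) ?_
  calc l / δ = 1 * 1 * (l / δ) * 1 := by ring
    _ ≤ 3 * (d / p) * (l / δ) * (1 + ρ ^ 2 * Δ / δ ^ 3 + l * Δ / ε ^ 2) := by
      gcongr; norm_num

/-- The rounding unit is absorbed because `xy ≥ 4/9`. -/
lemma natCeil_le_mul {x y : ℝ} (hy : 4 / 9 ≤ y) (hx : 1 ≤ x) :
    (⌈10 ^ 6 * x * y⌉₊ : ℝ) ≤ (10 ^ 6 + 3) * (x * y) := by
  have h1 : (⌈10 ^ 6 * x * y⌉₊ : ℝ) < 10 ^ 6 * x * y + 1 := Nat.ceil_lt_add_one (by positivity)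
  have h2 : y ≤ x * y := le_mul_of_one_le_left (by linarith) hx
  linarith

/-- Since `Λ ≤ 1/p` and `κ ≤ d`, the ratio `dK/p` is polynomial in the argument of `logTerm`. -/
lemma log_confidence_le (o : Version) (hd : 0 < d) (hδ : 0 < δ) (hδl : δ ≤ l) (hρ : 0 < ρ)
    (hε : 0 < ε) (hp : 0 < p) (hp1 : p < 1) (hΔ : 0 ≤ Δ) {K : ℕ} (hK0 : 0 < K)
    (hK : K = iterations o d (10 ^ 6) l ρ ε δ p Δ) :
    Real.log (d / (p / K)) ≤ 65 * logTerm d l ρ ε δ p Δ := by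
  have hℓ := one_le_logTerm hd hδ hδl hρ hε hp hp1 hΔ
  have hl : 0 < l := hδ.trans_le hδl
  have hd1 : (1 : ℝ) ≤ d := by exact_mod_cast hd
  have hd0 : (0 : ℝ) < d := by linarith
  have hK1 : (0 : ℝ) < K := by exact_mod_cast hK0
  have h1 : 1 ≤ (d : ℝ) / p := by rw [one_le_div hp]; linarith
  have h2 : 1 ≤ l / δ := by rwa [one_le_div hδ]
  have hA : 0 ≤ ρ ^ 2 * Δ / δ ^ 3 := by positivity
  have hB : 0 ≤ l * Δ / ε ^ 2 := by positivity
  have hκ1 := one_le_dimFactor o hd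
  have hκd : dimFactor o d ≤ d := by
    cases o
    · exact hd1
    · exact le_rfl
  have hΛ := four_ninths_le_confFactor ρ ε δ hp hp1
  have hΛp : confFactor ρ ε δ p ≤ 1 / p := min_le_left _ _
  have hKle : (K : ℝ) ≤ (10 ^ 6 + 3) * ((ρ ^ 2 * Δ / δ ^ 3 + dimFactor o d * (l * Δ / ε ^ 2) + 1) *
      confFactor ρ ε δ p) := by
    rw [hK]
    exact natCeil_le_mul hΛ (by nlinarith)
  rw [logTerm] at hℓ ⊢
  set A := ρ ^ 2 * Δ / δ ^ 3
  set B := l * Δ / ε ^ 2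
  set Y := 3 * ((d : ℝ) / p) * (l / δ) * (1 + A + B) with hY
  have hY0 : 0 < Y := by positivity
  have hS : A + dimFactor o d * B + 1 ≤ d * (1 + A + B) := by
    have : dimFactor o d * B ≤ d * B := by gcongr
    nlinarith
  have hYge : (d : ℝ) / p * (1 + A + B) ≤ Y := by
    calc (d : ℝ) / p * (1 + A + B) = 1 * (d / p) * 1 * (1 + A + B) := by ring
      _ ≤ Y := by rw [hY]; gcongr; norm_num
  have hYge' : (d : ℝ) / p ≤ Y := by
    refine le_trans ?_ hYge
    exact le_mul_of_one_le_right (by positivity) (by linarith)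
  have hmain : (d : ℝ) / (p / K) ≤ 10 ^ 7 * Y ^ 2 := by
    calc (d : ℝ) / (p / K) = d / p * K := by field_simp
      _ ≤ d / p * ((10 ^ 6 + 3) * ((d * (1 + A + B)) * (1 / p))) := by
        gcongr
        refine hKle.trans ?_
        gcongr
      _ = (10 ^ 6 + 3) * (d / p * (d / p * (1 + A + B))) := by ring
      _ ≤ 10 ^ 7 * (Y * Y) := by gcongr; norm_num
      _ = _ := by ring
  calc Real.log (d / (p / K)) ≤ Real.log (10 ^ 7 * Y ^ 2) :=
        Real.log_le_log (by positivity) hmain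
    _ = 7 * Real.log 10 + 2 * Real.log Y := by
        rw [Real.log_mul (by positivity) (by positivity), Real.log_pow, Real.log_pow]
        push_cast; ring
    _ ≤ 7 * 9 + 2 * Real.log Y := by
        gcongr
        linarith [Real.log_le_sub_one_of_pos (show (0 : ℝ) < 10 by norm_num)]
    _ ≤ 65 * Real.log Y := by linarith

lemma queries_le (o : Version) (hd : 0 < d) (hδ : 0 < δ) (hδl : δ ≤ l) (hρ : 0 < ρ)
    (hε : 0 < ε) (hp : 0 < p) (hp1 : p < 1) (hΔ : 0 ≤ Δ) {K k : ℕ} (hK0 : 0 < K)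
    (hK : K = iterations o d (10 ^ 6) l ρ ε δ p Δ)
    (hk : k = ⌈10 ^ 6 * (ρ ^ 2 * Δ / δ ^ 3 + 1) * confFactor ρ ε δ p⌉₊) :
    ((4 * d * K + 4 * d * ncfT d l δ (p / K) (ncfConst 20 l δ) * (k + 1) : ℕ) : ℝ) ≤
      10 ^ 12 * queryTerm o d l ρ ε δ Δ * confFactor ρ ε δ p * logTerm d l ρ ε δ p Δ ^ 3 := by
  have hℓ := one_le_logTerm hd hδ hδl hρ hε hp hp1 hΔ
  have hlog := log_ratio_le_logTerm hd hδ hδl hρ hε hp hp1 hΔ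
  have hlogq := log_confidence_le o hd hδ hδl hρ hε hp hp1 hΔ hK0 hK
  have hl : 0 < l := hδ.trans_le hδl
  have hd0 : (0 : ℝ) < d := by exact_mod_cast hd
  have hA : 0 ≤ ρ ^ 2 * Δ / δ ^ 3 := by positivity
  have hB : 0 ≤ l * Δ / ε ^ 2 := by positivity
  have hκ1 := one_le_dimFactor o hd
  have hΛ := four_ninths_le_confFactor ρ ε δ hp hp1
  have hlog0 : 0 ≤ Real.log (l / δ) := Real.log_nonneg (by rwa [one_le_div hδ])
  have hR : 1 ≤ √l / √δ := by
    rw [one_le_div (Real.sqrt_pos.2 hδ)]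
    exact Real.sqrt_le_sqrt hδl
  have hKle : (K : ℝ) ≤ (10 ^ 6 + 3) * ((ρ ^ 2 * Δ / δ ^ 3 + dimFactor o d * (l * Δ / ε ^ 2) + 1) *
      confFactor ρ ε δ p) := by
    rw [hK]
    exact natCeil_le_mul hΛ (by nlinarith)
  have hkle : (k : ℝ) ≤ (10 ^ 6 + 3) * ((ρ ^ 2 * Δ / δ ^ 3 + 1) * confFactor ρ ε δ p) := by
    rw [hk]
    exact natCeil_le_mul hΛ (by linarith)
  set ℓ := logTerm d l ρ ε δ p Δ
  set Λ := confFactor ρ ε δ p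
  -- Two logarithms come from `C₁²` and one from `log(d/q)`, hence the exponent three.
  have hT : (ncfT d l δ (p / K) (ncfConst 20 l δ) : ℝ) ≤ 104001 * ℓ ^ 3 * (√l / √δ) := by
    have hC : ncfConst 20 l δ ≤ 40 * ℓ := by unfold ncfConst; linarith
    have hC0 : 0 ≤ ncfConst 20 l δ := by unfold ncfConst; positivity
    have h1 : ncfConst 20 l δ ^ 2 * Real.log (d / (p / K)) * √l / √δ ≤
        104000 * ℓ ^ 3 * (√l / √δ) := by
      rw [mul_div_assoc]
      refine mul_le_mul_of_nonneg_right ?_ (by positivity)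
      calc _ ≤ ncfConst 20 l δ ^ 2 * (65 * ℓ) := by gcongr
        _ ≤ (40 * ℓ) ^ 2 * (65 * ℓ) := by gcongr
        _ = _ := by ring
    have h2 := (Nat.ceil_lt_add_one (show 0 ≤ 104000 * ℓ ^ 3 * (√l / √δ) by positivity)).le
    have h3 : (ncfT d l δ (p / K) (ncfConst 20 l δ) : ℝ) ≤ (⌈104000 * ℓ ^ 3 * (√l / √δ)⌉₊ : ℝ) := by
      exact_mod_cast Nat.ceil_mono h1
    have h4 : 1 ≤ ℓ ^ 3 * (√l / √δ) := one_le_mul_of_one_le_of_one_le (one_le_pow₀ hℓ) hR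
    linarith
  rw [queryTerm]
  set A := ρ ^ 2 * Δ / δ ^ 3
  set B := l * Δ / ε ^ 2
  set R := √l / √δ
  set κ := dimFactor o d
  push_cast
  have hk1 : (k : ℝ) + 1 ≤ (10 ^ 6 + 6) * ((A + 1) * Λ) := by
    have : Λ ≤ (A + 1) * Λ := le_mul_of_one_le_left (by linarith) (by linarith)
    linarith
  have hℓ3 : 1 ≤ ℓ ^ 3 := one_le_pow₀ hℓ
  have hRℓ : 1 ≤ ℓ ^ 3 * R := one_le_mul_of_one_le_of_one_le hℓ3 hR
  have hκ0 : 0 ≤ κ := by linarith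
  have hΛ0 : 0 ≤ Λ := by linarith
  have e1 : κ * B * Λ ≤ κ * B * Λ * ℓ ^ 3 := le_mul_of_one_le_right (by positivity) hℓ3
  have e2 : (A + 1) * Λ ≤ (A + 1) * Λ * (ℓ ^ 3 * R) := le_mul_of_one_le_right (by positivity) hRℓ
  have e3 : 0 ≤ κ * B * Λ * ℓ ^ 3 := by positivity
  have e4 : 0 ≤ (A + 1) * Λ * (ℓ ^ 3 * R) := by positivity
  calc 4 * d * K + 4 * d * (ncfT d l δ (p / K) (ncfConst 20 l δ) : ℝ) * (k + 1)
      ≤ 4 * d * ((10 ^ 6 + 3) * ((A + κ * B + 1) * Λ)) +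
          4 * d * (104001 * ℓ ^ 3 * R) * ((10 ^ 6 + 6) * ((A + 1) * Λ)) := by gcongr
    _ = d * (4 * (10 ^ 6 + 3) * (κ * B * Λ + (A + 1) * Λ) +
          4 * 104001 * (10 ^ 6 + 6) * ((A + 1) * Λ * (ℓ ^ 3 * R))) := by ring
    _ ≤ d * (10 ^ 12 * (κ * B * Λ * ℓ ^ 3 + (A + 1) * Λ * (ℓ ^ 3 * R))) := by
      gcongr
      linarith
    _ = _ := by ring

end Queries

end ZO
end

/-! ### Assembly. -/

theorem mainTheorem1 :
    ∃ (c₁ cK cQ : ℝ) (m : ℕ), 0 < c₁ ∧ 0 < cK ∧ 0 < cQ ∧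
      ∀ (o : ZO.Version) (d n : ℕ), 0 < d → 0 < n →
      ∀ (fs : Fin n → ZO.Vec d → ℝ) (l ρ ε δ p : ℝ) (x₀ : ZO.Vec d),
        0 < ρ → 0 < ε → 0 < δ → δ ≤ l → 0 < p → p < 1 →
        (∀ i, ZO.TwiceDifferentiable (fs i) ∧ ZO.LipschitzSmooth l (fs i) ∧
          ZO.HessianLipschitz ρ (fs i)) →
        BddBelow (Set.range (ZO.finiteSum fs)) →
        ∀ (Δ : ℝ) (K : ℕ), Δ = ZO.finiteSum fs x₀ - ⨅ x, ZO.finiteSum fs x →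
          K = ZO.iterations o d cK l ρ ε δ p Δ →
          ENNReal.ofReal (1 - p) ≤
            ZO.runLaw d K {ω | ∃ x : ZO.Vec d,
              (ZO.zoGDNCF o l ρ ε δ p (ZO.ncfConst c₁ l δ) K ω x₀).eval
                (ZO.finiteSum fs) = some x ∧
              ZO.IsSOSP ε δ (ZO.finiteSum fs) x ∧
              ((ZO.zoGDNCF o l ρ ε δ p (ZO.ncfConst c₁ l δ) K ω x₀).cost
                (ZO.finiteSum fs) : ℝ) ≤
                cQ * ZO.queryTerm o d l ρ ε δ Δ * ZO.confFactor ρ ε δ p *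
                  ZO.logTerm d l ρ ε δ p Δ ^ m} := by
  refine ⟨20, 10 ^ 6, 10 ^ 12, 3, by norm_num, by norm_num, by norm_num, ?_⟩
  intro o d n hd hn fs l ρ ε δ p x₀ hρ hε hδ hδl hp hp1 hfs hbdd Δ K hΔ hK
  have h : ZO.IsSmooth l ρ (ZO.finiteSum fs) :=
    ZO.IsSmooth.finiteSum hn fun i => ⟨(hfs i).1, (hfs i).2.1, (hfs i).2.2⟩
  set f := ZO.finiteSum fs
  have hb : ∀ y, (⨅ x, f x) ≤ f y := fun y => ciInf_le hbdd y
  have hΔ0 : 0 ≤ Δ := hΔ ▸ sub_nonneg.2 (hb x₀)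
  have hl : 0 < l := hδ.trans_le hδl
  have hΛ := ZO.four_ninths_le_confFactor ρ ε δ hp hp1
  have hκ := ZO.one_le_dimFactor o hd
  have hS : 1 ≤ ρ ^ 2 * Δ / δ ^ 3 + ZO.dimFactor o d * (l * Δ / ε ^ 2) + 1 :=
    le_add_of_nonneg_left (by positivity)
  have hKle : 10 ^ 6 * (ρ ^ 2 * Δ / δ ^ 3 + ZO.dimFactor o d * (l * Δ / ε ^ 2) + 1) *
      ZO.confFactor ρ ε δ p ≤ K := by
    rw [hK]
    exact Nat.le_ceil _
  -- This forces `q = p/K ≤ 1/10`, as the analysis of the curvature calls requires.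
  have hK10 : (10 : ℝ) ≤ K := by
    refine le_trans ?_ hKle
    nlinarith [mul_le_mul hS hΛ (by norm_num) (by linarith)]
  have hK0 : (0 : ℝ) < K := by linarith
  set k := ⌈10 ^ 6 * (ρ ^ 2 * Δ / δ ^ 3 + 1) * ZO.confFactor ρ ε δ p⌉₊ with hk
  have hq10 : p / K ≤ 1 / 10 := by
    rw [div_le_div_iff₀ hK0 (by norm_num)]
    linarith
  have hfail : ZO.runLaw d K {ω | ZO.Fails o l ρ ε δ (p / K) (ZO.ncfConst 20 l δ) f K k ω x₀} ≤
      ENNReal.ofReal p := by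
    refine (h.runLaw_fails_le_of_budget hd hδl hρ hε hδ hp hp1 o
      (fun x => ZO.stdGaussian_not_ncfCorrect_le hd h hρ hδ hδl (by positivity) hq10 x) hb x₀
      (by rw [← hΔ]; exact hKle) (by rw [← hΔ]; exact Nat.le_ceil _)).trans ?_
    rw [← ENNReal.ofReal_natCast, ← ENNReal.ofReal_mul hK0.le,
      ← ENNReal.ofReal_add (by positivity) (by positivity)]
    refine ENNReal.ofReal_le_ofReal ?_
    -- All curvature calls together err with probability at most `p/4`, and the potential adds
    -- `p/2`.
    have : (K : ℝ) * (p / K / 4) = p / 4 := by field_simp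
    linarith
  have hprob : IsProbabilityMeasure (ZO.runLaw d K) := by
    have := ZO.isProbabilityMeasure_seedLaw hd
    unfold ZO.runLaw
    infer_instance
  rw [ENNReal.ofReal_sub _ hp.le, ENNReal.ofReal_one, tsub_le_iff_right]
  refine le_trans ?_ (add_le_add le_rfl hfail)
  rw [← measure_univ (μ := ZO.runLaw d K)]
  -- Subadditivity holds for arbitrary sets, so the success event need not be measurable.
  refine (measure_mono fun ω _ => ?_).trans (measure_union_le _ _)
  by_cases hω : ZO.Fails o l ρ ε δ (p / K) (ZO.ncfConst 20 l δ) f K k ω x₀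
  · exact Or.inr hω
  · obtain ⟨⟨y, hy, hs⟩, hcost⟩ := ZO.gdLoop_of_not_fails hd K k ω x₀ hω
    exact Or.inl ⟨y, hy, hs, (Nat.cast_le.2 hcost).trans
      (ZO.queries_le o hd hδ hδl hρ hε hp hp1 hΔ0 (Nat.cast_pos.1 hK0) hK hk)⟩
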